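/- **Setting.** Let $d\ge 1$ and let $\Omega\subset\mathbb R^d$ be a $d$-dimensional polytope, where a $0$-dimensional polytope is a point and, for $n\ge1$, an $n$-dimensional polytope is a relatively open, bounded, connected, Lipschitz subset of an $n$-dimensional affine subspace whose relative boundary is a finite union of closures of $(n-1)$-dimensional polytopes. Let $\mathbf n$ be the outward unit normal of $\Omega$, and let $\partial\Omega=\Gamma_D\cup\Gamma_N$ with $\Gamma_D\cap\Gamma_N=\emptyset$. Let $K\in[L^\infty(\Omega)]^{d\times d}$, $\beta\in[W^{1,\infty}(\Omega)]^d$, $\sigma\in L^\infty(\Omega)$, and suppose there are $k_{\min}>0$ and $\sigma_0>0$ with $$\xi^TK(x)\xi\ge k_{\min}|\xi|^2\quad\forall\xi\in\mathbb R^d,\qquad \sigma(x)+\tfrac12\operatorname{div}\beta(x)\ge\sigma_0\qquad\text{for a.e. }x\in\Omega .$$ If $\beta\neq0$, suppose moreover that $\beta\cdot\mathbf n<0$ a.e. on $\Gamma_D$ and $\beta\cdot\mathbf n\ge0$ a.e. on $\Gamma_N$. Write $\|K\|_\infty$ for the essential supremum over $\Omega$ of the Euclidean operator norm of $K(x)$.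 **Meshes.** Let $\{\mathcal T_h\}_h$ be a family of conforming polytopic meshes of $\Omega$: each $\mathcal T_h$ is a finite set of disjoint $d$-dimensional polytopes with $\overline\Omega=\bigcup_{T\in\mathcal T_h}\overline T$. Its set of facets $\mathcal E_h$ is a finite set of non-overlapping closures of $(d-1)$-dimensional polytopes such that each $\partial T$ is the union of $\mathcal F_T=\{e\in\mathcal E_h: e\subseteq\partial T\}$, and every facet is either interior ($e=\partial T_1\cap\partial T_2$ for two distinct elements; set $\mathcal E_h^I$) or a boundary facet ($e\subseteq\partial T\cap\partial\Omega$). Every boundary facet lies, up to a set of zero surface measure, in $\Gamma_D$ (set $\mathcal E_h^D$) or in $\Gamma_N$ (set $\mathcal E_h^N$). Let $h_T,h_e$ be the diameters of $T,e$, let $\mathbf n_T$ be the outward unit normal of $T$ and $\mathbf n_e$ a unit normal of $e$. Assume that, with constants $r\in(0,\frac12]$ and $C_g>0$ independent of $h$, every element $T$ is star-shaped with respect to a ball of radius $r h_T$ centred in $T$, and $h_T\le C_g h_e$ for all $e\in\mathcal F_T$; and that $\operatorname{card}\mathcal F_T\le N_\partial$ for all $T$ and all $h$. Assume also that $K|_T$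 has a trace almost everywhere on $\partial T$ for all $T\in\mathcal T_h$, i.e. for a.e. $x\in\partial T$ there is a matrix $A$ such that the mean of $|K-A|$ over $T\cap B(x,\rho)$ tends to $0$ as $\rho\to0$. On $e=\partial T_1\cap\partial T_2$ put $\{w\}=\frac12(w|_{T_1}+w|_{T_2})$ and $[v]=v|_{T_1}\mathbf n_{T_1}+v|_{T_2}\mathbf n_{T_2}$; on a boundary facet $e\subseteq\partial T$ put $\{w\}=w|_T$ and $[v]=v|_T\mathbf n_T$. **Forms and norms.** Let $p\in\mathbb N$ and let $V_h\subseteq\mathbb P^p_d(\mathcal T_h)$ be a subspace of the space of functions that are polynomials of total degree at most $p$ on each $T\in\mathcal T_h$. For $\epsilon\in\{-1,0,1\}$ and $\gamma>0$ let $a_h^{dar}=a_h^d+a_h^{ar}$ with $$\begin{aligned}a_h^d(w,v)=&\sum_{T\in\mathcal T_h}\int_TK\nabla w\cdot\nabla v-\sum_{e\in\mathcal E_h^I}\int_e\{K\nabla w\}\cdot[v]+\epsilon\sum_{e\in\mathcal E_h^I}\int_e[w]\cdot\{K\nabla v\}-\sum_{e\in\mathcal E_h^D}\int_eK\nabla w\cdot\mathbf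 n\,v\\&+\epsilon\sum_{e\in\mathcal E_h^D}\int_ew\,K\nabla v\cdot\mathbf n+\sum_{e\in\mathcal E_h^I}\frac{\gamma}{h_e}\int_e[w]\cdot[v]+\sum_{e\in\mathcal E_h^D}\frac{\gamma}{h_e}\int_ewv,\\ a_h^{ar}(w,v)=&-\sum_{T\in\mathcal T_h}\int_T\beta w\cdot\nabla v+\sum_{T\in\mathcal T_h}\int_T\sigma wv+\sum_{e\in\mathcal E_h^I}\int_e\{\beta w\}\cdot[v]+\frac12\sum_{e\in\mathcal E_h^I}\int_e|\beta\cdot\mathbf n_e|\,[w]\cdot[v]+\sum_{e\in\mathcal E_h^N}\int_e\beta w\cdot\mathbf n\,v,\end{aligned}$$ and $$|||v|||_{dar}^2=\sum_{T\in\mathcal T_h}\int_TK\nabla v\cdot\nabla v+\sum_{e\in\mathcal E_h^I}\frac\gamma{h_e}\int_e|[v]|^2+\sum_{e\in\mathcal E_h^D}\frac\gamma{h_e}\int_ev^2+\|v\|_{L^2(\Omega)}^2+\frac12\sum_{e\in\mathcal E_h}\int_e|\beta\cdot\mathbf n_e|\,|[v]|^2 .$$ **Claim (discrete coercivity).** There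 exists $C_{tr}>0$ such that $$\|v\|_{L^2(\partial T)}^2\le C_{tr}h_T^{-1}\|v\|_{L^2(T)}^2\quad\text{for all }h,\ \text{all }T\in\mathcal T_h\text{ and all polynomials }v\text{ of degree at most }p .$$ For every such $C_{tr}$ and every $\epsilon\in\{-1,0,1\}$ put $\gamma_1=0$, $\gamma_0=\|K\|_\infty^2\frac{N_\partial C_{tr}}{4k_{\min}}$, $\gamma_{-1}=\|K\|_\infty^2\frac{N_\partial C_{tr}}{k_{\min}}$. Then for every $\gamma>\gamma_\epsilon$ the number $\alpha=\min\{1,\sigma_0,\alpha_d\}$, where $\alpha_d=1$ if $\epsilon=1$ and $$\alpha_d=1+\tfrac12(\epsilon-1)\|K\|_\infty\Bigl(\frac{N_\partial C_{tr}}{\gamma k_{\min}}\Bigr)^{1/2}\quad\text{if }\epsilon\in\{0,-1\},$$ is positive, does not depend on $h$, and satisfies $$a_h^{dar}(v_h,v_h)\ge\alpha\,|||v_h|||_{dar}^2\qquad\text{for all }h\text{ and all }v_h\in V_h .$$ -/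

import Mathlib

open MeasureTheory Filter Topology Set Metric
open scoped ENNReal ContDiff RealInnerProductSpace

noncomputable section

namespace DG

/-- The ambient Euclidean space `ℝ^d`. -/
abbrev Space (d : ℕ) : Type := EuclideanSpace ℝ (Fin d)

/-! ### Polytopes -/

/-- `P` is a Lipschitz subset of the affine subspace `A`: near every point of its relative boundary,
and inside `A`, it is the strict subgraph of a Lipschitz function in some unit direction `u` of `A`.
The argument `y - ⟪u, y⟫ u` of the function is the component of `y` orthogonal to `u`. -/
def IsLipschitzIn {d : ℕ} (A : AffineSubspace ℝ (Space d)) (P : Set (Space d)) : Prop :=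
  ∀ x ∈ closure P \ P, ∃ u ∈ A.direction, ‖u‖ = 1 ∧
    ∃ (L : NNReal) (φ : Space d → ℝ), LipschitzWith L φ ∧
      ∃ r > 0, ∀ y ∈ A, y ∈ ball x r → (y ∈ P ↔ ⟪u, y⟫ < φ (y - ⟪u, y⟫ • u))

/-- `n`-dimensional polytopes of `ℝ^d`, by recursion on `n`: a `0`-dimensional polytope is a single
point; an `(n+1)`-dimensional polytope is a relatively open, bounded, connected (in particular
nonempty), Lipschitz subset of an `(n+1)`-dimensional affine subspace whose relative boundary
`closure P \ P` is a finite union of closures of `n`-dimensional polytopes. -/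
def IsPolytope {d : ℕ} : ℕ → Set (Space d) → Prop
  | 0, P => ∃ x, P = {x}
  | n + 1, P =>
    ∃ A : AffineSubspace ℝ (Space d), Module.finrank ℝ A.direction = n + 1 ∧
      (∃ U : Set (Space d), IsOpen U ∧ P = (A : Set (Space d)) ∩ U) ∧
      Bornology.IsBounded P ∧ IsConnected P ∧ IsLipschitzIn A P ∧
      ∃ 𝓕 : Set (Set (Space d)), 𝓕.Finite ∧ (∀ F ∈ 𝓕, IsPolytope n F) ∧
        closure P \ P = ⋃ F ∈ 𝓕, closure F

/-! ### Normals, traces, weak derivatives -/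

/-- `n` is the outward unit normal to `T` at `x`: near `x`, the set `T` is the open half-space of
points `y` with `(y - x) · n < 0`. For a Lipschitz polytope this describes the normal at all
relative interior points of facets, hence at almost every boundary point. -/
def IsOutwardNormal {d : ℕ} (T : Set (Space d)) (x n : Space d) : Prop :=
  ‖n‖ = 1 ∧ ∀ᶠ y in 𝓝 x, (y ∈ T ↔ ⟪y - x, n⟫ < 0)

open scoped Classical in
/-- The outward unit normal `n_T(x)` (zero at the points where there is none). -/
def outwardNormal {d : ℕ} (T : Set (Space d)) (x : Space d) : Space d :=
  if h : ∃ n, IsOutwardNormal T x n then h.choose else 0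

/-- `f` restricted to `T` has the trace value `a` at `x`: the mean of `‖f - a‖` over
`T ∩ B(x, r)` tends to `0` as `r → 0`. -/
def HasTraceAt {d : ℕ} {F : Type*} [NormedAddCommGroup F]
    (T : Set (Space d)) (f : Space d → F) (x : Space d) (a : F) : Prop :=
  Tendsto (fun r : ℝ => ⨍ y in ball x r ∩ T, ‖f y - a‖) (𝓝[>] 0) (𝓝 0)

/-- The value at `x` of the trace of `f` restricted to `T`, i.e. the limit as `r → 0` of the means
of `f` over `T ∩ B(x, r)`. It is the limit of `f` at `x` from within `T` when this limit exists. -/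
def trace {d : ℕ} {F : Type*} [NormedAddCommGroup F] [NormedSpace ℝ F]
    (T : Set (Space d)) (f : Space d → F) (x : Space d) : F :=
  limUnder (𝓝[>] (0 : ℝ)) (fun r : ℝ => ⨍ y in ball x r ∩ T, f y)

/-- `g` is the weak partial derivative of `f` on `Ω` in the `i`-th direction. -/
def HasWeakPartial {d : ℕ} (Ω : Set (Space d)) (f : Space d → ℝ) (i : Fin d)
    (g : Space d → ℝ) : Prop :=
  ∀ φ : Space d → ℝ, ContDiff ℝ ∞ φ → HasCompactSupport φ → tsupport φ ⊆ Ω →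
    ∫ x in Ω, f x * fderiv ℝ φ x (EuclideanSpace.single i 1) = -∫ x in Ω, g x * φ x

/-- The Sobolev space `W^{1,∞}(Ω)`. -/
def MemW1Infty {d : ℕ} (Ω : Set (Space d)) (f : Space d → ℝ) : Prop :=
  MemLp f ∞ (volume.restrict Ω) ∧
    ∀ i, ∃ g, MemLp g ∞ (volume.restrict Ω) ∧ HasWeakPartial Ω f i g

open scoped Classical in
/-- The weak partial derivative, for functions of `W^{1,∞}(Ω)` (unique up to a null set). -/
def weakPartial {d : ℕ} (Ω : Set (Space d)) (f : Space d → ℝ) (i : Fin d) : Space d → ℝ :=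
  if h : ∃ g, MemLp g ∞ (volume.restrict Ω) ∧ HasWeakPartial Ω f i g then h.choose else 0

/-- The weak divergence of a vector field in `[W^{1,∞}(Ω)]^d`. -/
def weakDiv {d : ℕ} (Ω : Set (Space d)) (β : Space d → Space d) (x : Space d) : ℝ :=
  ∑ i, weakPartial Ω (fun y => β y i) i x

/-! ### Meshes -/

/-- The facet `e` is the whole common boundary of two distinct elements of the family `elems`. -/
def IsInteriorFacet {d : ℕ} (elems : Finset (Set (Space d))) (e : Set (Space d)) : Prop :=
  ∃ T₁ ∈ elems, ∃ T₂ ∈ elems, T₁ ≠ T₂ ∧ e = frontier T₁ ∩ frontier T₂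

/-- The facet `e` lies on the boundary of an element and on the boundary of the domain. -/
def IsBoundaryFacet {d : ℕ} (Ω : Set (Space d)) (elems : Finset (Set (Space d)))
    (e : Set (Space d)) : Prop :=
  ∃ T ∈ elems, e ⊆ frontier T ∩ frontier Ω

/-- A polytopic mesh of `Ω` together with its set of mesh facets and a choice of facet normals.
A polytope does not determine the decomposition of its boundary into facets, so the facets are data:
closures of `(d-1)`-dimensional polytopes which make up the element boundaries and do not overlap.
Conformity enters as the property that every facet is either the whole common boundary of two
elements or a piece of the boundary of `Ω`; nothing is asked of the lower-dimensional faces. -/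
structure Mesh {d : ℕ} (Ω : Set (Space d)) where
  /-- the mesh elements -/
  elems : Finset (Set (Space d))
  elem_polytope : ∀ T ∈ elems, IsPolytope d T
  elem_disjoint : ∀ T ∈ elems, ∀ T' ∈ elems, T ≠ T' → Disjoint T T'
  cover : closure Ω = ⋃ T ∈ elems, closure T
  /-- the mesh facets -/
  facets : Finset (Set (Space d))
  facet_polytope : ∀ e ∈ facets, ∃ F, IsPolytope (d - 1) F ∧ e = closure F
  facet_nonoverlap : ∀ e ∈ facets, ∀ e' ∈ facets, e ≠ e' → μHE[d - 1] (e ∩ e') = 0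
  frontier_eq : ∀ T ∈ elems, frontier T = ⋃ e ∈ facets, ⋃ _ : e ⊆ frontier T, e
  conforming : ∀ e ∈ facets, IsInteriorFacet elems e ∨ IsBoundaryFacet Ω elems e
  /-- the unit normal `n_e` of a facet, with an arbitrary orientation -/
  normal : Set (Space d) → Space d
  normal_unit : ∀ e ∈ facets, ‖normal e‖ = 1
  normal_orthogonal : ∀ e ∈ facets, ∀ x ∈ e, ∀ y ∈ e, ⟪x - y, normal e⟫ = 0

namespace Mesh

variable {d : ℕ} {Ω : Set (Space d)}

open scoped Classical in
/-- The set `F_T` of the facets of the element `T`. -/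
def facetsOf (M : Mesh Ω) (T : Set (Space d)) : Finset (Set (Space d)) :=
  M.facets.filter fun e => e ⊆ frontier T

/-- The maximal number `N_∂` of facets of a mesh element. -/
def maxFacets (M : Mesh Ω) : ℕ :=
  M.elems.sup fun T => (M.facetsOf T).card

open scoped Classical in
/-- The elements adjacent to a facet: two for an interior facet, one for a boundary facet. -/
def adjacent (M : Mesh Ω) (e : Set (Space d)) : Finset (Set (Space d)) :=
  M.elems.filter fun T => e ⊆ frontier T

open scoped Classical in
/-- The interior facets. -/
def interiorFacets (M : Mesh Ω) : Finset (Set (Space d)) :=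
  M.facets.filter (IsInteriorFacet M.elems)

open scoped Classical in
/-- The boundary facets. -/
def boundaryFacets (M : Mesh Ω) : Finset (Set (Space d)) :=
  M.facets.filter (IsBoundaryFacet Ω M.elems)

open scoped Classical in
/-- The boundary facets on `Γ'` (that is, contained in `Γ'` up to a set of zero surface measure:
a closed facet may have boundary points in common with another part of the boundary). -/
def boundaryFacetsOn (M : Mesh Ω) (Γ' : Set (Space d)) : Finset (Set (Space d)) :=
  M.boundaryFacets.filter fun e => μHE[d - 1] (e \ Γ') = 0

/-- The average on a facet: the arithmetic mean of the traces from the adjacent elements, i.e.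
`(f|_{T₁} + f|_{T₂}) / 2` on interior facets and the trace `f|_T` on boundary facets. -/
def avg {F : Type*} [NormedAddCommGroup F] [NormedSpace ℝ F] (M : Mesh Ω)
    (e : Set (Space d)) (f : Space d → F) (x : Space d) : F :=
  ((M.adjacent e).card : ℝ)⁻¹ • ∑ T ∈ M.adjacent e, trace T f x

/-- The jump of a scalar function on a facet: `φ|_{T₁} n_{T₁} + φ|_{T₂} n_{T₂}` on interior facets
and `φ|_T n_T` on boundary facets. -/
def jump (M : Mesh Ω) (e : Set (Space d)) (φ : Space d → ℝ) (x : Space d) : Space d :=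
  ∑ T ∈ M.adjacent e, trace T φ x • outwardNormal T x

/-- The broken polynomial space `P^p_d(T_h)`: functions that on every mesh element agree with a
polynomial of total degree at most `p` (the values off the elements play no role). -/
def brokenPoly (M : Mesh Ω) (p : ℕ) : Submodule ℝ (Space d → ℝ) where
  carrier := {v | ∀ T ∈ M.elems, ∃ q : MvPolynomial (Fin d) ℝ, q.totalDegree ≤ p ∧
    ∀ x ∈ T, v x = MvPolynomial.eval (fun i => x i) q}
  add_mem' := by
    intro v w hv hw T hT
    obtain ⟨q, hq, hqv⟩ := hv T hT
    obtain ⟨q', hq', hqw⟩ := hw T hT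
    exact ⟨q + q', (MvPolynomial.totalDegree_add q q').trans (max_le hq hq'),
      fun x hx => by simp [hqv x hx, hqw x hx]⟩
  zero_mem' := fun T _ => ⟨0, by simp, fun x _ => by simp⟩
  smul_mem' := by
    intro c v hv T hT
    obtain ⟨q, hq, hqv⟩ := hv T hT
    exact ⟨c • q, (MvPolynomial.totalDegree_smul_le c q).trans hq,
      fun x hx => by simp [hqv x hx]⟩

/-! ### Bilinear forms and norms

The forms are evaluated on functions which are smooth in each element, so that the broken gradient
is the pointwise gradient inside the elements. -/

/-- The diffusion form `a_h^d(w, v)`. -/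
def aDiff (M : Mesh Ω) (K : Space d → Space d →L[ℝ] Space d) (ΓD : Set (Space d))
    (ε γ : ℝ) (w v : Space d → ℝ) : ℝ :=
  ∑ T ∈ M.elems, (∫ x in T, ⟪K x (gradient w x), gradient v x⟫)
  - ∑ e ∈ M.interiorFacets,
      (∫ x in e, ⟪M.avg e (fun y => K y (gradient w y)) x, M.jump e v x⟫ ∂μHE[d - 1])
  + ε * ∑ e ∈ M.interiorFacets,
      (∫ x in e, ⟪M.jump e w x, M.avg e (fun y => K y (gradient v y)) x⟫ ∂μHE[d - 1])
  - ∑ e ∈ M.boundaryFacetsOn ΓD,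
      (∫ x in e, ⟪M.avg e (fun y => K y (gradient w y)) x, outwardNormal Ω x⟫
        * M.avg e v x ∂μHE[d - 1])
  + ε * ∑ e ∈ M.boundaryFacetsOn ΓD,
      (∫ x in e, M.avg e w x *
        ⟪M.avg e (fun y => K y (gradient v y)) x, outwardNormal Ω x⟫ ∂μHE[d - 1])
  + ∑ e ∈ M.interiorFacets,
      γ / diam e * (∫ x in e, ⟪M.jump e w x, M.jump e v x⟫ ∂μHE[d - 1])
  + ∑ e ∈ M.boundaryFacetsOn ΓD,
      γ / diam e * (∫ x in e, M.avg e w x * M.avg e v x ∂μHE[d - 1])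

/-- The advection-reaction form `a_h^{ar}(w, v)`. In `|β · n_e|` the field `β` is evaluated through
its continuous representative `trace Ω β` on the closure of `Ω`. -/
def aAdvReac (M : Mesh Ω) (β : Space d → Space d) (σ : Space d → ℝ) (ΓN : Set (Space d))
    (w v : Space d → ℝ) : ℝ :=
  - ∑ T ∈ M.elems, (∫ x in T, ⟪w x • β x, gradient v x⟫)
  + ∑ T ∈ M.elems, (∫ x in T, σ x * w x * v x)
  + ∑ e ∈ M.interiorFacets,
      (∫ x in e, ⟪M.avg e (fun y => w y • β y) x, M.jump e v x⟫ ∂μHE[d - 1])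
  + 1 / 2 * ∑ e ∈ M.interiorFacets,
      (∫ x in e, |⟪trace Ω β x, M.normal e⟫| * ⟪M.jump e w x, M.jump e v x⟫ ∂μHE[d - 1])
  + ∑ e ∈ M.boundaryFacetsOn ΓN,
      (∫ x in e, ⟪M.avg e (fun y => w y • β y) x, outwardNormal Ω x⟫ * M.avg e v x ∂μHE[d - 1])

/-- The diffusion-advection-reaction form `a_h^{dar} = a_h^d + a_h^{ar}`. -/
def aDar (M : Mesh Ω) (K : Space d → Space d →L[ℝ] Space d) (β : Space d → Space d)
    (σ : Space d → ℝ) (ΓD ΓN : Set (Space d)) (ε γ : ℝ) (w v : Space d → ℝ) : ℝ :=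
  M.aDiff K ΓD ε γ w v + M.aAdvReac β σ ΓN w v

/-- The squared jump seminorm `|v|_J²`. -/
def jumpSq (M : Mesh Ω) (ΓD : Set (Space d)) (γ : ℝ) (v : Space d → ℝ) : ℝ :=
  ∑ e ∈ M.interiorFacets, γ / diam e * (∫ x in e, ‖M.jump e v x‖ ^ 2 ∂μHE[d - 1])
  + ∑ e ∈ M.boundaryFacetsOn ΓD, γ / diam e * (∫ x in e, M.avg e v x ^ 2 ∂μHE[d - 1])

/-- The squared diffusion norm `|||v|||_d²`. -/
def normDiffSq (M : Mesh Ω) (K : Space d → Space d →L[ℝ] Space d) (ΓD : Set (Space d))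
    (γ : ℝ) (v : Space d → ℝ) : ℝ :=
  (∑ T ∈ M.elems, (∫ x in T, ⟪K x (gradient v x), gradient v x⟫)) + M.jumpSq ΓD γ v

/-- The squared advection-reaction norm `|||v|||_{ar}²`; the second sum is over all facets. -/
def normAdvReacSq (M : Mesh Ω) (β : Space d → Space d) (v : Space d → ℝ) : ℝ :=
  (∫ x in Ω, v x ^ 2)
  + 1 / 2 * ∑ e ∈ M.facets,
      (∫ x in e, |⟪trace Ω β x, M.normal e⟫| * ‖M.jump e v x‖ ^ 2 ∂μHE[d - 1])

/-- The squared norm `|||v|||_{dar}² = |||v|||_d² + |||v|||_{ar}²`. -/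
def normDarSq (M : Mesh Ω) (K : Space d → Space d →L[ℝ] Space d) (β : Space d → Space d)
    (ΓD : Set (Space d)) (γ : ℝ) (v : Space d → ℝ) : ℝ :=
  M.normDiffSq K ΓD γ v + M.normAdvReacSq β v

end Mesh

/-! ### Properties of families of meshes -/

/-- The star-shaped property: one `r ∈ (0, 1/2]` serves all the meshes, and every element `T` is
star-shaped with respect to (all points of) a ball of radius `r h_T` centred in `T`. -/
def StarShaped {d : ℕ} {Ω : Set (Space d)} {ι : Type*} (M : ι → Mesh Ω) : Prop :=
  ∃ r : ℝ, 0 < r ∧ r ≤ 1 / 2 ∧ ∀ i, ∀ T ∈ (M i).elems, ∃ x ∈ T,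
    ∀ y ∈ ball x (r * diam T), StarConvex ℝ y T

/-- The family is graded: `h_T ≤ C_g h_e` for all facets `e` of all elements `T`. -/
def Graded {d : ℕ} {Ω : Set (Space d)} {ι : Type*} (M : ι → Mesh Ω) : Prop :=
  ∃ C : ℝ, 0 < C ∧ ∀ i, ∀ T ∈ (M i).elems, ∀ e ∈ (M i).facetsOf T, diam T ≤ C * diam e

/-- `C` is an admissible constant in the discrete trace inequality
`‖v‖²_{L²(∂T)} ≤ C h_T⁻¹ ‖v‖²_{L²(T)}` for polynomials of degree at most `p` on all the elements. -/
def DiscreteTraceInequality {d : ℕ} {Ω : Set (Space d)} {ι : Type*} (M : ι → Mesh Ω) (p : ℕ)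
    (C : ℝ) : Prop :=
  ∀ i, ∀ T ∈ (M i).elems, ∀ q : MvPolynomial (Fin d) ℝ, q.totalDegree ≤ p →
    ∫ x in frontier T, (MvPolynomial.eval (fun j => x j) q) ^ 2 ∂μHE[d - 1]
      ≤ C * (diam T)⁻¹ * ∫ x in T, (MvPolynomial.eval (fun j => x j) q) ^ 2

/-! ### Constants -/

/-- `‖K‖_{L^∞(Ω)}`: the essential supremum over `Ω` of the Euclidean operator norm of `K(x)`. -/
def linftyNorm {d : ℕ} (Ω : Set (Space d)) (K : Space d → Space d →L[ℝ] Space d) : ℝ :=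
  (eLpNorm K ∞ (volume.restrict Ω)).toReal

/-- The threshold `γ_ε` for the penalty parameter, for `ε ∈ {-1, 0, 1}`. -/
def gammaThreshold (ε : ℤ) (normK N Ctr kmin : ℝ) : ℝ :=
  if ε = 1 then 0
  else if ε = 0 then normK ^ 2 * (N * Ctr / (4 * kmin))
  else normK ^ 2 * (N * Ctr / kmin)

/-- The coercivity constant `α_d` of the diffusion form, for `ε ∈ {-1, 0, 1}`. -/
def alphaDiff (ε : ℤ) (normK N Ctr kmin γ : ℝ) : ℝ :=
  if ε = 1 then 1
  else 1 + 1 / 2 * ((ε : ℝ) - 1) * normK * Real.sqrt (N * Ctr / (γ * kmin))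

end DG

end

noncomputable section

namespace DG

/-! ### The Euclidean Hausdorff measure on affine subspaces -/

/-! Testing with `w = v` treats the two halves of the form separately.

Diffusion. On the diagonal the consistency sums coincide up to the factor `ε`, so the form equals
the squared norm plus `ε - 1` times `consistency` (`aDiff_self`). The consistency sum is a flux-jump
product on facets. Young's inequality with a weight proportional to `diam e / γ` splits it into the
penalty term and `diam e` times the squared flux. The flux is at most `‖K‖_∞` times the adjacent
gradients. Partial derivatives of polynomials are polynomials of no larger degree, so the discrete
trace inequality moves the facet gradients into the elements at the cost `N * Ctr`, and ellipticity
turns them into energy. Optimising the Young parameter (`two_mul_le_of_young`) gives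
`abs_consistency_le`, whose constant is the one in `alphaDiff`; the thresholds are the values of `γ`
beyond which `alphaDiff` is positive.

Advection-reaction. The Gauss-Green formula for `β v²` on each element replaces the advection
integral by half a divergence, absorbed in `σ₀`, and half a boundary flux. Interior fluxes cancel
against the central flux of the form. On boundary facets the sign conditions on `β · n` turn the
remaining flux into half the upwind seminorm (`aAdvReac_coercive`).

Gauss-Green. Both the advection estimate and the trace inequality rest on `PolyDomain.gauss_green`,
proved directly for polytopes. The boundary lies in finitely many hyperplanes. The weak derivative
is tested with a smooth function times a product of cutoffs, one per hyperplane, each vanishing in a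
slab of width comparable to `δ`. As `δ → 0` the derivatives of the cutoffs concentrate on the
hyperplanes. By Fubini in the normal direction, interior and exterior points contribute nothing
there, because the even cutoff has a derivative of total mass zero, whereas a boundary point sees
one half-line only and contributes its trace with the sign of the normal (`tendsto_slice`,
`tendsto_slab`).

Regularity. A function in `W^{1,∞}` of a convex open set is Lipschitz up to a null set, by
mollification (`MemW1Infty.exists_continuous_rep`). The domain need not be convex, but it is locally
a ball at interior points and a half-ball at almost every boundary point, so traces of `β` behave as
for continuous fields almost everywhere on the facets.

Trace inequality. On an element star-shaped with respect to a ball of radius `ρ` about `x₀`, one has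
`(x - x₀) · n ≥ ρ` on the boundary, and the divergence theorem for `x - x₀` bounds the surface
measure by the volume. A scaled equivalence of norms on polynomials does the rest
(`exists_discreteTraceInequality`).

Dimension. Gradedness makes facet diameters positive; in dimension one facets are points, so the
existence of a mesh forces `2 ≤ d` (`Graded.two_le`). -/

theorem dimH_affineSubspace_le {d : ℕ} (B : AffineSubspace ℝ (Space d)) :
    dimH (B : Set (Space d)) ≤ Module.finrank ℝ B.direction := by
  rcases (B : Set (Space d)).eq_empty_or_nonempty with h | ⟨p, hp⟩
  · rw [h]; simp
  · have hiso : Isometry (fun w : B.direction => (w : Space d) + p) :=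
      (IsometryEquiv.addRight p).isometry.comp isometry_subtype_coe
    have himg : (B : Set (Space d)) = (fun w : B.direction => (w : Space d) + p) '' univ := by
      ext x
      constructor
      · intro hx
        exact ⟨⟨x - p, B.vsub_mem_direction hx hp⟩, mem_univ _, by simp⟩
      · rintro ⟨w, -, rfl⟩
        exact AffineSubspace.vadd_mem_of_mem_direction w.2 hp
    rw [himg, hiso.dimH_image, Real.dimH_univ_eq_finrank]

theorem euclideanHausdorffMeasure_eq_zero_of_dimH_lt {X : Type*} [EMetricSpace X]
    [MeasurableSpace X] [BorelSpace X] {s : Set X} {k n : ℕ} (hs : dimH s ≤ n) (h : n < k) :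
    μHE[k] s = 0 := by
  have hlt : dimH s < ((k : NNReal) : ℝ≥0∞) := hs.trans_lt (by exact_mod_cast h)
  have h0 := hausdorffMeasure_of_dimH_lt hlt
  rw [Measure.euclideanHausdorffMeasure_def, Measure.smul_apply]
  simp only [NNReal.coe_natCast] at h0
  rw [h0, smul_zero]

theorem affineSubspace_null {d k : ℕ} (B : AffineSubspace ℝ (Space d))
    (h : Module.finrank ℝ B.direction < k) : μHE[k] (B : Set (Space d)) = 0 :=
  euclideanHausdorffMeasure_eq_zero_of_dimH_lt (dimH_affineSubspace_le B) h

/-- Two distinct subspaces of the same dimension that meet have different directions, so their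
intersection has a strictly smaller direction. -/
theorem inter_affineSubspace_null {d k : ℕ} {A B : AffineSubspace ℝ (Space d)}
    (hA : Module.finrank ℝ A.direction = k) (hB : Module.finrank ℝ B.direction = k)
    (hAB : A ≠ B) : μHE[k] ((A : Set (Space d)) ∩ B) = 0 := by
  rcases ((A : Set (Space d)) ∩ B).eq_empty_or_nonempty with h | ⟨p, hpA, hpB⟩
  · rw [h]; simp
  · have hdir := AffineSubspace.direction_inf_of_mem hpA hpB
    suffices hlt : Module.finrank ℝ (A ⊓ B : AffineSubspace ℝ (Space d)).direction < k from
      affineSubspace_null (A ⊓ B) hlt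
    rw [hdir]
    have hne : A.direction ≠ B.direction := fun h =>
      hAB (AffineSubspace.ext_of_direction_eq h ⟨p, hpA, hpB⟩)
    by_contra hcon
    have h1 : A.direction ⊓ B.direction = A.direction :=
      Submodule.eq_of_le_of_finrank_le inf_le_left (by omega)
    have h2 : A.direction ⊓ B.direction = B.direction :=
      Submodule.eq_of_le_of_finrank_le inf_le_right (by omega)
    exact hne (h1.symm.trans h2)

/-! ### Hyperplanes: surface measure and orthogonal coordinates -/

/-- The hyperplane through `p` orthogonal to `ν`. -/
def hyper {d : ℕ} (ν p : Space d) : Set (Space d) := {x | ⟪ν, x - p⟫ = 0}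

/-- The linear hyperplane orthogonal to `ν`. -/
abbrev orth {d : ℕ} (ν : Space d) : Submodule ℝ (Space d) := (ℝ ∙ ν)ᗮ

theorem isClosed_hyper {d : ℕ} (ν p : Space d) : IsClosed (hyper ν p) :=
  isClosed_eq (by fun_prop) continuous_const

theorem finrank_orth {d : ℕ} {ν : Space d} (hν : ‖ν‖ = 1) :
    Module.finrank ℝ (orth ν) = d - 1 := by
  have h : _ + Module.finrank ℝ (orth ν) = _ := (ℝ ∙ ν).finrank_add_finrank_orthogonal
  rw [finrank_span_singleton (by rintro rfl; simp at hν), finrank_euclideanSpace_fin] at h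
  omega

theorem isometry_add_orth {d : ℕ} (ν p : Space d) :
    Isometry (fun w : orth ν => p + (w : Space d)) :=
  (IsometryEquiv.addLeft p).isometry.comp isometry_subtype_coe

theorem range_add_orth {d : ℕ} (ν p : Space d) :
    range (fun w : orth ν => p + (w : Space d)) = hyper ν p := by
  ext x
  constructor
  · rintro ⟨w, rfl⟩
    have := Submodule.mem_orthogonal_singleton_iff_inner_right.1 w.2
    simpa [hyper] using this
  · intro hx
    exact ⟨⟨x - p, Submodule.mem_orthogonal_singleton_iff_inner_right.2 hx⟩, by simp⟩

/-- The Euclidean Hausdorff measure is transported by isometries and is the volume on an inner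
product space of matching dimension. Surface integrals over a hyperplane thus become Lebesgue
integrals over `orth ν`, to which Fubini applies. -/
theorem map_add_orth {d : ℕ} {ν : Space d} (hν : ‖ν‖ = 1) (p : Space d) :
    (volume : Measure (orth ν)).map (fun w : orth ν => p + (w : Space d))
      = (μHE[d - 1] : Measure (Space d)).restrict (hyper ν p) := by
  rw [← range_add_orth, ← (isometry_add_orth ν p).map_euclideanHausdorffMeasure,
    ← finrank_orth hν, InnerProductSpace.euclideanHausdorffMeasure_eq_volume]

/-- This is the orthogonal decomposition along the line spanned by `ν`, where the unit length of `ν`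
makes `t ↦ t • ν` an isometry. -/
theorem measurePreserving_orth_prod {d : ℕ} {ν : Space d} (hν : ‖ν‖ = 1) (p : Space d) :
    MeasurePreserving (fun z : orth ν × ℝ => p + (z.1 : Space d) + z.2 • ν)
      (volume.prod volume) volume := by
  have h1 := ((ℝ ∙ ν).measurePreserving_measurableEquivProd p).symm
  rw [InnerProductSpace.euclideanHausdorffMeasure_eq_volume] at h1
  have h2 : MeasurePreserving (LinearIsometryEquiv.toSpanUnitSingleton ν hν : ℝ → (ℝ ∙ ν))
    volume volume := (LinearIsometryEquiv.toSpanUnitSingleton ν hν).measurePreserving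
  have h3 : MeasurePreserving (Prod.map (LinearIsometryEquiv.toSpanUnitSingleton ν hν : ℝ → (ℝ ∙ ν))
      (id : orth ν → orth ν)) (volume.prod volume) (volume.prod volume) :=
    h2.prod (MeasurePreserving.id _)
  have h4 := (h1.comp h3).comp (Measure.measurePreserving_swap
    (μ := (volume : Measure (orth ν))) (ν := (volume : Measure ℝ)))
  have heq : (fun z : orth ν × ℝ => p + (z.1 : Space d) + z.2 • ν)
      = (((ℝ ∙ ν).measurableEquivProd p).symm ∘
        Prod.map (LinearIsometryEquiv.toSpanUnitSingleton ν hν) id) ∘ Prod.swap := by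
    funext z
    simp only [Function.comp_apply, Prod.map, Prod.swap, Submodule.measurableEquivProd_symm_apply,
      LinearIsometryEquiv.toSpanUnitSingleton_apply, id_eq, vadd_eq_add]
    abel
  rw [heq]
  exact h4

theorem hyper_volume_null {d : ℕ} {ν : Space d} (hν : ‖ν‖ = 1) (p : Space d) :
    volume (hyper ν p) = 0 := by
  have h := (measurePreserving_orth_prod hν p)
  rw [← h.measure_preimage (isClosed_hyper ν p).measurableSet.nullMeasurableSet]
  have : (fun z : orth ν × ℝ => p + (z.1 : Space d) + z.2 • ν) ⁻¹' hyper ν p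
      ⊆ univ ×ˢ {0} := by
    rintro ⟨w, t⟩ hz
    have hw := Submodule.mem_orthogonal_singleton_iff_inner_right.1 w.2
    have : ⟪ν, p + (w : Space d) + t • ν - p⟫ = 0 := hz
    rw [add_assoc, add_sub_cancel_left, inner_add_right, hw, inner_smul_right,
      real_inner_self_eq_norm_sq, hν] at this
    simpa using this
  refine measure_mono_null this ?_
  rw [Measure.prod_prod]; simp

theorem hyper_inter_bounded_lt_top {d : ℕ} {ν : Space d} (hν : ‖ν‖ = 1) (p : Space d)
    {s : Set (Space d)} (hs : Bornology.IsBounded s) : μHE[d - 1] (hyper ν p ∩ s) < ⊤ := by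
  obtain ⟨R, hR⟩ := hs.subset_closedBall p
  have h1 : μHE[d - 1] (hyper ν p ∩ s) ≤
      (μHE[d - 1] : Measure (Space d)).restrict (hyper ν p) (closedBall p R) := by
    rw [Measure.restrict_apply isClosed_closedBall.measurableSet, inter_comm (closedBall p R)]
    exact measure_mono (inter_subset_inter_right _ hR)
  refine h1.trans_lt ?_
  rw [← map_add_orth hν, Measure.map_apply (isometry_add_orth ν p).continuous.measurable
    isClosed_closedBall.measurableSet]
  have : (fun w : orth ν => p + (w : Space d)) ⁻¹' closedBall p R = closedBall 0 R := by
    ext w; simp [dist_eq_norm]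
  rw [this]
  exact measure_closedBall_lt_top

/-! ### Polytopes -/

theorem IsPolytope.exists_affineSubspace {d n : ℕ} {F : Set (Space d)} (h : IsPolytope n F) :
    ∃ A : AffineSubspace ℝ (Space d), Module.finrank ℝ A.direction = n ∧
      closure F ⊆ A ∧ F.Nonempty := by
  cases n with
  | zero =>
    obtain ⟨x, rfl⟩ := h
    refine ⟨AffineSubspace.mk' x ⊥, by simp, ?_, singleton_nonempty x⟩
    rw [closure_singleton]
    simp
  | succ n =>
    obtain ⟨A, hA, ⟨U, -, hU⟩, -, hc, -⟩ := h
    refine ⟨A, hA, ?_, hc.nonempty⟩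
    exact closure_minimal (hU ▸ inter_subset_left) A.closed_of_finiteDimensional

/-- The relative boundary lies in finitely many affine subspaces of dimension `n`. -/
theorem IsPolytope.null_boundary {d n : ℕ} {F : Set (Space d)} (h : IsPolytope (n + 1) F) :
    μHE[n + 1] (closure F \ F) = 0 := by
  obtain ⟨A, hA, -, -, -, -, 𝓕, hfin, hpoly, heq⟩ := h
  rw [heq, measure_biUnion_null_iff hfin.countable]
  intro G hG
  obtain ⟨B, hB, hGB, -⟩ := (hpoly G hG).exists_affineSubspace
  exact measure_mono_null hGB (affineSubspace_null B (by omega))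

/-- In the isometric chart of the affine hull around one of its points, the polytope contains a
nonempty open set. -/
theorem IsPolytope.measure_pos {d n : ℕ} {F : Set (Space d)} (h : IsPolytope (n + 1) F) :
    0 < μHE[n + 1] F := by
  obtain ⟨A, hA, ⟨U, hUo, hU⟩, -, hc, -⟩ := h
  obtain ⟨p, hp⟩ := hc.nonempty
  have hpA : p ∈ A := by rw [hU] at hp; exact hp.1
  have hpU : p ∈ U := by rw [hU] at hp; exact hp.2
  have hiso : Isometry (fun w : A.direction => (w : Space d) + p) :=
    (IsometryEquiv.addRight p).isometry.comp isometry_subtype_coe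
  have h1 : (fun w : A.direction => (w : Space d) + p) ''
      ((fun w : A.direction => (w : Space d) + p) ⁻¹' U) ⊆ F := by
    rintro _ ⟨w, hw, rfl⟩
    rw [hU]
    exact ⟨AffineSubspace.vadd_mem_of_mem_direction w.2 hpA, hw⟩
  refine lt_of_lt_of_le ?_ (measure_mono h1)
  rw [hiso.euclideanHausdorffMeasure_image, ← hA,
    InnerProductSpace.euclideanHausdorffMeasure_eq_volume]
  exact (hUo.preimage hiso.continuous).measure_pos _ ⟨0, by simpa using hpU⟩

theorem exists_unit_normal {d : ℕ} (hd : 1 ≤ d) {V : Submodule ℝ (Space d)}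
    (hV : Module.finrank ℝ V = d - 1) : ∃ ν : Space d, ‖ν‖ = 1 ∧ V = orth ν := by
  have h : Module.finrank ℝ V + Module.finrank ℝ Vᗮ = Module.finrank ℝ (Space d) :=
    V.finrank_add_finrank_orthogonal
  rw [finrank_euclideanSpace_fin] at h
  have hpos : 0 < Module.finrank ℝ Vᗮ := by omega
  have := Module.finrank_pos_iff.1 hpos
  obtain ⟨w, hw⟩ := exists_ne (0 : Vᗮ)
  have hw' : ‖(w : Space d)‖ ≠ 0 := by simpa using hw
  refine ⟨‖(w : Space d)‖⁻¹ • (w : Space d), ?_, ?_⟩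
  · rw [norm_smul, norm_inv, norm_norm, inv_mul_cancel₀ hw']
  · have hn : ‖‖(w : Space d)‖⁻¹ • (w : Space d)‖ = 1 := by
      rw [norm_smul, norm_inv, norm_norm, inv_mul_cancel₀ hw']
    apply Submodule.eq_of_le_of_finrank_eq
    · intro v hv
      rw [Submodule.mem_orthogonal_singleton_iff_inner_right, inner_smul_left,
        real_inner_comm, (Submodule.mem_orthogonal V _).1 w.2 v hv, mul_zero]
    · rw [hV, finrank_orth hn]

theorem affineSubspace_eq_hyper {d : ℕ} {A : AffineSubspace ℝ (Space d)} {ν p : Space d}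
    (hA : A.direction = orth ν) (hp : p ∈ A) : (A : Set (Space d)) = hyper ν p := by
  ext x
  rw [SetLike.mem_coe, ← AffineSubspace.vsub_right_mem_direction_iff_mem hp, hA,
    Submodule.mem_orthogonal_singleton_iff_inner_right]
  rfl

/-! ### Full-dimensional polytopes: boundary hyperplanes and normals almost everywhere -/

/-- A finite family of hyperplanes with negligible pairwise intersections. -/
structure HyperplaneFamily (d : ℕ) where
  /-- the pairs of a unit normal and a point -/
  data : Finset (Space d × Space d)
  unit : ∀ j ∈ data, ‖j.1‖ = 1
  inter_null : ∀ j ∈ data, ∀ k ∈ data, j ≠ k →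
    μHE[d - 1] (hyper j.1 j.2 ∩ hyper k.1 k.2) = 0

/-- The topological and measure-theoretic properties of full-dimensional Lipschitz polytopes on
which the Gauss-Green formula rests. -/
structure PolyDomain {d : ℕ} (T : Set (Space d)) (H : HyperplaneFamily d) : Prop where
  isOpen : IsOpen T
  bounded : Bornology.IsBounded T
  nonempty : T.Nonempty
  frontier_subset : frontier T ⊆ ⋃ j ∈ H.data, hyper j.1 j.2
  outside : ∀ x ∈ frontier T, x ∈ closure (closure T)ᶜ
  ae_normal : ∀ᵐ x ∂(μHE[d - 1] : Measure (Space d)),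
    x ∈ frontier T → ∃ n, IsOutwardNormal T x n

/-- Moving from `x` in the graph direction `u` enters the strict epigraph at once. That set is open
and locally disjoint from `T`, hence locally disjoint from `closure T`. This excludes slits, with
`T` on both sides of its boundary. -/
theorem mem_closure_compl_closure_of_lipschitz {d : ℕ} {T : Set (Space d)} (hT : IsOpen T)
    (hL : IsLipschitzIn ⊤ T) {x : Space d} (hx : x ∈ frontier T) :
    x ∈ closure (closure T)ᶜ := by
  rw [hT.frontier_eq] at hx
  obtain ⟨u, -, hu, L, φ, hφ, r, hr, h⟩ := hL x hx
  have hxT : φ (x - ⟪u, x⟫ • u) ≤ ⟪u, x⟫ := by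
    by_contra hcon
    exact hx.2 ((h x trivial (mem_ball_self hr)).2 (not_le.1 hcon))
  have huu : ⟪u, u⟫ = 1 := by rw [real_inner_self_eq_norm_sq, hu]; norm_num
  have hlim : Tendsto (fun t : ℝ => x + t • u) (𝓝[>] 0) (𝓝 x) := by
    have : Tendsto (fun t : ℝ => x + t • u) (𝓝 0) (𝓝 (x + (0 : ℝ) • u)) :=
      Continuous.tendsto (by fun_prop) 0
    rw [zero_smul, add_zero] at this
    exact this.mono_left nhdsWithin_le_nhds
  refine mem_closure_of_tendsto hlim ?_
  filter_upwards [hlim (ball_mem_nhds x hr), self_mem_nhdsWithin] with t ht ht0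
  have hopen : IsOpen {y : Space d | φ (y - ⟪u, y⟫ • u) < ⟪u, y⟫} :=
    isOpen_lt (hφ.continuous.comp (by fun_prop)) (by fun_prop)
  have hmem : x + t • u ∈ {y : Space d | φ (y - ⟪u, y⟫ • u) < ⟪u, y⟫} := by
    have h1 : ⟪u, x + t • u⟫ = ⟪u, x⟫ + t := by rw [inner_add_right, inner_smul_right, huu, mul_one]
    have h2 : x + t • u - (⟪u, x⟫ + t) • u = x - ⟪u, x⟫ • u := by rw [add_smul]; abel
    simp only [mem_ofPred_eq, h1, h2]
    have : (0 : ℝ) < t := ht0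
    linarith
  intro hcl
  obtain ⟨y, ⟨hy1, hy2⟩, hyT⟩ := mem_closure_iff.1 hcl _ (hopen.inter isOpen_ball) ⟨hmem, ht⟩
  exact absurd ((h y trivial hy2).1 hyT) (not_lt.2 hy1.le)

theorem inter_frontier_nonempty_of_isPreconnected {X : Type*} [TopologicalSpace X] {s T : Set X}
    (hs : IsPreconnected s) (hT : IsOpen T) (h1 : (s ∩ T).Nonempty) (h2 : (s ∩ Tᶜ).Nonempty) :
    (s ∩ frontier T).Nonempty := by
  by_contra hcon
  have hno : ∀ x ∈ s, x ∉ frontier T := fun x hx hxf => hcon ⟨x, hx, hxf⟩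
  have hcl : ∀ x ∈ s, x ∉ T → x ∈ (closure T)ᶜ := fun x hx hxT hxc =>
    hno x hx (by rw [hT.frontier_eq]; exact ⟨hxc, hxT⟩)
  obtain ⟨z, -, hz1, hz2⟩ := hs T (closure T)ᶜ hT isClosed_closure.isOpen_compl
    (fun x hx => by by_cases hxT : x ∈ T; exacts [Or.inl hxT, Or.inr (hcl x hx hxT)]) h1
    (h2.imp fun x hx => ⟨hx.1, hcl x hx.1 hx.2⟩)
  exact hz2 (subset_closure hz1)

/-- The hyperplane cuts a small ball into two convex halves that miss the frontier, so each half
lies in `T` or in its complement. Both in `T` contradicts `hout`, both outside contradicts `x ∈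
closure T`, and the mixed cases are the two signs of the normal. -/
theorem isOutwardNormal_or_of_frontier {d : ℕ} {T : Set (Space d)} (hT : IsOpen T)
    {x n : Space d} (hn : ‖n‖ = 1) (hx : x ∈ frontier T) (hout : x ∈ closure (closure T)ᶜ)
    (hfr : ∀ᶠ y in 𝓝 x, (y ∈ frontier T ↔ ⟪y - x, n⟫ = 0)) :
    IsOutwardNormal T x n ∨ IsOutwardNormal T x (-n) := by
  obtain ⟨r, hr, hball⟩ := Metric.eventually_nhds_iff_ball.1 hfr
  have key : ∀ m : Space d, (m = n ∨ m = -n) →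
      (ball x r ∩ {y | ⟪y - x, m⟫ < 0} ⊆ T) ∨
      (ball x r ∩ {y | ⟪y - x, m⟫ < 0} ⊆ Tᶜ) := by
    intro m hm
    have hconv : Convex ℝ (ball x r ∩ {y | ⟪y - x, m⟫ < 0}) := by
      refine (convex_ball x r).inter ?_
      intro y hy z hz a b ha hb hab
      simp only [mem_ofPred_eq] at *
      have : a • y + b • z - x = a • (y - x) + b • (z - x) := by
        rw [smul_sub, smul_sub]
        have : x = a • x + b • x := by rw [← add_smul, hab, one_smul]
        nth_rewrite 1 [this]
        abel
      rw [this, inner_add_left, inner_smul_left, inner_smul_left]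
      simp only [conj_trivial]
      rcases ha.eq_or_lt with rfl | ha'
      · have : b = 1 := by linarith
        subst this; simpa using hz
      · have := mul_neg_of_pos_of_neg ha' hy
        have := mul_nonpos_of_nonneg_of_nonpos hb hz.le
        linarith
    by_contra hcon
    push Not at hcon
    obtain ⟨h1, h2⟩ := hcon
    obtain ⟨a, ha, haT⟩ := not_subset.1 h1
    obtain ⟨b, hb, hbT⟩ := not_subset.1 h2
    obtain ⟨z, hz, hzf⟩ := inter_frontier_nonempty_of_isPreconnected hconv.isPreconnected hT
      ⟨b, hb, by simpa using hbT⟩ ⟨a, ha, haT⟩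
    have hz0 := (hball z hz.1).1 hzf
    have hz1 : ⟪z - x, m⟫ < 0 := hz.2
    rcases hm with rfl | rfl
    · linarith
    · rw [inner_neg_right] at hz1; linarith
  have hplane : ∀ y ∈ ball x r, ⟪y - x, n⟫ = 0 → y ∉ T := by
    intro y hy h0 hyT
    have := (hball y hy).2 h0
    rw [hT.frontier_eq] at this
    exact this.2 hyT
  rcases key n (Or.inl rfl) with h1 | h1 <;> rcases key (-n) (Or.inr rfl) with h2 | h2
  · exfalso
    obtain ⟨y, hyb, hy⟩ := mem_closure_iff.1 hout _ isOpen_ball (mem_ball_self hr)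
    rcases lt_trichotomy ⟪y - x, n⟫ 0 with h | h | h
    · exact hy (subset_closure (h1 ⟨hyb, h⟩))
    · exact hy (frontier_subset_closure ((hball y hyb).2 h))
    · exact hy (subset_closure (h2 ⟨hyb, by simpa [inner_neg_right] using h⟩))
  · left
    refine ⟨hn, Metric.eventually_nhds_iff_ball.2 ⟨r, hr, fun y hy => ⟨fun hyT => ?_,
      fun h => h1 ⟨hy, h⟩⟩⟩⟩
    rcases lt_trichotomy ⟪y - x, n⟫ 0 with h | h | h
    · exact h
    · exact absurd hyT (hplane y hy h)
    · exact absurd hyT (h2 ⟨hy, by simpa [inner_neg_right] using h⟩)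
  · right
    refine ⟨by simpa using hn, Metric.eventually_nhds_iff_ball.2 ⟨r, hr, fun y hy =>
      ⟨fun hyT => ?_, fun h => h2 ⟨hy, h⟩⟩⟩⟩
    rcases lt_trichotomy ⟪y - x, n⟫ 0 with h | h | h
    · exact absurd hyT (h1 ⟨hy, h⟩)
    · exact absurd hyT (hplane y hy h)
    · simpa [inner_neg_right] using h
  · exfalso
    obtain ⟨y, hyb, hy⟩ := mem_closure_iff.1 (frontier_subset_closure hx) _ isOpen_ball
      (mem_ball_self hr)
    rcases lt_trichotomy ⟪y - x, n⟫ 0 with h | h | h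
    · exact h1 ⟨hyb, h⟩ hy
    · exact hplane y hyb h hy
    · exact h2 ⟨hyb, by simpa [inner_neg_right] using h⟩ hy

/-- An open set of full dimension: the data contained in `IsPolytope d T`. -/
theorem IsPolytope.full {d : ℕ} (hd : 1 ≤ d) {T : Set (Space d)} (h : IsPolytope d T) :
    IsOpen T ∧ Bornology.IsBounded T ∧ IsConnected T ∧ IsLipschitzIn ⊤ T ∧
      ∃ 𝓕 : Set (Set (Space d)), 𝓕.Finite ∧ (∀ F ∈ 𝓕, IsPolytope (d - 1) F) ∧
        frontier T = ⋃ F ∈ 𝓕, closure F := by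
  obtain ⟨n, rfl⟩ : ∃ n, d = n + 1 := ⟨d - 1, by omega⟩
  obtain ⟨A, hA, ⟨U, hUo, hU⟩, hb, hc, hL, 𝓕, hfin, hpoly, heq⟩ := h
  obtain ⟨p, hp⟩ := hc.nonempty
  have hAtop : A = ⊤ := by
    have hdir : A.direction = ⊤ := Submodule.eq_top_of_finrank_eq (by simpa using hA)
    have hpA : p ∈ A := by rw [hU] at hp; exact hp.1
    exact (AffineSubspace.direction_eq_top_iff_of_nonempty ⟨p, hpA⟩).1 hdir
  subst hAtop
  have hTo : IsOpen T := by rw [hU]; simpa using hUo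
  refine ⟨hTo, hb, hc, hL, 𝓕, hfin, by simpa using hpoly, ?_⟩
  rw [hTo.frontier_eq, heq]

/-- The assumption `2 ≤ d` puts `d - 1` in the successor case of the recursion, where facets are
relatively open and have a lower-dimensional boundary. -/
theorem IsPolytope.exists_relOpen {d : ℕ} (hd : 2 ≤ d) {F : Set (Space d)}
    (h : IsPolytope (d - 1) F) : ∃ ν p : Space d, ∃ U : Set (Space d), ‖ν‖ = 1 ∧ IsOpen U ∧
      F = hyper ν p ∩ U ∧ closure F ⊆ hyper ν p ∧ μHE[d - 1] (closure F \ F) = 0 ∧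
      0 < μHE[d - 1] F := by
  obtain ⟨n, rfl⟩ : ∃ n, d = n + 2 := ⟨d - 2, by omega⟩
  have h' : IsPolytope (n + 1) F := h
  have hnull := h'.null_boundary
  have hpos := h'.measure_pos
  obtain ⟨A, hA, ⟨U, hUo, hU⟩, hb, hc, hL, -⟩ := h'
  obtain ⟨p, hp⟩ := hc.nonempty
  have hpA : p ∈ A := by rw [hU] at hp; exact hp.1
  obtain ⟨ν, hν, hν'⟩ := exists_unit_normal (by omega) (V := A.direction) (by simpa using hA)
  have hAh := affineSubspace_eq_hyper hν' hpA
  refine ⟨ν, p, U, hν, hUo, hAh ▸ hU, ?_, hnull, hpos⟩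
  exact closure_minimal (by rw [hU, hAh]; exact inter_subset_left) (isClosed_hyper ν p)

theorem hyper_eq_mk' {d : ℕ} (ν p : Space d) :
    hyper ν p = (AffineSubspace.mk' p (orth ν) : Set (Space d)) := by
  rw [affineSubspace_eq_hyper (AffineSubspace.direction_mk' _ _) (AffineSubspace.self_mem_mk' _ _)]

theorem hyper_inter_null {d : ℕ} {ν p ν' p' : Space d} (hν : ‖ν‖ = 1) (hν' : ‖ν'‖ = 1)
    (h : hyper ν p ≠ hyper ν' p') : μHE[d - 1] (hyper ν p ∩ hyper ν' p') = 0 := by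
  rw [hyper_eq_mk', hyper_eq_mk'] at *
  apply inter_affineSubspace_null
  · rw [AffineSubspace.direction_mk', finrank_orth hν]
  · rw [AffineSubspace.direction_mk', finrank_orth hν']
  · exact fun h' => h (by rw [h'])

theorem hyper_eq_of_mem {d : ℕ} {ν p x : Space d} (hx : x ∈ hyper ν p) :
    hyper ν p = {y | ⟪y - x, ν⟫ = 0} := by
  ext y
  have hx' : ⟪ν, x - p⟫ = 0 := hx
  have : ⟪y - x, ν⟫ = ⟪ν, y - p⟫ := by
    rw [real_inner_comm, ← sub_sub_sub_cancel_right y x p, inner_sub_right, hx', sub_zero]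
  simp only [hyper, mem_ofPred_eq, this]

theorem IsPolytope.exists_polyDomain {d : ℕ} (hd : 2 ≤ d) {T : Set (Space d)}
    (h : IsPolytope d T) : ∃ H : HyperplaneFamily d, PolyDomain T H := by
  classical
  obtain ⟨hTo, hTb, hTc, hTL, 𝓕, hfin, hpoly, hfr⟩ := h.full (by omega)
  have hex : ∀ F : 𝓕, ∃ ν p : Space d, ∃ U : Set (Space d), ‖ν‖ = 1 ∧ IsOpen U ∧
      (F : Set (Space d)) = hyper ν p ∩ U ∧ closure F ⊆ hyper ν p ∧
      μHE[d - 1] (closure (F : Set (Space d)) \ F) = 0 ∧ 0 < μHE[d - 1] (F : Set (Space d)) :=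
    fun F => (hpoly F F.2).exists_relOpen hd
  choose ν p U hν hU hF hcl hnull hpos using hex
  have : Finite 𝓕 := hfin
  have := Fintype.ofFinite 𝓕
  -- Coplanar facets would violate `inter_null`, so one normal and one point are chosen per distinct
  -- hyperplane, not per facet.
  let 𝓢 : Set (Set (Space d)) := range fun F : 𝓕 => hyper (ν F) (p F)
  have h𝓢 : ∀ S : 𝓢, ∃ j : Space d × Space d, ‖j.1‖ = 1 ∧ hyper j.1 j.2 = S := by
    rintro ⟨_, F, rfl⟩
    exact ⟨(ν F, p F), hν F, rfl⟩
  choose rep hrep1 hrep2 using h𝓢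
  have : Fintype 𝓢 := Fintype.ofFinite 𝓢
  refine ⟨⟨Finset.univ.image rep, ?_, ?_⟩, hTo, hTb, hTc.nonempty, ?_, ?_, ?_⟩
  · simp only [Finset.mem_image, Finset.mem_univ, true_and, forall_exists_index,
      forall_apply_eq_imp_iff]
    exact hrep1
  · simp only [Finset.mem_image, Finset.mem_univ, true_and, forall_exists_index,
      forall_apply_eq_imp_iff]
    intro S S' hne
    apply hyper_inter_null (hrep1 S) (hrep1 S')
    rw [hrep2, hrep2]
    exact fun h' => hne (by rw [Subtype.ext h'])
  · rw [hfr]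
    refine iUnion₂_subset fun F hFm => ?_
    refine (hcl ⟨F, hFm⟩).trans ?_
    have hS := hrep2 ⟨hyper (ν ⟨F, hFm⟩) (p ⟨F, hFm⟩), mem_range_self _⟩
    simp only at hS
    rw [← hS]
    exact subset_biUnion_of_mem (u := fun j : Space d × Space d => hyper j.1 j.2)
      (Finset.mem_coe.2 (Finset.mem_image_of_mem rep (Finset.mem_univ _)))
  · exact fun x hx => mem_closure_compl_closure_of_lipschitz hTo hTL hx
  -- The exceptional points are the relative boundaries of the facets and the intersections of
  -- distinct facet planes. Off this null set a single plane carries the frontier near `x`.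
  · have h1 : ∀ᵐ x ∂(μHE[d - 1] : Measure (Space d)), ∀ F : 𝓕,
        x ∉ closure (F : Set (Space d)) \ F :=
      ae_all_iff.2 fun F => measure_eq_zero_iff_ae_notMem.1 (hnull F)
    have h2 : ∀ᵐ x ∂(μHE[d - 1] : Measure (Space d)), ∀ F G : 𝓕,
        hyper (ν F) (p F) ≠ hyper (ν G) (p G) → x ∉ hyper (ν F) (p F) ∩ hyper (ν G) (p G) := by
      refine ae_all_iff.2 fun F => ae_all_iff.2 fun G => ?_
      by_cases hFG : hyper (ν F) (p F) = hyper (ν G) (p G)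
      · exact Eventually.of_forall fun x hx => absurd hFG hx
      · have := measure_eq_zero_iff_ae_notMem.1 (hyper_inter_null (hν F) (hν G) hFG)
        filter_upwards [this] with x hx _
        exact hx
    filter_upwards [h1, h2] with x hx1 hx2 hxfr
    have hxu := hxfr
    rw [hfr] at hxu
    obtain ⟨F₀, hF₀, hxF⟩ := mem_iUnion₂.1 hxu
    let F : 𝓕 := ⟨F₀, hF₀⟩
    have hxF' : x ∈ (F : Set (Space d)) := by
      by_contra hcon
      exact hx1 F ⟨hxF, hcon⟩
    have hxh : x ∈ hyper (ν F) (p F) := hcl F hxF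
    have hxUF : x ∈ U F := by rw [hF F] at hxF'; exact hxF'.2
    have hloc : ∀ᶠ y in 𝓝 x, ∀ G : 𝓕, y ∈ closure (G : Set (Space d)) → y ∈ hyper (ν F) (p F) := by
      refine eventually_all.2 fun G => ?_
      by_cases hFG : hyper (ν F) (p F) = hyper (ν G) (p G)
      · exact Eventually.of_forall fun y hy => hFG ▸ hcl G hy
      · have hxG : x ∉ hyper (ν G) (p G) := fun hxG => hx2 F G hFG ⟨hxh, hxG⟩
        filter_upwards [(isClosed_hyper (ν G) (p G)).isOpen_compl.mem_nhds hxG] with y hy hyG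
        exact absurd (hcl G hyG) hy
    have hiff : ∀ᶠ y in 𝓝 x, (y ∈ frontier T ↔ ⟪y - x, ν F⟫ = 0) := by
      filter_upwards [hloc, (hU F).mem_nhds hxUF] with y hy hyU
      have hyh : y ∈ hyper (ν F) (p F) ↔ ⟪y - x, ν F⟫ = 0 := by rw [hyper_eq_of_mem hxh]; rfl
      rw [← hyh]
      constructor
      · intro hyf
        rw [hfr] at hyf
        obtain ⟨G, hG, hyG⟩ := mem_iUnion₂.1 hyf
        exact hy ⟨G, hG⟩ hyG
      · intro hyh'
        rw [hfr]
        refine mem_iUnion₂.2 ⟨F₀, hF₀, subset_closure ?_⟩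
        change y ∈ (F : Set (Space d))
        rw [hF F]
        exact ⟨hyh', hyU⟩
    rcases isOutwardNormal_or_of_frontier hTo (hν F) hxfr
      (mem_closure_compl_closure_of_lipschitz hTo hTL hxfr) hiff with h | h
    exacts [⟨_, h⟩, ⟨_, h⟩]

/-! ### Outward normals -/

theorem eventually_ray {d : ℕ} {x : Space d} {P : Space d → Prop} (h : ∀ᶠ y in 𝓝 x, P y)
    (w : Space d) : ∀ᶠ t : ℝ in 𝓝[>] 0, P (x + t • w) := by
  have : Tendsto (fun t : ℝ => x + t • w) (𝓝 0) (𝓝 (x + (0 : ℝ) • w)) :=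
    Continuous.tendsto (by fun_prop) 0
  rw [zero_smul, add_zero] at this
  exact (this.mono_left nhdsWithin_le_nhds).eventually h

theorem inner_gt_neg_one {d : ℕ} {n m : Space d} (hn : ‖n‖ = 1) (hm : ‖m‖ = 1) (h : n ≠ -m) :
    -1 < ⟪n, m⟫ := by
  have h1 : 0 < ‖n + m‖ ^ 2 := by
    have : n + m ≠ 0 := fun h0 => h (eq_neg_of_add_eq_zero_left h0)
    positivity
  rw [norm_add_sq_real, hn, hm] at h1
  linarith

/-- Were `n ≠ -n'`, then `⟪n, n'⟫ > -1` and the ray from `x` in direction `-(n + n')` would enter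
both sets. -/
theorem IsOutwardNormal.eq_neg_of_disjoint {d : ℕ} {T T' : Set (Space d)} {x n n' : Space d}
    (h : IsOutwardNormal T x n) (h' : IsOutwardNormal T' x n') (hd : Disjoint T T') :
    n = -n' := by
  by_contra hne
  have hin := inner_gt_neg_one h.1 h'.1 hne
  obtain ⟨t, ht1, ht2, ht0⟩ := ((eventually_ray h.2 (-(n + n'))).and
    ((eventually_ray h'.2 (-(n + n'))).and self_mem_nhdsWithin)).exists
  have ht0' : (0 : ℝ) < t := ht0
  have hnn : ⟪n, n⟫ = 1 := by rw [real_inner_self_eq_norm_sq, h.1]; norm_num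
  have hnn' : ⟪n', n'⟫ = 1 := by rw [real_inner_self_eq_norm_sq, h'.1]; norm_num
  have hc : ⟪n', n⟫ = ⟪n, n'⟫ := real_inner_comm _ _
  refine disjoint_left.1 hd (ht1.2 ?_) (ht2.2 ?_)
  · rw [add_sub_cancel_left, inner_smul_left, inner_neg_left, inner_add_left, hnn, hc]
    simp only [conj_trivial]; nlinarith
  · rw [add_sub_cancel_left, inner_smul_left, inner_neg_left, inner_add_left, hnn']
    simp only [conj_trivial]; nlinarith

/-- Were the normals different, the ray from `x` in direction `n' - n` would enter `T` while staying
outside `T'`. -/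
theorem IsOutwardNormal.eq_of_subset {d : ℕ} {T T' : Set (Space d)} {x n n' : Space d}
    (h : IsOutwardNormal T x n) (h' : IsOutwardNormal T' x n') (hs : T ⊆ T') : n = n' := by
  by_contra hne
  have hin := inner_gt_neg_one (n := n) (m := -n') h.1 (by simpa using h'.1) (by simpa using hne)
  obtain ⟨t, ht1, ht2, ht0⟩ := ((eventually_ray h.2 (n' - n)).and
    ((eventually_ray h'.2 (n' - n)).and self_mem_nhdsWithin)).exists
  have ht0' : (0 : ℝ) < t := ht0
  have hnn : ⟪n, n⟫ = 1 := by rw [real_inner_self_eq_norm_sq, h.1]; norm_num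
  have hnn' : ⟪n', n'⟫ = 1 := by rw [real_inner_self_eq_norm_sq, h'.1]; norm_num
  have hc : ⟪n', n⟫ = ⟪n, n'⟫ := real_inner_comm _ _
  rw [inner_neg_right] at hin
  have hm := ht2.1 (hs (ht1.2 ?_))
  · rw [add_sub_cancel_left, inner_smul_left, inner_sub_left, hnn'] at hm
    simp only [conj_trivial] at hm; nlinarith
  · rw [add_sub_cancel_left, inner_smul_left, inner_sub_left, hnn, hc]
    simp only [conj_trivial]; nlinarith

theorem IsOutwardNormal.eq_outwardNormal {d : ℕ} {T : Set (Space d)} {x n : Space d}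
    (h : IsOutwardNormal T x n) : outwardNormal T x = n := by
  have hex : ∃ n, IsOutwardNormal T x n := ⟨n, h⟩
  rw [outwardNormal, dif_pos hex]
  exact hex.choose_spec.eq_of_subset h Subset.rfl

theorem norm_outwardNormal_le {d : ℕ} (T : Set (Space d)) (x : Space d) :
    ‖outwardNormal T x‖ ≤ 1 := by
  unfold outwardNormal
  split_ifs with h
  · exact h.choose_spec.1.le
  · simp

theorem IsOutwardNormal.mem_frontier_iff {d : ℕ} {T : Set (Space d)} {x n : Space d}
    (h : IsOutwardNormal T x n) : ∀ᶠ y in 𝓝 x, (y ∈ frontier T ↔ ⟪y - x, n⟫ = 0) := by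
  filter_upwards [h.2.eventually_nhds] with y hy
  constructor
  · intro hyf
    rcases lt_trichotomy ⟪y - x, n⟫ 0 with h0 | h0 | h0
    · exfalso
      have hlt : ∀ᶠ z in 𝓝 y, ⟪z - x, n⟫ < 0 :=
        (ContinuousAt.eventually_lt (by fun_prop) continuousAt_const h0)
      have : T ∈ 𝓝 y := by filter_upwards [hy, hlt] with z hz hz0 using hz.2 hz0
      exact hyf.2 (mem_interior_iff_mem_nhds.2 this)
    · exact h0
    · exfalso
      have hlt : ∀ᶠ z in 𝓝 y, 0 < ⟪z - x, n⟫ :=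
        (ContinuousAt.eventually_lt continuousAt_const (by fun_prop) h0)
      have hc : ∀ᶠ z in 𝓝 y, z ∉ T := by
        filter_upwards [hy, hlt] with z hz hz0 hzT
        exact absurd (hz.1 hzT) (not_lt.2 hz0.le)
      exact (mem_closure_iff_frequently.1 hyf.1) hc
  · intro h0
    have hnn : ⟪n, n⟫ = 1 := by rw [real_inner_self_eq_norm_sq, h.1]; norm_num
    refine ⟨?_, fun hInt => ?_⟩
    · rw [mem_closure_iff_frequently]
      intro hcon
      obtain ⟨t, ht, ht'⟩ := ((eventually_ray (hy.and hcon) (-n)).and self_mem_nhdsWithin).exists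
      have ht0 : (0 : ℝ) < t := ht'
      refine ht.2 (ht.1.2 ?_)
      rw [add_sub_right_comm, inner_add_left, h0, inner_smul_left, inner_neg_left, hnn]
      simp only [conj_trivial]; linarith
    · have := (hy.self_of_nhds).1 (interior_subset hInt)
      linarith

theorem eq_or_eq_neg_of_orth {d : ℕ} {ν z : Space d} (hν : ‖ν‖ = 1) (hz : ‖z‖ = 1)
    (hw : ∀ w ∈ orth ν, ⟪w, z⟫ = 0) : z = ν ∨ z = -ν := by
  have hz1 : z ∈ (orth ν)ᗮ := (Submodule.mem_orthogonal _ _).2 hw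
  rw [Submodule.orthogonal_orthogonal] at hz1
  obtain ⟨c, rfl⟩ := Submodule.mem_span_singleton.1 hz1
  rw [norm_smul, hν, mul_one, Real.norm_eq_abs] at hz
  rcases (abs_eq zero_le_one).1 hz with rfl | rfl
  · left; simp
  · right; simp

/-- At almost every point of a facet contained in the boundary of `T`, the outward normal is, up to
its sign, the given normal of the facet. -/
theorem PolyDomain.ae_normal_eq {d : ℕ} (hd : 2 ≤ d) {T F : Set (Space d)}
    {H : HyperplaneFamily d} (hT : PolyDomain T H) (hF : IsPolytope (d - 1) F)
    (hFT : closure F ⊆ frontier T) {m : Space d} (hm : ‖m‖ = 1)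
    (hort : ∀ x ∈ closure F, ∀ y ∈ closure F, ⟪x - y, m⟫ = 0) :
    ∀ᵐ x ∂(μHE[d - 1] : Measure (Space d)), x ∈ closure F →
      IsOutwardNormal T x (outwardNormal T x) ∧
        (outwardNormal T x = m ∨ outwardNormal T x = -m) := by
  obtain ⟨ν, p, U, hν, hU, hFU, hcl, hnull, -⟩ := hF.exists_relOpen hd
  filter_upwards [hT.ae_normal, measure_eq_zero_iff_ae_notMem.1 hnull] with x hx1 hx2 hxF
  obtain ⟨n, hn⟩ := hx1 (hFT hxF)
  rw [hn.eq_outwardNormal]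
  refine ⟨hn, ?_⟩
  have hxF' : x ∈ F := by
    by_contra hcon
    exact hx2 ⟨hxF, hcon⟩
  have hxh : x ∈ hyper ν p := hcl hxF
  have hxU : x ∈ U := by rw [hFU] at hxF'; exact hxF'.2
  -- Short rays in the facet plane stay in `F`. They are orthogonal to `m` by `hort`, and to `n`
  -- because the frontier of `T` is locally the plane orthogonal to `n`.
  have key : ∀ w ∈ orth ν, ⟪w, m⟫ = 0 ∧ ⟪w, n⟫ = 0 := by
    intro w hw
    obtain ⟨t, ⟨ht1, ht2⟩, ht0⟩ := ((eventually_ray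
      ((hU.eventually_mem hxU).and hn.mem_frontier_iff) w).and
      self_mem_nhdsWithin).exists
    have ht0' : (0 : ℝ) < t := ht0
    have hmem : x + t • w ∈ F := by
      rw [hFU]
      refine ⟨?_, ht1⟩
      rw [hyper_eq_of_mem hxh]
      have := Submodule.mem_orthogonal_singleton_iff_inner_left.1 hw
      simp [inner_smul_left, this]
    have h1 := hort _ (subset_closure hmem) _ hxF
    have h2 := ht2.1 (hFT (subset_closure hmem))
    rw [add_sub_cancel_left, inner_smul_left] at h1 h2
    simp only [conj_trivial, mul_eq_zero, ht0'.ne', false_or] at h1 h2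
    exact ⟨h1, h2⟩
  rcases eq_or_eq_neg_of_orth hν hm (fun w hw => (key w hw).1) with h1 | h1 <;>
    rcases eq_or_eq_neg_of_orth hν hn.1 (fun w hw => (key w hw).2) with h2 | h2 <;> simp [h1, h2]

/-! ### A smooth cutoff -/

/-- An even smooth function with values in `[0, 1]`, vanishing near `0` and equal to `1` outside
`[-1, 1]`. -/
def cut (t : ℝ) : ℝ := Real.smoothTransition (2 * t ^ 2 - 1)

theorem contDiff_cut : ContDiff ℝ ∞ cut :=
  Real.smoothTransition.contDiff.comp (by fun_prop)

theorem cut_nonneg (t : ℝ) : 0 ≤ cut t := Real.smoothTransition.nonneg _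

theorem cut_le_one (t : ℝ) : cut t ≤ 1 := Real.smoothTransition.le_one _

theorem abs_cut_le_one (t : ℝ) : |cut t| ≤ 1 := by
  rw [abs_of_nonneg (cut_nonneg t)]; exact cut_le_one t

theorem cut_eq_zero {t : ℝ} (h : t ^ 2 ≤ 1 / 2) : cut t = 0 :=
  Real.smoothTransition.zero_of_nonpos (by linarith)

theorem cut_eq_one {t : ℝ} (h : 1 ≤ t ^ 2) : cut t = 1 :=
  Real.smoothTransition.one_of_one_le (by linarith)

theorem hasDerivAt_cut (t : ℝ) : HasDerivAt cut (deriv cut t) t :=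
  (contDiff_cut.differentiable (by simp)).differentiableAt.hasDerivAt

theorem continuous_deriv_cut : Continuous (deriv cut) :=
  contDiff_cut.continuous_deriv (by simp)

theorem deriv_cut_eq_zero {t : ℝ} (h : 1 < |t|) : deriv cut t = 0 := by
  have hev : ∀ᶠ s in 𝓝 t, cut s = 1 := by
    have : ∀ᶠ s in 𝓝 t, 1 < |s| :=
      ContinuousAt.eventually_lt continuousAt_const continuous_abs.continuousAt h
    filter_upwards [this] with s hs
    apply cut_eq_one
    rw [← sq_abs]; nlinarith [abs_nonneg s]
  rw [EventuallyEq.deriv_eq (f := fun _ => (1 : ℝ)) hev]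
  simp

theorem hasCompactSupport_deriv_cut : HasCompactSupport (deriv cut) := by
  refine HasCompactSupport.of_support_subset_isCompact (isCompact_Icc (a := -1) (b := 1)) ?_
  intro t ht
  by_contra hcon
  refine ht (deriv_cut_eq_zero ?_)
  by_contra h
  exact hcon (abs_le.1 (not_lt.1 h))

theorem integrable_deriv_cut : Integrable (deriv cut) :=
  continuous_deriv_cut.integrable_of_hasCompactSupport hasCompactSupport_deriv_cut

theorem cut_zero : cut 0 = 0 := cut_eq_zero (by norm_num)

/-- The cutoff rises from `0` at the origin to `1` on both sides, so its derivative has mass `1` on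
the right, `-1` on the left and `0` in total. These numbers become the sign of the normal in the
Gauss-Green limit. -/
theorem integral_deriv_cut_Ioi : ∫ s in Ioi 0, deriv cut s = 1 := by
  have h := integral_Ioi_of_hasDerivAt_of_tendsto (f := cut) (f' := deriv cut) (a := 0) (m := 1)
    (hasDerivAt_cut 0).continuousAt.continuousWithinAt (fun t _ => hasDerivAt_cut t)
    integrable_deriv_cut.integrableOn ?_
  · rw [h, cut_zero, sub_zero]
  · refine tendsto_const_nhds.congr' ?_
    filter_upwards [eventually_ge_atTop 1] with t ht
    rw [cut_eq_one (by nlinarith)]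

theorem integral_deriv_cut_Iio : ∫ s in Iio 0, deriv cut s = -1 := by
  rw [← integral_Iic_eq_integral_Iio]
  have h := integral_Iic_of_hasDerivAt_of_tendsto (f := cut) (f' := deriv cut) (a := 0) (m := 1)
    (hasDerivAt_cut 0).continuousAt.continuousWithinAt (fun t _ => hasDerivAt_cut t)
    integrable_deriv_cut.integrableOn ?_
  · rw [h, cut_zero, zero_sub]
  · refine tendsto_const_nhds.congr' ?_
    filter_upwards [eventually_le_atBot (-1)] with t ht
    rw [cut_eq_one (by nlinarith)]

theorem integral_deriv_cut : ∫ s, deriv cut s = 0 := by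
  have h := integral_add_compl (s := Iic (0 : ℝ)) measurableSet_Iic integrable_deriv_cut
  rw [compl_Iic, integral_Ioi_of_hasDerivAt_of_tendsto (f := cut) (m := 1)
    (hasDerivAt_cut 0).continuousAt.continuousWithinAt (fun t _ => hasDerivAt_cut t)
    integrable_deriv_cut.integrableOn, integral_Iic_eq_integral_Iio, integral_deriv_cut_Iio,
    cut_zero] at h
  · linarith
  · refine tendsto_const_nhds.congr' ?_
    filter_upwards [eventually_ge_atTop 1] with t ht
    rw [cut_eq_one (by nlinarith)]

/-! ### Integration over slabs around a hyperplane -/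

theorem continuous_orth_prod {d : ℕ} (ν p : Space d) (δ : ℝ) :
    Continuous (fun z : orth ν × ℝ => p + (z.1 : Space d) + (δ * z.2) • ν) := by fun_prop

/-- Fubini's theorem in the direction `ν`, with the normal variable scaled by `δ`. -/
theorem integral_eq_integral_orth_scaled {d : ℕ} {ν : Space d} (hν : ‖ν‖ = 1) (p : Space d)
    {δ : ℝ} (hδ : 0 < δ) {G : Space d → ℝ} (hG : AEStronglyMeasurable G volume) :
    ∫ x, G x = δ * ∫ z : orth ν × ℝ, G (p + (z.1 : Space d) + (δ * z.2) • ν)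
      ∂(volume.prod volume) := by
  have hmp := measurePreserving_orth_prod hν p
  have hscale : ENNReal.ofReal δ • ((volume : Measure (orth ν)).prod (volume : Measure ℝ)).map
      (Prod.map id (δ * ·)) = volume.prod volume := by
    have h1 := Real.smul_map_volume_mul_left hδ.ne'
    rw [abs_of_pos hδ] at h1
    conv_rhs => rw [← h1]
    rw [Measure.prod_smul_right, ← Measure.map_prod_map _ _ measurable_id (measurable_const_mul δ),
      Measure.map_id]
  have hGm : AEStronglyMeasurable (fun z : orth ν × ℝ => G (p + (z.1 : Space d) + z.2 • ν))
      (volume.prod volume) := hG.comp_measurePreserving hmp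
  have hGs : AEStronglyMeasurable (fun z : orth ν × ℝ => G (p + (z.1 : Space d) + z.2 • ν))
      (((volume : Measure (orth ν)).prod (volume : Measure ℝ)).map (Prod.map id (δ * ·))) := by
    rw [← hscale] at hGm
    refine hGm.mono_ac ?_
    refine Measure.AbsolutelyContinuous.mk fun s _ hs => ?_
    rw [Measure.smul_apply, smul_eq_mul, mul_eq_zero] at hs
    exact hs.resolve_left (by simpa using hδ)
  calc ∫ x, G x = ∫ z : orth ν × ℝ, G (p + (z.1 : Space d) + z.2 • ν) ∂(volume.prod volume) := by
        rw [← hmp.map_eq, integral_map hmp.measurable.aemeasurable]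
        rwa [hmp.map_eq]
    _ = _ := by
        conv_lhs => rw [← hscale]
        rw [integral_smul_measure, integral_map
          (measurable_id.prodMap (measurable_const_mul δ)).aemeasurable hGs]
        simp [hδ.le]

theorem tendsto_add_mul_smul {d : ℕ} (y ν : Space d) (s : ℝ) :
    Tendsto (fun δ : ℝ => y + (δ * s) • ν) (𝓝[>] 0) (𝓝 y) := by
  have : Tendsto (fun δ : ℝ => y + (δ * s) • ν) (𝓝 0) (𝓝 (y + ((0 : ℝ) * s) • ν)) :=
    Continuous.tendsto (by fun_prop) 0
  rw [zero_mul, zero_smul, add_zero] at this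
  exact this.mono_left nhdsWithin_le_nhds

theorem measurable_indicator_of_continuousOn {X : Type*} [TopologicalSpace X] [MeasurableSpace X]
    [OpensMeasurableSpace X] {T : Set X} (hT : IsOpen T) {F : X → ℝ} (hF : ContinuousOn F T) :
    Measurable (T.indicator F) := by
  classical
  rw [← piecewise_eq_indicator]
  exact hF.measurable_piecewise continuousOn_const hT.measurableSet

/-- Off the hyperplanes the arguments of `cut` grow like `1 / δ`. The point may move with `δ`, since
the slices evaluate the product at `y + (δ * s) • ν`. -/
theorem eventually_prod_cut_eq_one {d : ℕ} {J : Finset (Space d × Space d)} {y : Space d}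
    (hy : ∀ k ∈ J, y ∉ hyper k.1 k.2) (x : ℝ → Space d) (hx : Tendsto x (𝓝[>] 0) (𝓝 y)) :
    ∀ᶠ δ in 𝓝[>] (0 : ℝ), ∏ k ∈ J, cut (⟪k.1, x δ - k.2⟫ / δ) = 1 := by
  have h : ∀ᶠ δ in 𝓝[>] (0 : ℝ), ∀ k ∈ J, cut (⟪k.1, x δ - k.2⟫ / δ) = 1 := by
    rw [Finset.eventually_all]
    intro k hk
    have hne : 0 < |⟪k.1, y - k.2⟫| := abs_pos.2 (hy k hk)
    have hlim : Tendsto (fun δ => |⟪k.1, x δ - k.2⟫|) (𝓝[>] 0) (𝓝 |⟪k.1, y - k.2⟫|) := by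
      have hc : Continuous fun z : Space d => |⟪k.1, z - k.2⟫| := by fun_prop
      exact (hc.tendsto y).comp hx
    have h1 := hlim.eventually_const_lt (half_lt_self hne)
    have h2 : ∀ᶠ δ in 𝓝[>] (0 : ℝ), δ < |⟪k.1, y - k.2⟫| / 2 :=
      nhdsWithin_le_nhds (eventually_lt_nhds (half_pos hne))
    filter_upwards [h1, h2, self_mem_nhdsWithin] with δ h1 h2 h3
    have hδ : (0 : ℝ) < δ := h3
    apply cut_eq_one
    rw [div_pow, le_div_iff₀ (by positivity), one_mul, ← sq_abs ⟪k.1, x δ - k.2⟫]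
    exact pow_le_pow_left₀ hδ.le (by linarith) 2
  filter_upwards [h] with δ hδ
  exact Finset.prod_eq_one hδ

theorem abs_prod_cut_le_one {ι : Type*} (J : Finset ι) (t : ι → ℝ) :
    |∏ k ∈ J, cut (t k)| ≤ 1 := by
  rw [Finset.abs_prod]
  exact Finset.prod_le_one (fun _ _ => abs_nonneg _) fun _ _ => abs_cut_le_one _

/-- Near `y` the frontier is the plane orthogonal to `n` and can lie on no hyperplane but `j`; short
rays in that plane therefore stay in `hyper j.1 j.2`, which makes `j.1` normal to it. -/
theorem outwardNormal_eq_or_neg_of_hyper {d : ℕ} {T : Set (Space d)} {H : HyperplaneFamily d}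
    (hT : PolyDomain T H) {j : Space d × Space d} (hj : j ∈ H.data) {y n : Space d}
    (hy : y ∈ hyper j.1 j.2) (hother : ∀ k ∈ H.data.erase j, y ∉ hyper k.1 k.2)
    (hn : IsOutwardNormal T y n) : n = j.1 ∨ n = -j.1 := by
  have hloc : ∀ᶠ z in 𝓝 y, ∀ k ∈ H.data.erase j, z ∉ hyper k.1 k.2 := by
    rw [Finset.eventually_all]
    intro k hk
    exact (isClosed_hyper k.1 k.2).isOpen_compl.eventually_mem (hother k hk)
  have hw : ∀ w ∈ orth n, ⟪w, j.1⟫ = 0 := by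
    intro w hw
    obtain ⟨t, ⟨ht1, ht2⟩, ht0⟩ := ((eventually_ray
      (hn.mem_frontier_iff.and hloc) w).and self_mem_nhdsWithin).exists
    have ht0' : (0 : ℝ) < t := ht0
    have hfr := ht1.2 (by
      rw [add_sub_cancel_left, inner_smul_left,
        Submodule.mem_orthogonal_singleton_iff_inner_left.1 hw, mul_zero])
    obtain ⟨k, hk, hmem⟩ := mem_iUnion₂.1 (hT.frontier_subset hfr)
    have hkj : k = j := by
      by_contra hne
      exact ht2 k (Finset.mem_erase.2 ⟨hne, hk⟩) hmem
    rw [hkj, hyper_eq_of_mem hy] at hmem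
    have : ⟪y + t • w - y, j.1⟫ = 0 := hmem
    rw [add_sub_cancel_left, inner_smul_left] at this
    simpa [ht0'.ne'] using this
  rcases eq_or_eq_neg_of_orth hn.1 (H.unit j hj) hw with h | h
  · left; exact h.symm
  · right; rw [h, neg_neg]

/-- The limit, along the normal to a hyperplane through `y`, of the means of `F` with the odd weight
`deriv cut`: only the boundary points of `T` contribute. -/
theorem tendsto_slice {d : ℕ} {T : Set (Space d)} {H : HyperplaneFamily d}
    (hT : PolyDomain T H) {j : Space d × Space d} (hj : j ∈ H.data) {F B : Space d → ℝ} {C : ℝ}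
    (hFc : ContinuousOn F T) (hFb : ∀ x ∈ T, |F x| ≤ C) {y : Space d}
    (hy : y ∈ hyper j.1 j.2) (hother : ∀ k ∈ H.data.erase j, y ∉ hyper k.1 k.2)
    (hn : y ∈ frontier T → ∃ n, IsOutwardNormal T y n)
    (hB : y ∈ frontier T → Tendsto F (𝓝[T] y) (𝓝 (B y))) :
    Tendsto (fun δ : ℝ => ∫ s : ℝ, T.indicator F (y + (δ * s) • j.1) *
        (∏ k ∈ H.data.erase j, cut (⟪k.1, y + (δ * s) • j.1 - k.2⟫ / δ)) * deriv cut s)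
      (𝓝[>] 0)
      (𝓝 ((frontier T).indicator (fun y => -(B y * ⟪outwardNormal T y, j.1⟫)) y)) := by
  have hνν : ⟪j.1, j.1⟫ = 1 := by rw [real_inner_self_eq_norm_sq, H.unit j hj]; norm_num
  have hmeas : ∀ δ : ℝ, AEStronglyMeasurable (fun s : ℝ => T.indicator F (y + (δ * s) • j.1) *
        (∏ k ∈ H.data.erase j, cut (⟪k.1, y + (δ * s) • j.1 - k.2⟫ / δ)) * deriv cut s)
        volume := by
    intro δ
    have h1 : Measurable (T.indicator F) := measurable_indicator_of_continuousOn hT.isOpen hFc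
    have h2 : Measurable (fun s : ℝ => T.indicator F (y + (δ * s) • j.1)) :=
      h1.comp (by fun_prop)
    have h3 : Continuous fun s : ℝ =>
        ∏ k ∈ H.data.erase j, cut (⟪k.1, y + (δ * s) • j.1 - k.2⟫ / δ) :=
      continuous_finsetProd _ fun k _ => contDiff_cut.continuous.comp (by fun_prop)
    exact ((h2.mul h3.measurable).mul continuous_deriv_cut.measurable).aestronglyMeasurable
  have hbound : ∀ δ s : ℝ, ‖T.indicator F (y + (δ * s) • j.1) *
        (∏ k ∈ H.data.erase j, cut (⟪k.1, y + (δ * s) • j.1 - k.2⟫ / δ)) * deriv cut s‖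
        ≤ |C| * |deriv cut s| := by
    intro δ s
    rw [norm_mul, norm_mul, Real.norm_eq_abs, Real.norm_eq_abs, Real.norm_eq_abs]
    refine mul_le_mul_of_nonneg_right ?_ (abs_nonneg _)
    have h1 : |T.indicator F (y + (δ * s) • j.1)| ≤ |C| := by
      by_cases hm : y + (δ * s) • j.1 ∈ T
      · rw [indicator_of_mem hm]; exact (hFb _ hm).trans (le_abs_self C)
      · rw [indicator_of_notMem hm]; simp
    calc _ ≤ |C| * 1 := mul_le_mul h1 (abs_prod_cut_le_one _ _) (abs_nonneg _) (abs_nonneg _)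
      _ = |C| := mul_one _
  have hInt : Integrable fun s : ℝ => |C| * |deriv cut s| :=
    integrable_deriv_cut.abs.const_mul _
  -- it suffices to identify the limit of the values of `F` along almost every ray
  have main : ∀ c : ℝ → ℝ, (∀ s : ℝ, s ≠ 0 →
      Tendsto (fun δ : ℝ => T.indicator F (y + (δ * s) • j.1)) (𝓝[>] 0) (𝓝 (c s))) →
      Tendsto (fun δ : ℝ => ∫ s : ℝ, T.indicator F (y + (δ * s) • j.1) *
        (∏ k ∈ H.data.erase j, cut (⟪k.1, y + (δ * s) • j.1 - k.2⟫ / δ)) * deriv cut s)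
      (𝓝[>] 0) (𝓝 (∫ s, c s * deriv cut s)) := by
    intro c hc
    refine tendsto_integral_filter_of_dominated_convergence _ (Eventually.of_forall hmeas)
      (Eventually.of_forall fun δ => Eventually.of_forall (hbound δ)) hInt ?_
    have h0 : ∀ᵐ s : ℝ, s ≠ 0 := by
      rw [ae_iff]; simp
    filter_upwards [h0] with s hs
    refine Tendsto.mul_const _ ?_
    have := (hc s hs).mul (tendsto_const_nhds.congr' ((eventually_prod_cut_eq_one hother _
      (tendsto_add_mul_smul y j.1 s)).mono fun δ h => h.symm))
    rwa [mul_one] at this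
  by_cases hyT : y ∈ T
  · have hyf : y ∉ frontier T := by rw [hT.isOpen.frontier_eq]; exact fun h => h.2 hyT
    rw [indicator_of_notMem hyf]
    have := main (fun _ => F y) fun s _ => by
      have h1 := ((hFc y hyT).continuousAt (hT.isOpen.mem_nhds hyT)).tendsto.comp
        (tendsto_add_mul_smul y j.1 s)
      refine h1.congr' ?_
      filter_upwards [(tendsto_add_mul_smul y j.1 s).eventually
        (hT.isOpen.eventually_mem hyT)] with δ hδ
      rw [indicator_of_mem hδ]; rfl
    rwa [integral_const_mul, integral_deriv_cut, mul_zero] at this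
  by_cases hyf : y ∈ frontier T
  swap
  · rw [indicator_of_notMem hyf]
    have hyc : y ∉ closure T := fun h => hyf (by rw [hT.isOpen.frontier_eq]; exact ⟨h, hyT⟩)
    have := main (fun _ => 0) fun s _ => by
      refine tendsto_const_nhds.congr' ?_
      filter_upwards [(tendsto_add_mul_smul y j.1 s).eventually
        (isClosed_closure.isOpen_compl.eventually_mem hyc)] with δ hδ
      rw [indicator_of_notMem fun h => hδ (subset_closure h)]
    simpa using this
  rw [indicator_of_mem hyf]
  obtain ⟨n, hn⟩ := hn hyf
  rw [hn.eq_outwardNormal]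
  have hB' := hB hyf
  -- A ray of direction `s • j.1` enters `T` exactly when `s * ⟪j.1, n⟫ < 0`; otherwise the
  -- indicator vanishes along it.
  have hside : ∀ s : ℝ, s ≠ 0 →
      Tendsto (fun δ : ℝ => T.indicator F (y + (δ * s) • j.1)) (𝓝[>] 0)
        (𝓝 (if s * ⟪j.1, n⟫ < 0 then B y else 0)) := by
    intro s hs
    have hev := (tendsto_add_mul_smul y j.1 s).eventually hn.2
    split_ifs with hsn
    · have hmem : ∀ᶠ δ in 𝓝[>] (0 : ℝ), y + (δ * s) • j.1 ∈ T := by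
        filter_upwards [hev, self_mem_nhdsWithin] with δ hδ hδ0
        have hδ0' : (0 : ℝ) < δ := hδ0
        rw [hδ, add_sub_cancel_left, inner_smul_left, conj_trivial, mul_assoc]
        exact mul_neg_of_pos_of_neg hδ0' hsn
      have h1 := hB'.comp (tendsto_nhdsWithin_iff.2 ⟨tendsto_add_mul_smul y j.1 s, hmem⟩)
      refine h1.congr' ?_
      filter_upwards [hmem] with δ hδ
      rw [indicator_of_mem hδ]; rfl
    · refine tendsto_const_nhds.congr' ?_
      filter_upwards [hev, self_mem_nhdsWithin] with δ hδ hδ0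
      have hδ0' : (0 : ℝ) < δ := hδ0
      rw [indicator_of_notMem]
      rw [hδ, add_sub_cancel_left, inner_smul_left, conj_trivial, mul_assoc, not_lt]
      exact mul_nonneg hδ0'.le (not_lt.1 hsn)
  have hfin := main _ hside
  -- For `n = j.1` the half-line `s < 0` survives, with mass `-1`; for `n = -j.1` it is `s > 0`,
  -- with mass `1`. Both masses are `-⟪n, j.1⟫`.
  rcases outwardNormal_eq_or_neg_of_hyper hT hj hy hother hn with h | h
  · rw [h, hνν] at hfin ⊢
    convert hfin using 2
    have : (fun s : ℝ => (if s * 1 < 0 then B y else 0) * deriv cut s)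
        = (Iio 0).indicator fun s => B y * deriv cut s := by
      funext s
      by_cases hs : s < 0 <;> simp [hs, indicator]
    rw [this, integral_indicator measurableSet_Iio, integral_const_mul, integral_deriv_cut_Iio]
    ring
  · rw [h, inner_neg_right, hνν] at hfin
    rw [h, inner_neg_left, hνν]
    convert hfin using 2
    have : (fun s : ℝ => (if s * -1 < 0 then B y else 0) * deriv cut s)
        = (Ioi 0).indicator fun s => B y * deriv cut s := by
      funext s
      by_cases hs : 0 < s <;> simp [hs, indicator]
    rw [this, integral_indicator measurableSet_Ioi, integral_const_mul, integral_deriv_cut_Ioi]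
    ring

theorem HyperplaneFamily.ae_notMem_other {d : ℕ} (H : HyperplaneFamily d) :
    ∀ᵐ y ∂(μHE[d - 1] : Measure (Space d)), ∀ j ∈ H.data, y ∈ hyper j.1 j.2 →
      ∀ k ∈ H.data.erase j, y ∉ hyper k.1 k.2 := by
  rw [Finset.eventually_all]
  intro j hj
  have : ∀ᵐ y ∂(μHE[d - 1] : Measure (Space d)), ∀ k ∈ H.data.erase j,
      y ∉ hyper j.1 j.2 ∩ hyper k.1 k.2 := by
    rw [Finset.eventually_all]
    intro k hk
    rw [Finset.mem_erase] at hk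
    exact measure_eq_zero_iff_ae_notMem.1 (H.inter_null j hj k hk.2 hk.1.symm)
  filter_upwards [this] with y hy hyj k hk hyk
  exact hy k hk ⟨hyj, hyk⟩

theorem continuous_prod_cut {d : ℕ} (J : Finset (Space d × Space d)) (δ : ℝ) :
    Continuous fun x : Space d => ∏ k ∈ J, cut (⟪k.1, x - k.2⟫ / δ) := by
  refine continuous_finsetProd _ fun k _ => ?_
  have : Continuous fun x : Space d => ⟪k.1, x - k.2⟫ / δ := by fun_prop
  exact contDiff_cut.continuous.comp this

/-- In the coordinates `p + w + (δ * s) • ν` the volume factor `δ` cancels the `1 / δ` of the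
derivative. The inner integrals converge by `tendsto_slice` for almost every `w`, and the
boundedness of `T` provides a dominating function. Integrability of the boundary term comes out of
the same limit, so `B` needs no measurability assumption. -/
theorem tendsto_slab {d : ℕ} {T : Set (Space d)} {H : HyperplaneFamily d}
    (hT : PolyDomain T H) {j : Space d × Space d} (hj : j ∈ H.data) {F B : Space d → ℝ} {C : ℝ}
    (hFc : ContinuousOn F T) (hFb : ∀ x ∈ T, |F x| ≤ C)
    (hB : ∀ᵐ y ∂(μHE[d - 1] : Measure (Space d)),
      y ∈ frontier T → Tendsto F (𝓝[T] y) (𝓝 (B y))) :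
    IntegrableOn (fun y => B y * ⟪outwardNormal T y, j.1⟫) (hyper j.1 j.2 ∩ frontier T) μHE[d - 1] ∧
    Tendsto (fun δ : ℝ => ∫ x in T, F x *
        (∏ k ∈ H.data.erase j, cut (⟪k.1, x - k.2⟫ / δ)) * (deriv cut (⟪j.1, x - j.2⟫ / δ) / δ))
      (𝓝[>] 0)
      (𝓝 (-∫ y in hyper j.1 j.2 ∩ frontier T, B y * ⟪outwardNormal T y, j.1⟫ ∂μHE[d - 1])) := by
  obtain ⟨ν, p⟩ := j
  simp only
  have hν : ‖ν‖ = 1 := H.unit (ν, p) hj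
  have hνν : ⟪ν, ν⟫ = 1 := by rw [real_inner_self_eq_norm_sq, hν]; norm_num
  have hind : Measurable (T.indicator F) := measurable_indicator_of_continuousOn hT.isOpen hFc
  have hpc : ∀ δ : ℝ, Continuous fun x : Space d =>
      ∏ k ∈ H.data.erase (ν, p), cut (⟪k.1, x - k.2⟫ / δ) := fun δ =>
    continuous_prod_cut _ δ
  obtain ⟨R₀, hR₀⟩ := hT.bounded.subset_closedBall 0
  -- If `x = p + w + (δ * s) • ν` lies in `T`, with `δ < 1` and `|s| ≤ 1`, then `w = x - p - (δ * s)
  -- • ν` has norm at most `R`.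
  let R := R₀ + ‖p‖ + 1
  let Kf : ℝ → orth ν × ℝ → ℝ := fun δ z =>
    T.indicator F (p + (z.1 : Space d) + (δ * z.2) • ν) *
      (∏ k ∈ H.data.erase (ν, p), cut (⟪k.1, p + (z.1 : Space d) + (δ * z.2) • ν - k.2⟫ / δ)) *
      deriv cut z.2
  have hKm : ∀ δ, Measurable (Kf δ) := fun δ =>
    ((hind.comp (continuous_orth_prod ν p δ).measurable).mul
      ((hpc δ).comp (continuous_orth_prod ν p δ)).measurable).mul
      (continuous_deriv_cut.measurable.comp measurable_snd)
  let bd : orth ν → ℝ := (closedBall (0 : orth ν) R).indicator fun _ => 1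
  have hbdi : Integrable bd := by
    rw [integrable_indicator_iff measurableSet_closedBall]
    exact integrableOn_const measure_closedBall_lt_top.ne
  have hKb : ∀ δ ∈ Ioo (0 : ℝ) 1, ∀ z, ‖Kf δ z‖ ≤ bd z.1 * (|C| * |deriv cut z.2|) := by
    rintro δ ⟨hδ0, hδ1⟩ ⟨w, s⟩
    simp only [Kf, Real.norm_eq_abs, abs_mul]
    by_cases hmem : p + (w : Space d) + (δ * s) • ν ∈ T
    swap
    · rw [indicator_of_notMem hmem]
      simp only [abs_zero, zero_mul]
      have : 0 ≤ bd w := indicator_nonneg (fun _ _ => zero_le_one) _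
      positivity
    rw [indicator_of_mem hmem]
    by_cases hs : 1 < |s|
    · rw [deriv_cut_eq_zero hs]; simp
    rw [not_lt] at hs
    have hw : w ∈ closedBall (0 : orth ν) R := by
      rw [mem_closedBall_zero_iff]
      change ‖(w : Space d)‖ ≤ R
      have h1 : (w : Space d) = (p + (w : Space d) + (δ * s) • ν) - p - (δ * s) • ν := by abel
      have h2 : ‖(δ * s) • ν‖ ≤ 1 := by
        rw [norm_smul, hν, mul_one, Real.norm_eq_abs, abs_mul, abs_of_pos hδ0]
        nlinarith [abs_nonneg s]
      have h3 : ‖p + (w : Space d) + (δ * s) • ν‖ ≤ R₀ := by simpa using hR₀ hmem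
      rw [h1]
      calc _ ≤ ‖p + (w : Space d) + (δ * s) • ν‖ + ‖p‖ + ‖(δ * s) • ν‖ :=
            (norm_sub_le _ _).trans (add_le_add_left (norm_sub_le _ _) _)
        _ ≤ R := by simp only [R]; linarith
    have hbd1 : bd w = 1 := indicator_of_mem hw _
    rw [hbd1, one_mul]
    refine mul_le_mul_of_nonneg_right ?_ (abs_nonneg _)
    calc _ ≤ |C| * 1 := mul_le_mul ((hFb _ hmem).trans (le_abs_self C)) (abs_prod_cut_le_one _ _)
          (abs_nonneg _) (abs_nonneg _)
      _ = |C| := mul_one _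
  have hbd2 : Integrable (fun z : orth ν × ℝ => bd z.1 * (|C| * |deriv cut z.2|))
      (volume.prod volume) := hbdi.mul_prod (integrable_deriv_cut.abs.const_mul _)
  have hKi : ∀ δ ∈ Ioo (0 : ℝ) 1, Integrable (Kf δ) (volume.prod volume) := fun δ hδ =>
    hbd2.mono' (hKm δ).aestronglyMeasurable (Eventually.of_forall (hKb δ hδ))
  have hev : ∀ᶠ δ in 𝓝[>] (0 : ℝ), δ ∈ Ioo (0 : ℝ) 1 := Ioo_mem_nhdsGT one_pos
  have hslab : ∀ δ ∈ Ioo (0 : ℝ) 1, (∫ x in T, F x *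
        (∏ k ∈ H.data.erase (ν, p), cut (⟪k.1, x - k.2⟫ / δ)) *
          (deriv cut (⟪ν, x - p⟫ / δ) / δ)) = ∫ w : orth ν, ∫ s, Kf δ (w, s) := by
    intro δ hδ
    rw [← integral_prod _ (hKi δ hδ), ← integral_indicator hT.isOpen.measurableSet]
    let G : Space d → ℝ := fun x => T.indicator F x *
      (∏ k ∈ H.data.erase (ν, p), cut (⟪k.1, x - k.2⟫ / δ)) * (deriv cut (⟪ν, x - p⟫ / δ) / δ)
    have hG : T.indicator (fun x => F x *
        (∏ k ∈ H.data.erase (ν, p), cut (⟪k.1, x - k.2⟫ / δ)) *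
          (deriv cut (⟪ν, x - p⟫ / δ) / δ)) = G := by
      funext x
      by_cases hx : x ∈ T <;> simp [G, hx]
    have hGm : Measurable G := (hind.mul (hpc δ).measurable).mul
      ((continuous_deriv_cut.comp (by fun_prop)).div_const δ).measurable
    rw [hG, integral_eq_integral_orth_scaled hν p hδ.1 hGm.aestronglyMeasurable,
      ← integral_const_mul]
    congr 1
    funext z
    have hin : ⟪ν, p + (z.1 : Space d) + (δ * z.2) • ν - p⟫ = δ * z.2 := by
      have := Submodule.mem_orthogonal_singleton_iff_inner_right.1 z.1.2
      rw [add_assoc, add_sub_cancel_left, inner_add_right, this, inner_smul_right, hνν]; ring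
    have hδ0 := hδ.1.ne'
    simp only [G, Kf, hin]
    rw [mul_div_cancel_left₀ _ hδ0]
    field_simp
  have hgen : ∀ᵐ w : orth ν, Tendsto (fun δ : ℝ => ∫ s, Kf δ (w, s)) (𝓝[>] 0)
      (𝓝 ((frontier T).indicator (fun y => -(B y * ⟪outwardNormal T y, ν⟫)) (p + w))) := by
    have h1 : ∀ᵐ y ∂(μHE[d - 1] : Measure (Space d)).restrict (hyper ν p),
        y ∈ hyper ν p ∧ (y ∈ frontier T → Tendsto F (𝓝[T] y) (𝓝 (B y))) ∧
        (y ∈ frontier T → ∃ n, IsOutwardNormal T y n) ∧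
        ∀ k ∈ H.data.erase (ν, p), y ∉ hyper k.1 k.2 := by
      rw [ae_restrict_iff' (isClosed_hyper ν p).measurableSet]
      filter_upwards [hB, hT.ae_normal, H.ae_notMem_other] with y h1 h2 h3 hy
      exact ⟨hy, h1, h2, h3 (ν, p) hj hy⟩
    rw [← map_add_orth hν] at h1
    filter_upwards [ae_of_ae_map (isometry_add_orth ν p).continuous.measurable.aemeasurable h1]
      with w hw
    obtain ⟨hw1, hw2, hw3, hw4⟩ := hw
    have key := tendsto_slice (B := B) (y := p + (w : Space d)) (j := (ν, p)) hT hj hFc hFb hw1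
      hw4 hw3 hw2
    simpa only [Kf] using key
  have hinner : ∀ δ ∈ Ioo (0 : ℝ) 1, ∀ w, ‖∫ s, Kf δ (w, s)‖ ≤
      bd w * ∫ s, |C| * |deriv cut s| := by
    intro δ hδ w
    rw [← integral_const_mul]
    exact norm_integral_le_of_norm_le ((integrable_deriv_cut.abs.const_mul _).const_mul _)
      (Eventually.of_forall fun s => hKb δ hδ (w, s))
  have hbd3 : Integrable fun w => bd w * ∫ s, |C| * |deriv cut s| := hbdi.mul_const _
  have hmeas : ∀ δ, AEStronglyMeasurable (fun w : orth ν => ∫ s, Kf δ (w, s)) volume := fun δ =>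
    (hKm δ).stronglyMeasurable.integral_prod_right'.aestronglyMeasurable
  have hlim := tendsto_integral_filter_of_dominated_convergence _
    (Eventually.of_forall hmeas)
    (hev.mono fun δ hδ => Eventually.of_forall (hinner δ hδ)) hbd3 hgen
  have hLi : Integrable fun w : orth ν =>
      (frontier T).indicator (fun y => -(B y * ⟪outwardNormal T y, ν⟫)) (p + w) := by
    refine hbd3.mono' (aestronglyMeasurable_of_tendsto_ae _ hmeas hgen) ?_
    filter_upwards [hgen] with w hw
    exact le_of_tendsto hw.norm (hev.mono fun δ hδ => hinner δ hδ w)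
  have hemb : MeasurableEmbedding (fun w : orth ν => p + (w : Space d)) :=
    (isometry_add_orth ν p).isClosedEmbedding.measurableEmbedding
  have hrr : ((μHE[d - 1] : Measure (Space d)).restrict (hyper ν p)).restrict (frontier T)
      = (μHE[d - 1] : Measure (Space d)).restrict (hyper ν p ∩ frontier T) := by
    rw [Measure.restrict_restrict isClosed_frontier.measurableSet, inter_comm]
  constructor
  · have h1 := (hemb.integrable_map_iff (μ := (volume : Measure (orth ν)))
      (g := (frontier T).indicator (fun y => -(B y * ⟪outwardNormal T y, ν⟫)))).2 hLi
    rw [map_add_orth hν, integrable_indicator_iff isClosed_frontier.measurableSet] at h1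
    rw [IntegrableOn, hrr] at h1
    rw [IntegrableOn]
    simpa using h1.neg
  · have h2 := hemb.integral_map (μ := (volume : Measure (orth ν)))
      (g := (frontier T).indicator (fun y => -(B y * ⟪outwardNormal T y, ν⟫)))
    rw [map_add_orth hν, integral_indicator isClosed_frontier.measurableSet, hrr,
      integral_neg] at h2
    rw [h2]
    refine hlim.congr' ?_
    filter_upwards [hev] with δ hδ
    rw [hslab δ hδ]

/-! ### The Gauss-Green formula on a polytope -/

theorem setIntegral_biUnion_finset_ae {X ι : Type*} [MeasurableSpace X] {μ : Measure X}
    (t : Finset ι) {s : ι → Set X} {f : X → ℝ} (hm : ∀ i ∈ t, MeasurableSet (s i))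
    (hd : ∀ i ∈ t, ∀ j ∈ t, i ≠ j → μ (s i ∩ s j) = 0) (hi : ∀ i ∈ t, IntegrableOn f (s i) μ) :
    ∫ x in ⋃ i ∈ t, s i, f x ∂μ = ∑ i ∈ t, ∫ x in s i, f x ∂μ := by
  classical
  induction t using Finset.induction_on with
  | empty => simp
  | insert a t ha ih =>
    rw [Finset.set_biUnion_insert, setIntegral_union₀, Finset.sum_insert ha, ih]
    · exact fun i hi' => hm i (Finset.mem_insert_of_mem hi')
    · exact fun i hi' j hj => hd i (Finset.mem_insert_of_mem hi') j (Finset.mem_insert_of_mem hj)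
    · exact fun i hi' => hi i (Finset.mem_insert_of_mem hi')
    · rw [AEDisjoint, inter_iUnion₂]
      refine (measure_biUnion_null_iff t.countable_toSet).2 fun i hi' => ?_
      refine hd a (Finset.mem_insert_self a t) i (Finset.mem_insert_of_mem hi') ?_
      rintro rfl
      exact ha hi'
    · exact (t.measurableSet_biUnion fun i hi' =>
        hm i (Finset.mem_insert_of_mem hi')).nullMeasurableSet
    · exact hi a (Finset.mem_insert_self a t)
    · exact (integrableOn_finset_iUnion).2 fun i hi' => hi i (Finset.mem_insert_of_mem hi')

theorem integrableOn_of_continuous {d : ℕ} {T : Set (Space d)} (hT : Bornology.IsBounded T)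
    {E : Type*} [NormedAddCommGroup E] {c : Space d → E} (hc : Continuous c) :
    IntegrableOn c T :=
  (hc.continuousOn.integrableOn_compact hT.isCompact_closure).mono_set subset_closure

theorem exists_bound_of_continuous {d : ℕ} {T : Set (Space d)} (hT : Bornology.IsBounded T)
    {c : Space d → ℝ} (hc : Continuous c) : ∃ M, ∀ x ∈ T, |c x| ≤ M := by
  obtain ⟨M, hM⟩ := hT.isCompact_closure.exists_bound_of_continuousOn hc.continuousOn
  exact ⟨M, fun x hx => hM x (subset_closure hx)⟩

/-- The cutoff near all the hyperplanes of a family. -/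
def HyperplaneFamily.cutoff {d : ℕ} (H : HyperplaneFamily d) (δ : ℝ) (x : Space d) : ℝ :=
  ∏ k ∈ H.data, cut (⟪k.1, x - k.2⟫ / δ)

theorem HyperplaneFamily.contDiff_cutoff {d : ℕ} (H : HyperplaneFamily d) (δ : ℝ) :
    ContDiff ℝ ∞ (H.cutoff δ) := by
  unfold HyperplaneFamily.cutoff
  refine contDiff_prod fun k _ => ?_
  have : ContDiff ℝ ∞ fun x : Space d => ⟪k.1, x - k.2⟫ / δ :=
    (contDiff_const.inner ℝ (contDiff_id.sub contDiff_const)).div_const δ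
  exact contDiff_cut.comp this

theorem HyperplaneFamily.fderiv_cutoff {d : ℕ} (H : HyperplaneFamily d) (δ : ℝ)
    (x e : Space d) : fderiv ℝ (H.cutoff δ) x e = ∑ j ∈ H.data,
      (∏ k ∈ H.data.erase j, cut (⟪k.1, x - k.2⟫ / δ)) *
        (deriv cut (⟪j.1, x - j.2⟫ / δ) / δ) * ⟪j.1, e⟫ := by
  have h1 : ∀ j ∈ H.data, HasFDerivAt (fun x : Space d => cut (⟪j.1, x - j.2⟫ / δ))
      ((deriv cut (⟪j.1, x - j.2⟫ / δ) / δ) • innerSL ℝ j.1) x := by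
    intro j _
    have h2 : HasFDerivAt (fun x : Space d => ⟪j.1, x - j.2⟫ / δ) (δ⁻¹ • innerSL ℝ j.1) x := by
      have h3 : HasFDerivAt (fun x : Space d => innerSL ℝ j.1 (x - j.2)) (innerSL ℝ j.1) x := by
        have := ((innerSL ℝ j.1).hasFDerivAt (x := x - j.2)).comp x
          ((hasFDerivAt_id x).sub_const j.2)
        rwa [ContinuousLinearMap.comp_id] at this
      have h4 := h3.const_mul δ⁻¹
      refine h4.congr_of_eventuallyEq (Eventually.of_forall fun y => ?_)
      simp [div_eq_inv_mul]
    have h5 := (hasDerivAt_cut (⟪j.1, x - j.2⟫ / δ)).comp_hasFDerivAt x h2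
    rw [smul_smul, ← div_eq_mul_inv] at h5
    exact h5
  have h6 := (HasFDerivAt.finsetProd h1).fderiv
  have h7 : H.cutoff δ = fun x => ∏ k ∈ H.data, cut (⟪k.1, x - k.2⟫ / δ) := rfl
  rw [h7, h6, sum_apply]
  refine Finset.sum_congr rfl fun j _ => ?_
  simp [mul_assoc]

/-- Since `cut` vanishes on a whole neighbourhood of `0`, so does the product near each hyperplane;
this makes the truncated test functions admissible. -/
theorem HyperplaneFamily.cutoff_eventually_zero {d : ℕ} (H : HyperplaneFamily d) {δ : ℝ}
    {x : Space d} (hx : x ∈ ⋃ j ∈ H.data, hyper j.1 j.2) :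
    ∀ᶠ y in 𝓝 x, H.cutoff δ y = 0 := by
  obtain ⟨k, hk, hxk⟩ := mem_iUnion₂.1 hx
  have h0 : ⟪k.1, x - k.2⟫ = 0 := hxk
  have hc : Continuous fun y : Space d => (⟪k.1, y - k.2⟫ / δ) ^ 2 := by fun_prop
  have : ∀ᶠ y in 𝓝 x, (⟪k.1, y - k.2⟫ / δ) ^ 2 < 1 / 2 :=
    hc.continuousAt.eventually_lt continuousAt_const (by rw [h0]; norm_num)
  filter_upwards [this] with y hy
  exact Finset.prod_eq_zero hk (cut_eq_zero hy.le)

theorem HyperplaneFamily.ae_cutoff_tendsto {d : ℕ} (H : HyperplaneFamily d) :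
    ∀ᵐ x : Space d, Tendsto (fun δ => H.cutoff δ x) (𝓝[>] 0) (𝓝 1) := by
  have h : ∀ᵐ x : Space d, ∀ k ∈ H.data, x ∉ hyper k.1 k.2 := by
    rw [Finset.eventually_all]
    intro k hk
    exact measure_eq_zero_iff_ae_notMem.1 (hyper_volume_null (H.unit k hk) k.2)
  filter_upwards [h] with x hx
  exact tendsto_const_nhds.congr' ((eventually_prod_cut_eq_one hx (fun _ => x)
    tendsto_const_nhds).mono fun δ h => h.symm)

theorem PolyDomain.frontier_eq_biUnion {d : ℕ} {T : Set (Space d)} {H : HyperplaneFamily d}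
    (hT : PolyDomain T H) :
    frontier T = ⋃ j ∈ H.data, (hyper j.1 j.2 ∩ frontier T) := by
  rw [← iUnion₂_inter, inter_eq_right.2 hT.frontier_subset]

theorem PolyDomain.measure_frontier_lt_top {d : ℕ} {T : Set (Space d)} {H : HyperplaneFamily d}
    (hT : PolyDomain T H) : μHE[d - 1] (frontier T) < ⊤ := by
  rw [hT.frontier_eq_biUnion]
  refine (measure_biUnion_finset_le _ _).trans_lt (ENNReal.sum_lt_top.2 fun j hj => ?_)
  exact hyper_inter_bounded_lt_top (H.unit j hj) j.2
    (hT.bounded.closure.subset frontier_subset_closure)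

theorem PolyDomain.volume_frontier {d : ℕ} {T : Set (Space d)} {H : HyperplaneFamily d}
    (hT : PolyDomain T H) : volume (frontier T) = 0 := by
  refine measure_mono_null hT.frontier_subset ?_
  exact (measure_biUnion_null_iff H.data.countable_toSet).2 fun j hj =>
    hyper_volume_null (H.unit j hj) j.2

/-- The indicator does not destroy smoothness, because the cutoff vanishes near the hyperplanes and
these contain the frontier. The product is thus a test function for `HasWeakPartial`, although `φ`
itself need not vanish on the boundary. -/
theorem PolyDomain.contDiff_test {d : ℕ} {T : Set (Space d)} {H : HyperplaneFamily d}
    (hT : PolyDomain T H) {φ : Space d → ℝ} (hφ : ContDiff ℝ ∞ φ) (δ : ℝ) :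
    ContDiff ℝ ∞ (T.indicator fun x => H.cutoff δ x * φ x) ∧
      HasCompactSupport (T.indicator fun x => H.cutoff δ x * φ x) ∧
      tsupport (T.indicator fun x => H.cutoff δ x * φ x) ⊆ T := by
  have hfr : ∀ x ∈ frontier T, (T.indicator fun x => H.cutoff δ x * φ x) =ᶠ[𝓝 x] 0 := by
    intro x hx
    filter_upwards [H.cutoff_eventually_zero (δ := δ) (hT.frontier_subset hx)] with y hy
    by_cases hyT : y ∈ T <;> simp [hyT, hy]
  have hsupp : Function.support (T.indicator fun x => H.cutoff δ x * φ x) ⊆ T :=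
    support_indicator_subset
  refine ⟨?_, ?_, ?_⟩
  · rw [contDiff_iff_contDiffAt]
    intro x
    by_cases hx : x ∈ frontier T
    · exact (contDiffAt_const (c := (0 : ℝ))).congr_of_eventuallyEq (hfr x hx)
    by_cases hxT : x ∈ T
    · refine ((H.contDiff_cutoff δ).mul hφ).contDiffAt.congr_of_eventuallyEq ?_
      filter_upwards [hT.isOpen.mem_nhds hxT] with y hy
      rw [indicator_of_mem hy]
    · have hxc : x ∉ closure T := fun h => hx (by rw [hT.isOpen.frontier_eq]; exact ⟨h, hxT⟩)
      refine (contDiffAt_const (c := (0 : ℝ))).congr_of_eventuallyEq ?_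
      filter_upwards [isClosed_closure.isOpen_compl.mem_nhds hxc] with y hy
      rw [indicator_of_notMem fun h => hy (subset_closure h)]
  · exact HasCompactSupport.of_support_subset_isCompact hT.bounded.isCompact_closure
      (hsupp.trans subset_closure)
  · intro x hx
    by_contra hxT
    have hxc : x ∈ closure T := closure_mono hsupp hx
    have hxf : x ∈ frontier T := by rw [hT.isOpen.frontier_eq]; exact ⟨hxc, hxT⟩
    exact (notMem_tsupport_iff_eventuallyEq.2 (hfr x hxf)) hx

/-- The Gauss-Green formula on a Lipschitz polytope, for a bounded function `f` with a weak partial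
derivative and a limit `b` at almost every boundary point, tested with a smooth `φ`. -/
theorem PolyDomain.gauss_green {d : ℕ} {T : Set (Space d)} {H : HyperplaneFamily d}
    (hT : PolyDomain T H) {f g b φ : Space d → ℝ} {i : Fin d} {C : ℝ}
    (hfc : ContinuousOn f T) (hfb : ∀ x ∈ T, |f x| ≤ C)
    (hb : ∀ᵐ y ∂(μHE[d - 1] : Measure (Space d)),
      y ∈ frontier T → Tendsto f (𝓝[T] y) (𝓝 (b y)))
    (hg : IntegrableOn g T) (hw : HasWeakPartial T f i g) (hφ : ContDiff ℝ ∞ φ) :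
    IntegrableOn (fun x => b x * φ x * outwardNormal T x i) (frontier T) μHE[d - 1] ∧
    ∫ x in T, (f x * fderiv ℝ φ x (EuclideanSpace.single i 1) + g x * φ x)
      = ∫ x in frontier T, b x * φ x * outwardNormal T x i ∂μHE[d - 1] := by
  set e : Space d := EuclideanSpace.single i 1 with he
  have hTm := hT.isOpen.measurableSet
  have hφc : Continuous φ := hφ.continuous
  have hφ'c : Continuous fun x => fderiv ℝ φ x e :=
    (hφ.continuous_fderiv (by simp)).clm_apply continuous_const
  obtain ⟨M, hM⟩ := exists_bound_of_continuous hT.bounded hφc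
  have hfm : AEStronglyMeasurable f (volume.restrict T) := hfc.aestronglyMeasurable hTm
  have hfbd : ∀ᵐ x ∂volume.restrict T, ‖f x‖ ≤ C := ae_restrict_of_forall_mem hTm hfb
  have hfint : ∀ {c : Space d → ℝ}, Continuous c → IntegrableOn (fun x => f x * c x) T :=
    fun hc => (integrableOn_of_continuous hT.bounded hc).bdd_mul hfm hfbd
  have hgφ : IntegrableOn (fun x => g x * φ x) T :=
    hg.mul_bdd hφc.aestronglyMeasurable (ae_restrict_of_forall_mem hTm hM)
  have hcut1 : ∀ δ x, |H.cutoff δ x| ≤ 1 := fun δ x => abs_prod_cut_le_one _ _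
  have hFc : ContinuousOn (fun x => f x * φ x) T := hfc.mul hφc.continuousOn
  have hFb : ∀ x ∈ T, |f x * φ x| ≤ C * M := by
    intro x hx
    rw [abs_mul]
    exact mul_le_mul (hfb x hx) (hM x hx) (abs_nonneg _) ((abs_nonneg _).trans (hfb x hx))
  have hB : ∀ᵐ y ∂(μHE[d - 1] : Measure (Space d)),
      y ∈ frontier T → Tendsto (fun x => f x * φ x) (𝓝[T] y) (𝓝 (b y * φ y)) := by
    filter_upwards [hb] with y hy hyf
    exact (hy hyf).mul (hφc.continuousAt.mono_left nhdsWithin_le_nhds)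
  have hslab := fun j (hj : j ∈ H.data) =>
    tendsto_slab (B := fun y => b y * φ y) hT hj hFc hFb hB
  -- on each hyperplane, the normal is `±` that of the hyperplane
  have hnormal : ∀ j ∈ H.data, ∀ᵐ y ∂(μHE[d - 1] : Measure (Space d)).restrict
      (hyper j.1 j.2 ∩ frontier T), b y * φ y * ⟪outwardNormal T y, j.1⟫ * ⟪j.1, e⟫
        = b y * φ y * outwardNormal T y i := by
    intro j hj
    rw [ae_restrict_iff' ((isClosed_hyper _ _).inter isClosed_frontier).measurableSet]
    filter_upwards [hT.ae_normal, H.ae_notMem_other] with y h1 h2 hy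
    obtain ⟨n, hn⟩ := h1 hy.2
    have hjj : ⟪j.1, j.1⟫ = 1 := by rw [real_inner_self_eq_norm_sq, H.unit j hj]; norm_num
    have hje : ⟪j.1, e⟫ = j.1 i := by
      rw [he, EuclideanSpace.inner_single_right]; simp
    rw [hn.eq_outwardNormal, hje]
    rcases outwardNormal_eq_or_neg_of_hyper hT hj hy.1 (h2 j hj hy.1) hn with h | h
    · rw [h, hjj]; ring
    · rw [h, inner_neg_left, hjj, PiLp.neg_apply]; ring
  have hInt : ∀ j ∈ H.data, IntegrableOn (fun x => b x * φ x * outwardNormal T x i)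
      (hyper j.1 j.2 ∩ frontier T) μHE[d - 1] := fun j hj =>
    ((hslab j hj).1.mul_const ⟪j.1, e⟫).congr (hnormal j hj)
  have hfrint : IntegrableOn (fun x => b x * φ x * outwardNormal T x i) (frontier T)
      μHE[d - 1] := by
    rw [hT.frontier_eq_biUnion, integrableOn_finset_iUnion]
    exact hInt
  refine ⟨hfrint, ?_⟩
  have hsum : ∫ x in frontier T, b x * φ x * outwardNormal T x i ∂μHE[d - 1]
      = ∑ j ∈ H.data, (∫ y in hyper j.1 j.2 ∩ frontier T,
        b y * φ y * ⟪outwardNormal T y, j.1⟫ ∂μHE[d - 1]) * ⟪j.1, e⟫ := by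
    conv_lhs => rw [hT.frontier_eq_biUnion]
    rw [setIntegral_biUnion_finset_ae _ _ _ hInt]
    · refine Finset.sum_congr rfl fun j hj => ?_
      rw [← integral_mul_const]
      exact integral_congr_ae ((hnormal j hj).mono fun y hy => hy.symm)
    · exact fun j hj => ((isClosed_hyper _ _).inter isClosed_frontier).measurableSet
    · intro j hj k hk hjk
      exact measure_mono_null (inter_subset_inter inter_subset_left inter_subset_left)
        (H.inter_null j hj k hk hjk)
  -- the identity obtained by testing with the truncated function
  have hid : ∀ δ : ℝ, (∑ j ∈ H.data, (∫ x in T, f x * φ x *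
        (∏ k ∈ H.data.erase j, cut (⟪k.1, x - k.2⟫ / δ)) *
          (deriv cut (⟪j.1, x - j.2⟫ / δ) / δ)) * ⟪j.1, e⟫)
      = -∫ x in T, H.cutoff δ x * (f x * fderiv ℝ φ x e + g x * φ x) := by
    intro δ
    obtain ⟨ht1, ht2, ht3⟩ := hT.contDiff_test hφ δ
    have hweak := hw _ ht1 ht2 ht3
    have hcutc := (H.contDiff_cutoff δ).continuous
    have hterm : ∀ j ∈ H.data, IntegrableOn (fun x => f x * φ x *
        (∏ k ∈ H.data.erase j, cut (⟪k.1, x - k.2⟫ / δ)) *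
          (deriv cut (⟪j.1, x - j.2⟫ / δ) / δ) * ⟪j.1, e⟫) T := by
      intro j _
      have hc1 : Continuous fun x : Space d => ⟪j.1, x - j.2⟫ / δ := by fun_prop
      have hc : Continuous fun x : Space d => φ x *
        (∏ k ∈ H.data.erase j, cut (⟪k.1, x - k.2⟫ / δ)) *
          (deriv cut (⟪j.1, x - j.2⟫ / δ) / δ) :=
        (hφc.mul (continuous_prod_cut _ δ)).mul ((continuous_deriv_cut.comp hc1).div_const δ)
      exact IntegrableOn.congr_fun ((hfint hc).mul_const ⟪j.1, e⟫) (fun x _ => by ring) hTm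
    have hL : ∫ x in T, f x * fderiv ℝ (T.indicator fun x => H.cutoff δ x * φ x) x e
        = (∫ x in T, H.cutoff δ x * (f x * fderiv ℝ φ x e)) +
          ∑ j ∈ H.data, (∫ x in T, f x * φ x *
            (∏ k ∈ H.data.erase j, cut (⟪k.1, x - k.2⟫ / δ)) *
              (deriv cut (⟪j.1, x - j.2⟫ / δ) / δ)) * ⟪j.1, e⟫ := by
      simp_rw [← integral_mul_const]
      rw [← integral_finsetSum _ hterm, ← integral_add]
      · refine setIntegral_congr_fun hTm fun x hx => ?_
        have hev : (T.indicator fun x => H.cutoff δ x * φ x) =ᶠ[𝓝 x]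
            fun x => H.cutoff δ x * φ x := by
          filter_upwards [hT.isOpen.mem_nhds hx] with y hy
          rw [indicator_of_mem hy]
        rw [hev.fderiv_eq, fderiv_fun_mul ((H.contDiff_cutoff δ).differentiable (by simp) x)
          (hφ.differentiable (by simp) x)]
        simp only [add_apply, smul_apply, smul_eq_mul]
        rw [H.fderiv_cutoff, mul_add, Finset.mul_sum, Finset.mul_sum]
        congr 1
        · ring
        · exact Finset.sum_congr rfl fun j _ => by ring
      · exact IntegrableOn.congr_fun (hfint (hcutc.mul hφ'c))
          (fun x _ => by simp only [Pi.mul_apply]; ring) hTm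
      · exact integrable_finsetSum _ hterm
    have hR : ∫ x in T, g x * (T.indicator fun x => H.cutoff δ x * φ x) x
        = ∫ x in T, H.cutoff δ x * (g x * φ x) := by
      refine setIntegral_congr_fun hTm fun x hx => ?_
      simp only [indicator_of_mem hx]
      ring
    have hsplit : ∫ x in T, H.cutoff δ x * (f x * fderiv ℝ φ x e + g x * φ x)
        = (∫ x in T, H.cutoff δ x * (f x * fderiv ℝ φ x e)) +
          ∫ x in T, H.cutoff δ x * (g x * φ x) := by
      simp_rw [mul_add]
      refine integral_add ?_ ?_
      · exact (hfint hφ'c).bdd_mul hcutc.aestronglyMeasurable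
          (Eventually.of_forall fun x => hcut1 δ x)
      · exact Integrable.bdd_mul hgφ hcutc.aestronglyMeasurable
          (Eventually.of_forall fun x => hcut1 δ x)
    rw [hL, hR] at hweak
    rw [hsplit]
    linarith
  -- As `δ → 0`, the left side of `hid` converges to one slab limit per hyperplane. The right side
  -- converges by dominated convergence, the cutoff tending to `1` almost everywhere. Uniqueness of
  -- limits is the formula.
  have hlim1 : Tendsto (fun δ : ℝ => ∑ j ∈ H.data, (∫ x in T, f x * φ x *
        (∏ k ∈ H.data.erase j, cut (⟪k.1, x - k.2⟫ / δ)) *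
          (deriv cut (⟪j.1, x - j.2⟫ / δ) / δ)) * ⟪j.1, e⟫) (𝓝[>] 0)
      (𝓝 (∑ j ∈ H.data, (-∫ y in hyper j.1 j.2 ∩ frontier T,
        b y * φ y * ⟪outwardNormal T y, j.1⟫ ∂μHE[d - 1]) * ⟪j.1, e⟫)) :=
    tendsto_finsetSum _ fun j hj => ((hslab j hj).2).mul_const _
  have hlim2 : Tendsto (fun δ : ℝ => -∫ x in T, H.cutoff δ x *
      (f x * fderiv ℝ φ x e + g x * φ x)) (𝓝[>] 0)
      (𝓝 (-∫ x in T, (f x * fderiv ℝ φ x e + g x * φ x))) := by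
    refine Tendsto.neg ?_
    have hi : IntegrableOn (fun x => f x * fderiv ℝ φ x e + g x * φ x) T :=
      (hfint hφ'c).add hgφ
    refine tendsto_integral_filter_of_dominated_convergence
      (fun x => ‖f x * fderiv ℝ φ x e + g x * φ x‖) ?_ ?_ hi.norm ?_
    · exact Eventually.of_forall fun δ =>
        (H.contDiff_cutoff δ).continuous.aestronglyMeasurable.mul hi.aestronglyMeasurable
    · refine Eventually.of_forall fun δ => Eventually.of_forall fun x => ?_
      rw [norm_mul]
      exact mul_le_of_le_one_left (norm_nonneg _) (hcut1 δ x)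
    · filter_upwards [ae_restrict_of_ae H.ae_cutoff_tendsto] with x hx
      simpa using hx.mul_const (f x * fderiv ℝ φ x e + g x * φ x)
  have huniq := tendsto_nhds_unique (hlim1.congr hid) hlim2
  rw [hsum]
  simp only [neg_mul, Finset.sum_neg_distrib] at huniq
  linarith

section

open scoped Convolution

/-! ### Functions with bounded weak derivatives -/

theorem HasWeakPartial.mono {d : ℕ} {Ω C : Set (Space d)} {f g : Space d → ℝ} {i : Fin d}
    (h : HasWeakPartial Ω f i g) (hΩ : MeasurableSet Ω) (hC : C ⊆ Ω) :
    HasWeakPartial C f i g := by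
  intro φ h1 h2 h3
  have h4 := h φ h1 h2 (h3.trans hC)
  rw [setIntegral_eq_of_subset_of_forall_sdiff_eq_zero hΩ hC,
    setIntegral_eq_of_subset_of_forall_sdiff_eq_zero hΩ hC] at h4
  · exact h4
  · intro x hx
    rw [image_eq_zero_of_notMem_tsupport fun hxs => hx.2 (h3 hxs), mul_zero]
  · intro x hx
    rw [fderiv_of_notMem_tsupport ℝ fun hxs => hx.2 (h3 hxs)]
    simp

theorem MemW1Infty.mono {d : ℕ} {Ω C : Set (Space d)} {f : Space d → ℝ}
    (h : MemW1Infty Ω f) (hΩ : MeasurableSet Ω) (hC : C ⊆ Ω) : MemW1Infty C f := by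
  refine ⟨h.1.mono_measure (Measure.restrict_mono hC le_rfl), fun i => ?_⟩
  obtain ⟨g, hg1, hg2⟩ := h.2 i
  exact ⟨g, hg1.mono_measure (Measure.restrict_mono hC le_rfl), hg2.mono hΩ hC⟩

theorem ae_norm_le_of_memLp_top {X E : Type*} [MeasurableSpace X] {μ : Measure X}
    [NormedAddCommGroup E] {f : X → E} (hf : MemLp f ∞ μ) :
    ∀ᵐ x ∂μ, ‖f x‖ ≤ (eLpNorm f ∞ μ).toReal := by
  rw [eLpNorm_exponent_top]
  filter_upwards [ae_le_eLpNormEssSup (f := f) (μ := μ)] with x hx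
  have hlt : eLpNormEssSup f μ < ⊤ := by simpa [eLpNorm_exponent_top] using hf.2
  rw [← toReal_enorm]
  exact ENNReal.toReal_mono hlt.ne hx

/-- The derivative of a mollification is bounded by that of the function. -/
theorem abs_fderiv_mollify_le {d : ℕ} {C : Set (Space d)} (hC : MeasurableSet C)
    {f g : Space d → ℝ} {i : Fin d} {L : ℝ} (hf : LocallyIntegrable (C.indicator f))
    (hg : ∀ᵐ x ∂volume.restrict C, ‖g x‖ ≤ L) (hL : 0 ≤ L)
    (hw : HasWeakPartial C f i g) (ψ : ContDiffBump (0 : Space d)) {x : Space d}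
    (hx : closedBall x ψ.rOut ⊆ C) :
    |fderiv ℝ (ψ.normed volume ⋆[ContinuousLinearMap.lsmul ℝ ℝ, volume] C.indicator f) x
      (EuclideanSpace.single i 1)| ≤ L := by
  set e : Space d := EuclideanSpace.single i 1
  have hψc : HasCompactSupport (ψ.normed (volume : Measure (Space d))) :=
    ψ.hasCompactSupport_normed
  have hψd : ContDiff ℝ ∞ (ψ.normed (volume : Measure (Space d))) := ψ.contDiff_normed
  have hψ1 : ContDiff ℝ 1 (ψ.normed (volume : Measure (Space d))) := ψ.contDiff_normed
  have h1 := (hψc.hasFDerivAt_convolution_right (ContinuousLinearMap.lsmul ℝ ℝ).flip hf hψ1 x).fderiv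
  rw [← convolution_flip, h1, convolution_precompR_apply _ hf (hψc.fderiv ℝ)
    (hψ1.continuous_fderiv one_ne_zero), convolution_def]
  -- The derivative of the mollification at `x` is minus the pairing of `f` with the derivative of
  -- `χ`, that is, the pairing of `g` with `χ`. By `hx` the support of `χ` lies in `C`, and `χ` is
  -- nonnegative of mass one.
  let χ : Space d → ℝ := fun y => ψ.normed volume (x - y)
  have hχd : ContDiff ℝ ∞ χ := hψd.comp (contDiff_const.sub contDiff_id)
  have hχs : Function.support χ ⊆ closedBall x ψ.rOut := by
    intro y hy
    have : x - y ∈ Function.support (ψ.normed (volume : Measure (Space d))) := hy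
    rw [ψ.support_normed_eq, mem_ball_zero_iff] at this
    rw [mem_closedBall, dist_comm, dist_eq_norm]
    exact this.le
  have hχc : HasCompactSupport χ :=
    HasCompactSupport.of_support_subset_isCompact (isCompact_closedBall x ψ.rOut) hχs
  have hχt : tsupport χ ⊆ C := (closure_minimal hχs isClosed_closedBall).trans hx
  have hfd : ∀ y, fderiv ℝ χ y e = -(fderiv ℝ (ψ.normed volume) (x - y) e) := by
    intro y
    have h2 : HasFDerivAt χ ((fderiv ℝ (ψ.normed volume) (x - y)).comp
        (-ContinuousLinearMap.id ℝ (Space d))) y := by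
      have h3 : HasFDerivAt (fun y : Space d => x - y) (-ContinuousLinearMap.id ℝ (Space d)) y :=
        (hasFDerivAt_id y).const_sub x
      exact ((hψd.differentiable (by simp)) (x - y)).hasFDerivAt.comp y h3
    rw [h2.fderiv]
    simp
  have hweak := hw χ hχd hχc hχt
  have heq : ∫ t, ((ContinuousLinearMap.lsmul ℝ ℝ).flip (C.indicator f t))
      (fderiv ℝ (ψ.normed volume) (x - t) e) = ∫ y in C, g y * χ y := by
    have : ∫ x in C, f x * fderiv ℝ χ x e = -∫ t,
        ((ContinuousLinearMap.lsmul ℝ ℝ).flip (C.indicator f t))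
          (fderiv ℝ (ψ.normed volume) (x - t) e) := by
      rw [← integral_neg, ← integral_indicator hC]
      congr 1
      funext y
      by_cases hy : y ∈ C
      · simp [hy, hfd, mul_comm]
      · simp [hy]
    linarith
  rw [heq]
  have hInt : Integrable χ := hχd.continuous.integrable_of_hasCompactSupport hχc
  calc |∫ y in C, g y * χ y| ≤ ∫ y in C, L * χ y := by
        rw [← Real.norm_eq_abs]
        refine norm_integral_le_of_norm_le (hInt.const_mul L).integrableOn ?_
        filter_upwards [hg] with y hy
        rw [norm_mul, Real.norm_eq_abs (χ y), abs_of_nonneg (ψ.nonneg_normed _)]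
        exact mul_le_mul_of_nonneg_right hy (ψ.nonneg_normed _)
    _ ≤ ∫ y, L * χ y := setIntegral_le_integral (hInt.const_mul L)
        (Eventually.of_forall fun y => mul_nonneg hL (ψ.nonneg_normed _))
    _ = L := by
        rw [integral_const_mul]
        have : ∫ y, χ y = 1 := by
          simp only [χ]
          rw [integral_sub_left_eq_self (fun y => ψ.normed volume y) volume x]
          exact ψ.integral_normed
        rw [this, mul_one]

theorem norm_clm_le_sum {d : ℕ} (D : Space d →L[ℝ] ℝ) {L : Fin d → ℝ}
    (h : ∀ i, |D (EuclideanSpace.single i 1)| ≤ L i) : ‖D‖ ≤ ∑ i, L i := by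
  refine D.opNorm_le_bound (Finset.sum_nonneg fun i _ => (abs_nonneg _).trans (h i)) fun v => ?_
  have hv : v = ∑ i, v i • EuclideanSpace.single i (1 : ℝ) := by
    have := (EuclideanSpace.basisFun (Fin d) ℝ).sum_repr v
    simpa using this.symm
  conv_lhs => rw [hv]
  rw [map_sum, Finset.sum_mul]
  refine (norm_sum_le _ _).trans (Finset.sum_le_sum fun i _ => ?_)
  rw [map_smul, norm_smul, mul_comm]
  exact mul_le_mul (h i) (PiLp.norm_apply_le v i) (norm_nonneg _) ((abs_nonneg _).trans (h i))

/-- By convexity any two points of `C` are joined by a segment in `C`, along which all sufficiently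
fine mollifications have gradients bounded by the sum of the sup norms of the weak partials. In the
limit `f` is Lipschitz on the set of full measure where the mollifications converge, and Lipschitz
functions extend. -/
theorem MemW1Infty.exists_continuous_rep {d : ℕ} {C : Set (Space d)} (hCo : IsOpen C)
    (hCc : Convex ℝ C) {f : Space d → ℝ} (hf : MemW1Infty C f) :
    ∃ F : Space d → ℝ, Continuous F ∧ ∀ᵐ x ∂volume.restrict C, f x = F x := by
  choose g hg1 hg2 using hf.2
  have hCm := hCo.measurableSet
  have hloc : LocallyIntegrable (C.indicator f) :=
    ((memLp_indicator_iff_restrict hCm).2 hf.1).locallyIntegrable le_top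
  let L : Fin d → ℝ := fun i => (eLpNorm (g i) ∞ (volume.restrict C)).toReal
  have hL : 0 ≤ ∑ i, L i := Finset.sum_nonneg fun i _ => ENNReal.toReal_nonneg
  let ψ : ℕ → ContDiffBump (0 : Space d) := fun n =>
    ⟨1 / ((n : ℝ) + 1) / 2, 1 / ((n : ℝ) + 1), by positivity, half_lt_self (by positivity)⟩
  have hψ0 : Tendsto (fun n => (ψ n).rOut) atTop (𝓝 0) := tendsto_one_div_add_atTop_nhds_zero_nat
  -- The constant `2` bounds the ratio of the outer to the inner radius of the bumps `ψ n`.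
  have hconv := ContDiffBump.ae_convolution_tendsto_right_of_locallyIntegrable (μ := volume)
    (K := 2) hψ0 (Eventually.of_forall fun n => by
      change 1 / ((n : ℝ) + 1) ≤ 2 * (1 / ((n : ℝ) + 1) / 2); linarith) hloc
  let S : Set (Space d) := {x | x ∈ C ∧ Tendsto (fun n => ((ψ n).normed volume
    ⋆[ContinuousLinearMap.lsmul ℝ ℝ, volume] C.indicator f) x) atTop (𝓝 (C.indicator f x))}
  have hlip : LipschitzOnWith (Real.toNNReal (∑ i, L i)) f S := by
    refine LipschitzOnWith.of_dist_le_mul fun x hx y hy => ?_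
    rw [Real.coe_toNNReal _ hL, Real.dist_eq, dist_comm, dist_eq_norm, abs_sub_comm]
    have hseg : segment ℝ x y ⊆ C := hCc.segment_subset hx.1 hy.1
    have hcomp : IsCompact (segment ℝ x y) := by
      rw [segment_eq_image_lineMap]
      exact isCompact_Icc.image AffineMap.lineMap_continuous
    obtain ⟨δ, hδ, hthick⟩ := hcomp.exists_thickening_subset_open hCo hseg
    have h1 := (hy.2.sub hx.2).norm
    rw [indicator_of_mem hx.1, indicator_of_mem hy.1] at h1
    refine le_of_tendsto h1 ?_
    filter_upwards [hψ0.eventually_lt_const hδ] with n hn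
    refine Convex.norm_image_sub_le_of_norm_fderiv_le (𝕜 := ℝ) (s := segment ℝ x y) ?_ ?_
      (convex_segment x y) (left_mem_segment ℝ x y) (right_mem_segment ℝ x y)
    · intro z _
      exact ((ψ n).hasCompactSupport_normed.contDiff_convolution_left _
        ((ψ n).contDiff_normed (n := 1)) hloc).differentiable one_ne_zero z
    · intro z hz
      refine norm_clm_le_sum _ fun i => ?_
      refine abs_fderiv_mollify_le hCm hloc (ae_norm_le_of_memLp_top (hg1 i))
        ENNReal.toReal_nonneg (hg2 i) (ψ n) ?_
      intro w hw
      refine hthick (mem_thickening_iff.2 ⟨z, hz, ?_⟩)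
      exact (mem_closedBall.1 hw).trans_lt hn
  obtain ⟨F, hF1, hF2⟩ := hlip.extend_real
  refine ⟨F, hF1.continuous, ?_⟩
  rw [ae_restrict_iff' hCm]
  filter_upwards [hconv] with x hx hxC
  exact hF2 ⟨hxC, hx⟩

theorem exists_continuous_rep_vector {d : ℕ} {C : Set (Space d)} (hCo : IsOpen C)
    (hCc : Convex ℝ C) {β : Space d → Space d} (hβ : ∀ j, MemW1Infty C (fun x => β x j)) :
    ∃ F : Space d → Space d, Continuous F ∧ ∀ᵐ x ∂volume.restrict C, β x = F x := by
  choose F hF1 hF2 using fun j => (hβ j).exists_continuous_rep hCo hCc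
  refine ⟨fun x => WithLp.toLp 2 fun j => F j x, ?_, ?_⟩
  · exact (PiLp.continuous_toLp 2 _).comp (continuous_pi hF1)
  · filter_upwards [ae_all_iff.2 hF2] with x hx
    ext j
    exact hx j

end

/-! ### Traces -/

theorem volume_ball_inter_pos {d : ℕ} {T : Set (Space d)} (hT : IsOpen T) {x : Space d}
    (hx : x ∈ closure T) {ρ : ℝ} (hρ : 0 < ρ) : 0 < volume (ball x ρ ∩ T) :=
  (isOpen_ball.inter hT).measure_pos _
    (mem_closure_iff.1 hx _ isOpen_ball (mem_ball_self hρ))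

theorem volume_ball_inter_lt_top {d : ℕ} (T : Set (Space d)) (x : Space d) (ρ : ℝ) :
    volume (ball x ρ ∩ T) < ⊤ :=
  (measure_mono inter_subset_left).trans_lt measure_ball_lt_top

theorem norm_setAverage_le {X E : Type*} [MeasurableSpace X] {μ : Measure X}
    [NormedAddCommGroup E] [NormedSpace ℝ E] {f : X → E} {s : Set X} (hs : μ s < ⊤) {M : ℝ}
    (hM : 0 ≤ M) (h : ∀ᵐ x ∂μ.restrict s, ‖f x‖ ≤ M) : ‖⨍ x in s, f x ∂μ‖ ≤ M := by
  rw [setAverage_eq, norm_smul, norm_inv, Real.norm_eq_abs, abs_of_nonneg measureReal_nonneg]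
  have h1 := norm_setIntegral_le_of_norm_le_const_ae hs h
  rcases (measureReal_nonneg (μ := μ) (s := s)).eq_or_lt with h0 | h0
  · rw [← h0]; simpa using hM
  · rw [inv_mul_le_iff₀ h0, mul_comm]
    exact h1

theorem setAverage_congr_ae {X E : Type*} [MeasurableSpace X] {μ : Measure X}
    [NormedAddCommGroup E] [NormedSpace ℝ E] {f g : X → E} {s : Set X}
    (h : f =ᵐ[μ.restrict s] g) : ⨍ x in s, f x ∂μ = ⨍ x in s, g x ∂μ := by
  rw [setAverage_eq, setAverage_eq, integral_congr_ae h]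

theorem tendsto_average_of_ae_eq {d : ℕ} {E : Type*} [NormedAddCommGroup E] [NormedSpace ℝ E]
    [CompleteSpace E] {T : Set (Space d)} (hT : IsOpen T) {x : Space d} (hx : x ∈ closure T)
    {f F : Space d → E} (hF : Continuous F) {r : ℝ} (hr : 0 < r)
    (h : ∀ᵐ y ∂volume.restrict (ball x r ∩ T), f y = F y) :
    Tendsto (fun ρ : ℝ => ⨍ y in ball x ρ ∩ T, f y) (𝓝[>] 0) (𝓝 (F x)) := by
  rw [Metric.tendsto_nhds]
  intro ε hε
  obtain ⟨δ, hδ, hball⟩ := Metric.continuousAt_iff.1 (hF.continuousAt (x := x)) (ε / 2)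
    (half_pos hε)
  filter_upwards [Ioo_mem_nhdsGT (lt_min hr hδ)] with ρ hρ
  have h1 : ∀ᵐ y ∂volume.restrict (ball x ρ ∩ T), f y = F y :=
    ae_mono (Measure.restrict_mono (inter_subset_inter_left _
      (ball_subset_ball (hρ.2.le.trans (min_le_left _ _)))) le_rfl) h
  rw [setAverage_congr_ae h1]
  have h2 : (⨍ y in ball x ρ ∩ T, F y) ∈ closedBall (F x) (ε / 2) := by
    refine (convex_closedBall (F x) (ε / 2)).set_average_mem isClosed_closedBall
      (volume_ball_inter_pos hT hx hρ.1).ne' (volume_ball_inter_lt_top T x ρ).ne ?_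
      (integrableOn_of_continuous (isBounded_ball.subset inter_subset_left) hF)
    refine ae_restrict_of_forall_mem (isOpen_ball.inter hT).measurableSet fun y hy => ?_
    exact (hball ((mem_ball.1 hy.1).trans (hρ.2.trans_le (min_le_right _ _)))).le
  exact (mem_closedBall.1 h2).trans_lt (half_lt_self hε)

theorem trace_eq_of_tendsto {d : ℕ} {E : Type*} [NormedAddCommGroup E] [NormedSpace ℝ E]
    {T : Set (Space d)} {x : Space d} {f : Space d → E} {a : E}
    (h : Tendsto (fun ρ : ℝ => ⨍ y in ball x ρ ∩ T, f y) (𝓝[>] 0) (𝓝 a)) : trace T f x = a :=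
  h.limUnder_eq

theorem trace_eq_of_ae_eq {d : ℕ} {E : Type*} [NormedAddCommGroup E] [NormedSpace ℝ E]
    [CompleteSpace E] {T : Set (Space d)} (hT : IsOpen T) {x : Space d} (hx : x ∈ closure T)
    {f F : Space d → E} (hF : Continuous F) {r : ℝ} (hr : 0 < r)
    (h : ∀ᵐ y ∂volume.restrict (ball x r ∩ T), f y = F y) : trace T f x = F x :=
  trace_eq_of_tendsto (tendsto_average_of_ae_eq hT hx hF hr h)

theorem trace_eq_of_eqOn {d : ℕ} {E : Type*} [NormedAddCommGroup E] [NormedSpace ℝ E]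
    [CompleteSpace E] {T : Set (Space d)} (hT : IsOpen T) {x : Space d} (hx : x ∈ closure T)
    {f F : Space d → E} (hF : Continuous F) (h : ∀ y ∈ T, f y = F y) : trace T f x = F x :=
  trace_eq_of_ae_eq hT hx hF one_pos (ae_restrict_of_forall_mem
    (isOpen_ball.inter hT).measurableSet fun y hy => h y hy.2)

/-- On small balls `‖G‖ ≤ M`, so replacing `K y` by its trace value `a` changes the mean by at most
`M` times the mean of `‖K y - a‖`. What remains is the mean of a continuous function. -/
theorem tendsto_average_clm {d : ℕ} {T : Set (Space d)} (hT : IsOpen T) {x : Space d}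
    (hx : x ∈ closure T) {K : Space d → Space d →L[ℝ] Space d}
    (hK : MemLp K ∞ (volume.restrict T)) {a : Space d →L[ℝ] Space d} (ha : HasTraceAt T K x a)
    {G : Space d → Space d} (hG : Continuous G) :
    Tendsto (fun ρ : ℝ => ⨍ y in ball x ρ ∩ T, K y (G y)) (𝓝[>] 0) (𝓝 (a (G x))) := by
  obtain ⟨M, hM⟩ := (isCompact_closedBall x 1).exists_bound_of_continuousOn hG.continuousOn
  have hM0 : 0 ≤ M := (norm_nonneg _).trans (hM x (mem_closedBall_self zero_le_one))
  have h1 := tendsto_average_of_ae_eq (f := fun y => a (G y)) hT hx (a.continuous.comp hG) one_pos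
    (Eventually.of_forall fun _ => rfl)
  have h2 : Tendsto (fun ρ : ℝ => M * ⨍ y in ball x ρ ∩ T, ‖K y - a‖) (𝓝[>] 0) (𝓝 0) := by
    have := Tendsto.const_mul M ha
    rwa [mul_zero] at this
  have h3 : Tendsto (fun ρ : ℝ => (⨍ y in ball x ρ ∩ T, K y (G y)) -
      ⨍ y in ball x ρ ∩ T, a (G y)) (𝓝[>] 0) (𝓝 0) := by
    refine squeeze_zero_norm' ?_ h2
    filter_upwards [Ioo_mem_nhdsGT one_pos] with ρ hρ
    have hfin : IsFiniteMeasure (volume.restrict (ball x ρ ∩ T)) :=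
      ⟨by rw [Measure.restrict_apply_univ]; exact volume_ball_inter_lt_top T x ρ⟩
    have hKL : MemLp K ∞ (volume.restrict (ball x ρ ∩ T)) :=
      hK.mono_measure (Measure.restrict_mono inter_subset_right le_rfl)
    have hKi : Integrable K (volume.restrict (ball x ρ ∩ T)) := hKL.integrable le_top
    have hGb : ∀ᵐ y ∂volume.restrict (ball x ρ ∩ T), ‖G y‖ ≤ M :=
      ae_restrict_of_forall_mem (isOpen_ball.inter hT).measurableSet fun y hy =>
        hM y ((ball_subset_ball hρ.2.le).trans ball_subset_closedBall hy.1)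
    have hi1 : Integrable (fun y => K y (G y)) (volume.restrict (ball x ρ ∩ T)) := by
      refine (hKi.norm.mul_const M).mono' ?_ ?_
      · exact isBoundedBilinearMap_apply.continuous.comp_aestronglyMeasurable
          (hKi.aestronglyMeasurable.prodMk hG.aestronglyMeasurable)
      · filter_upwards [hGb] with y hy
        exact ((K y).le_opNorm _).trans (mul_le_mul_of_nonneg_left hy (norm_nonneg _))
    have hi2 : Integrable (fun y => a (G y)) (volume.restrict (ball x ρ ∩ T)) :=
      integrableOn_of_continuous (isBounded_ball.subset inter_subset_left) (a.continuous.comp hG)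
    have hi3 : Integrable (fun y => K y - a) (volume.restrict (ball x ρ ∩ T)) :=
      hKi.sub (integrable_const a)
    rw [setAverage_eq, setAverage_eq, setAverage_eq, ← smul_sub, ← integral_sub hi1 hi2,
      norm_smul, norm_inv, Real.norm_eq_abs, abs_of_nonneg measureReal_nonneg, smul_eq_mul,
      mul_left_comm]
    refine mul_le_mul_of_nonneg_left ?_ (inv_nonneg.2 measureReal_nonneg)
    rw [← integral_const_mul]
    refine norm_integral_le_of_norm_le (hi3.norm.const_mul M) ?_
    filter_upwards [hGb] with y hy
    rw [← sub_apply, mul_comm]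
    exact ((K y - a).le_opNorm _).trans (mul_le_mul_of_nonneg_left hy (norm_nonneg _))
  have h4 := h3.add h1
  simpa using h4

/-- The trace of `K ∇v` is bounded by `‖K‖_∞ |∇v|`. -/
theorem norm_trace_clm_le {d : ℕ} {T : Set (Space d)} (hT : IsOpen T) {x : Space d}
    (hx : x ∈ closure T) {K : Space d → Space d →L[ℝ] Space d}
    (hK : MemLp K ∞ (volume.restrict T)) {k : ℝ} (hk : 0 ≤ k)
    (hKk : ∀ᵐ y ∂volume.restrict T, ‖K y‖ ≤ k) (ha : ∃ a, HasTraceAt T K x a)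
    {w G : Space d → Space d} (hG : Continuous G) (hw : ∀ y ∈ T, w y = G y) :
    ‖trace T (fun y => K y (w y)) x‖ ≤ k * ‖G x‖ := by
  obtain ⟨a, ha⟩ := ha
  have h1 := tendsto_average_clm hT hx hK ha hG
  have h2 : trace T (fun y => K y (w y)) x = a (G x) := by
    refine trace_eq_of_tendsto (h1.congr fun ρ => ?_)
    refine setAverage_congr_ae (ae_restrict_of_forall_mem (isOpen_ball.inter hT).measurableSet
      fun y hy => ?_)
    simp only [hw y hy.2]
  rw [h2]
  -- With the vector `G x` frozen, `a (G x)` is a limit of means of `K y (G x)`, each of norm at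
  -- most `k * ‖G x‖`. This passes the essential bound on `K` to its trace.
  have h3 := tendsto_average_clm hT hx hK ha (continuous_const (y := G x))
  refine le_of_tendsto h3.norm (Eventually.of_forall fun ρ => ?_)
  refine norm_setAverage_le (volume_ball_inter_lt_top T x ρ) (by positivity) ?_
  filter_upwards [ae_mono (Measure.restrict_mono inter_subset_right le_rfl) hKk] with y hy
  exact ((K y).le_opNorm _).trans (mul_le_mul_of_nonneg_right hy (norm_nonneg _))

/-! ### The continuous representative of a vector field -/

theorem convex_inner_sub_lt {d : ℕ} (x n : Space d) : Convex ℝ {y | ⟪y - x, n⟫ < 0} := by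
  have h : {y : Space d | ⟪y - x, n⟫ < 0} = {y | ⟪n, y⟫ < ⟪n, x⟫} := by
    ext y
    simp only [mem_ofPred_eq]
    rw [real_inner_comm, inner_sub_right, sub_neg]
  rw [h]
  exact convex_halfSpace_lt (innerSL ℝ n).isLinear _

/-- Where a normal exists, `Ω` is locally a half-ball. This supplies the convexity needed for a
continuous representative at almost every boundary point. -/
theorem IsOutwardNormal.exists_convex {d : ℕ} {Ω : Set (Space d)} {x n : Space d}
    (h : IsOutwardNormal Ω x n) : ∃ r > 0, Convex ℝ (ball x r ∩ Ω) := by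
  obtain ⟨r, hr, hball⟩ := Metric.eventually_nhds_iff_ball.1 h.2
  refine ⟨r, hr, ?_⟩
  have : ball x r ∩ Ω = ball x r ∩ {y | ⟪y - x, n⟫ < 0} := by
    ext y
    exact and_congr_right fun hy => hball y hy
  rw [this]
  exact (convex_ball x r).inter (convex_inner_sub_lt x n)

theorem exists_convex_of_mem {d : ℕ} {Ω : Set (Space d)} (hΩ : IsOpen Ω) {x : Space d}
    (hx : x ∈ Ω) : ∃ r > 0, Convex ℝ (ball x r ∩ Ω) := by
  obtain ⟨r, hr, hball⟩ := Metric.isOpen_iff.1 hΩ x hx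
  refine ⟨r, hr, ?_⟩
  rw [inter_eq_left.2 hball]
  exact convex_ball x r

theorem exists_local_rep {d : ℕ} {Ω : Set (Space d)} (hΩ : IsOpen Ω) {β : Space d → Space d}
    (hβ : ∀ j, MemW1Infty Ω (fun x => β x j)) {x : Space d}
    (hx : ∃ r > 0, Convex ℝ (ball x r ∩ Ω)) :
    ∃ r > 0, ∃ F : Space d → Space d, Continuous F ∧
      (∀ᵐ y ∂volume.restrict (ball x r ∩ Ω), β y = F y) ∧
      (∀ y ∈ ball x r ∩ closure Ω, trace Ω β y = F y) := by
  obtain ⟨r, hr, hconv⟩ := hx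
  have ho : IsOpen (ball x r ∩ Ω) := isOpen_ball.inter hΩ
  obtain ⟨F, hFc, hF⟩ := exists_continuous_rep_vector ho hconv
    fun j => (hβ j).mono hΩ.measurableSet inter_subset_right
  refine ⟨r, hr, F, hFc, hF, fun y hy => ?_⟩
  obtain ⟨s, hs, hsub⟩ := Metric.isOpen_iff.1 isOpen_ball y hy.1
  exact trace_eq_of_ae_eq hΩ hy.2 hFc hs
    (ae_mono (Measure.restrict_mono (inter_subset_inter_left _ hsub) le_rfl) hF)

/-- The trace is continuous at the points near which `Ω` is convex. -/
theorem tendsto_trace {d : ℕ} {Ω : Set (Space d)} (hΩ : IsOpen Ω) {β : Space d → Space d}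
    (hβ : ∀ j, MemW1Infty Ω (fun x => β x j)) {x : Space d} (hxc : x ∈ closure Ω)
    (hx : ∃ r > 0, Convex ℝ (ball x r ∩ Ω)) :
    Tendsto (trace Ω β) (𝓝[Ω] x) (𝓝 (trace Ω β x)) := by
  obtain ⟨r, hr, F, hFc, hF, htr⟩ := exists_local_rep hΩ hβ hx
  rw [htr x ⟨mem_ball_self hr, hxc⟩]
  refine (hFc.continuousAt.mono_left nhdsWithin_le_nhds).congr' ?_
  filter_upwards [self_mem_nhdsWithin, nhdsWithin_le_nhds (ball_mem_nhds x hr)] with y hy1 hy2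
  exact (htr y ⟨hy2, subset_closure hy1⟩).symm

theorem continuousOn_trace {d : ℕ} {Ω : Set (Space d)} (hΩ : IsOpen Ω) {β : Space d → Space d}
    (hβ : ∀ j, MemW1Infty Ω (fun x => β x j)) : ContinuousOn (trace Ω β) Ω := fun _ hx =>
  tendsto_trace hΩ hβ (subset_closure hx) (exists_convex_of_mem hΩ hx)

theorem ae_trace_eq {d : ℕ} {Ω : Set (Space d)} (hΩ : IsOpen Ω) {β : Space d → Space d}
    (hβ : ∀ j, MemW1Infty Ω (fun x => β x j)) :
    ∀ᵐ x ∂volume.restrict Ω, trace Ω β x = β x := by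
  rw [ae_restrict_iff' hΩ.measurableSet, ae_iff]
  refine measure_null_of_locally_null _ fun x hx => ?_
  have hxΩ : x ∈ Ω := by
    by_contra hcon
    exact hx fun h => absurd h hcon
  obtain ⟨r, hr, F, hFc, hF, htr⟩ := exists_local_rep hΩ hβ (exists_convex_of_mem hΩ hxΩ)
  rw [ae_restrict_iff' (isOpen_ball.inter hΩ).measurableSet, ae_iff] at hF
  refine ⟨_, ?_, hF⟩
  filter_upwards [nhdsWithin_le_nhds (ball_mem_nhds x hr), self_mem_nhdsWithin] with y hy1 hy2
  simp only [Classical.not_imp] at hy2 ⊢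
  refine ⟨⟨hy1, hy2.1⟩, fun h => hy2.2 ?_⟩
  rw [h, htr y ⟨hy1, subset_closure hy2.1⟩]

/-- The trace is continuous in `Ω`, so exceeding the essential bound at one point would mean
exceeding it on a set of positive measure. -/
theorem exists_trace_bound {d : ℕ} {Ω : Set (Space d)} (hΩ : IsOpen Ω) {β : Space d → Space d}
    (hβ : ∀ j, MemW1Infty Ω (fun x => β x j)) : ∃ C, ∀ x ∈ Ω, ∀ j, |trace Ω β x j| ≤ C := by
  let L : Fin d → ℝ := fun j => (eLpNorm (fun x => β x j) ∞ (volume.restrict Ω)).toReal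
  have hL : ∀ j, 0 ≤ L j := fun j => ENNReal.toReal_nonneg
  refine ⟨∑ j, L j, fun x hx j => ?_⟩
  have hb : ∀ᵐ y ∂volume.restrict Ω, |trace Ω β y j| ≤ ∑ j, L j := by
    filter_upwards [ae_trace_eq hΩ hβ, ae_norm_le_of_memLp_top (hβ j).1] with y hy1 hy2
    rw [hy1]
    exact hy2.trans (Finset.single_le_sum (fun i _ => hL i) (Finset.mem_univ j))
  by_contra hcon
  have hcont : ContinuousAt (fun y => |trace Ω β y j|) x := by
    have h1 := (continuousOn_trace hΩ hβ).continuousAt (hΩ.mem_nhds hx)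
    have h2 : Continuous fun z : Space d => |z j| := by fun_prop
    exact h2.continuousAt.comp h1
  have hev : ∀ᶠ y in 𝓝 x, ∑ j, L j < |trace Ω β y j| ∧ y ∈ Ω :=
    (hcont.eventually_const_lt (not_le.1 hcon)).and (hΩ.eventually_mem hx)
  rw [ae_restrict_iff' hΩ.measurableSet, ae_iff] at hb
  refine (Measure.measure_pos_of_mem_nhds volume hev).ne' (measure_mono_null ?_ hb)
  intro y hy
  simp only [mem_ofPred_eq, Classical.not_imp, not_le] at hy ⊢
  exact ⟨hy.2, hy.1⟩

/-- At a point near which `Ω` is convex, the trace from a subdomain is the trace from `Ω`. -/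
theorem trace_smul_eq {d : ℕ} {Ω T : Set (Space d)} (hΩ : IsOpen Ω) {β : Space d → Space d}
    (hβ : ∀ j, MemW1Infty Ω (fun x => β x j)) (hT : IsOpen T) (hTΩ : T ⊆ Ω) {x : Space d}
    (hxc : x ∈ closure T) (hx : ∃ r > 0, Convex ℝ (ball x r ∩ Ω)) {v q : Space d → ℝ}
    (hq : Continuous q) (hv : ∀ y ∈ T, v y = q y) :
    trace T (fun y => v y • β y) x = q x • trace Ω β x := by
  obtain ⟨r, hr, F, hFc, hF, htr⟩ := exists_local_rep hΩ hβ hx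
  rw [htr x ⟨mem_ball_self hr, closure_mono hTΩ hxc⟩]
  refine trace_eq_of_ae_eq (F := fun y => q y • F y) hT hxc (hq.smul hFc) hr ?_
  have h1 := ae_mono (Measure.restrict_mono (inter_subset_inter_right (ball x r) hTΩ) le_rfl) hF
  filter_upwards [h1, ae_restrict_mem (isOpen_ball.inter hT).measurableSet] with y hy1 hy2
  rw [hy1, hv y hy2.2]

/-! ### Polynomial functions -/

/-- The function on `ℝ^d` given by a polynomial. -/
def pol {d : ℕ} (q : MvPolynomial (Fin d) ℝ) (x : Space d) : ℝ :=
  MvPolynomial.eval (fun i => x i) q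

theorem hasFDerivAt_pol {d : ℕ} (q : MvPolynomial (Fin d) ℝ) (x : Space d) :
    HasFDerivAt (pol q) (∑ i, pol (MvPolynomial.pderiv i q) x • EuclideanSpace.proj (𝕜 := ℝ) i)
      x := by
  induction q using MvPolynomial.induction_on with
  | C a =>
    have : pol (MvPolynomial.C a : MvPolynomial (Fin d) ℝ) = fun _ => a := by
      funext y; simp [pol]
    rw [this]
    refine (hasFDerivAt_const a x).congr_fderiv ?_
    simp [pol]
  | add p q hp hq =>
    have : pol (p + q) = fun y => pol p y + pol q y := by funext y; simp [pol]
    rw [this]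
    refine (hp.add hq).congr_fderiv ?_
    rw [← Finset.sum_add_distrib]
    refine Finset.sum_congr rfl fun i _ => ?_
    rw [← add_smul]
    simp [pol]
  | mul_X p j hp =>
    have : pol (p * MvPolynomial.X j) = fun y => pol p y * y j := by funext y; simp [pol]
    rw [this]
    have h1 : HasFDerivAt (fun y : Space d => y j) (EuclideanSpace.proj (𝕜 := ℝ) j) x :=
      (EuclideanSpace.proj (𝕜 := ℝ) j).hasFDerivAt
    refine (hp.mul h1).congr_fderiv ?_
    have h2 : ∀ i, pol (MvPolynomial.pderiv i (p * MvPolynomial.X j)) x =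
        x j * pol (MvPolynomial.pderiv i p) x + if i = j then pol p x else 0 := by
      intro i
      by_cases hij : i = j
      · subst hij
        simp only [pol, MvPolynomial.pderiv_mul, MvPolynomial.pderiv_X_self, map_add, map_mul,
          MvPolynomial.eval_X, map_one, if_true]
        ring
      · simp only [pol, MvPolynomial.pderiv_mul, MvPolynomial.pderiv_X_of_ne (Ne.symm hij),
          map_add, map_mul, MvPolynomial.eval_X, map_zero, if_neg hij]
        ring
    simp only [h2, add_smul, Finset.sum_add_distrib, ite_smul, zero_smul, Finset.sum_ite_eq',
      Finset.mem_univ, if_true, Finset.smul_sum, smul_smul]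
    rw [add_comm]

theorem contDiff_pol {d : ℕ} (q : MvPolynomial (Fin d) ℝ) : ContDiff ℝ ∞ (pol q) := by
  induction q using MvPolynomial.induction_on with
  | C a =>
    have : pol (MvPolynomial.C a : MvPolynomial (Fin d) ℝ) = fun _ => a := by
      funext y; simp [pol]
    rw [this]
    exact contDiff_const
  | add p q hp hq =>
    have : pol (p + q) = fun y => pol p y + pol q y := by funext y; simp [pol]
    rw [this]
    exact hp.add hq
  | mul_X p j hp =>
    have : pol (p * MvPolynomial.X j) = fun y => pol p y * y j := by funext y; simp [pol]
    rw [this]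
    exact hp.mul (EuclideanSpace.proj (𝕜 := ℝ) j).contDiff

theorem continuous_pol {d : ℕ} (q : MvPolynomial (Fin d) ℝ) : Continuous (pol q) :=
  (contDiff_pol q).continuous

theorem fderiv_single_eq_gradient {d : ℕ} (φ : Space d → ℝ) (x : Space d) (i : Fin d) :
    fderiv ℝ φ x (EuclideanSpace.single i 1) = gradient φ x i := by
  rw [← inner_gradient_left, EuclideanSpace.inner_single_right]
  simp

theorem gradient_pol_apply {d : ℕ} (q : MvPolynomial (Fin d) ℝ) (x : Space d) (i : Fin d) :
    gradient (pol q) x i = pol (MvPolynomial.pderiv i q) x := by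
  rw [← fderiv_single_eq_gradient, (hasFDerivAt_pol q x).fderiv]
  simp [sum_apply]

theorem continuous_gradient_pol {d : ℕ} (q : MvPolynomial (Fin d) ℝ) :
    Continuous (gradient (pol q)) := by
  have : gradient (pol q) = fun x => WithLp.toLp 2 fun i => pol (MvPolynomial.pderiv i q) x := by
    funext x
    ext i
    exact gradient_pol_apply q x i
  rw [this]
  exact (PiLp.continuous_toLp 2 _).comp (continuous_pi fun i => continuous_pol _)

theorem norm_sq_gradient_pol {d : ℕ} (q : MvPolynomial (Fin d) ℝ) (x : Space d) :
    ‖gradient (pol q) x‖ ^ 2 = ∑ i, pol (MvPolynomial.pderiv i q) x ^ 2 := by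
  rw [EuclideanSpace.norm_sq_eq]
  refine Finset.sum_congr rfl fun i _ => ?_
  rw [gradient_pol_apply, Real.norm_eq_abs, sq_abs]

theorem totalDegree_pderiv_le {σ : Type*} (q : MvPolynomial σ ℝ) (i : σ) :
    (MvPolynomial.pderiv i q).totalDegree ≤ q.totalDegree := by
  classical
  refine Finset.sup_le fun m hm => ?_
  rw [MvPolynomial.mem_support_iff, MvPolynomial.coeff_pderiv] at hm
  have hm' : m + Finsupp.single i 1 ∈ q.support := by
    rw [MvPolynomial.mem_support_iff]
    exact fun h => hm (by rw [h]; simp)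
  refine le_trans ?_ (MvPolynomial.le_totalDegree hm')
  rw [Finsupp.sum_add_index' (fun _ => rfl) (fun _ _ _ => rfl)]
  exact Nat.le_add_right _ _

/-- Substituting polynomials of degree at most one does not raise the degree. This allows elements
to be rescaled to unit size. -/
theorem exists_pol_comp_affine {d p : ℕ} (q : MvPolynomial (Fin d) ℝ) (hq : q.totalDegree ≤ p)
    (x₀ : Space d) (h : ℝ) : ∃ q' : MvPolynomial (Fin d) ℝ, q'.totalDegree ≤ p ∧
      ∀ z : Space d, pol q' z = pol q (x₀ + h • z) := by
  let A : Fin d → MvPolynomial (Fin d) ℝ := fun i =>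
    MvPolynomial.C (x₀ i) + MvPolynomial.C h * MvPolynomial.X i
  have hA : ∀ i, (A i).totalDegree ≤ 1 := by
    intro i
    refine (MvPolynomial.totalDegree_add _ _).trans (max_le ?_ ?_)
    · rw [MvPolynomial.totalDegree_C]; exact zero_le_one
    · refine (MvPolynomial.totalDegree_mul _ _).trans ?_
      rw [MvPolynomial.totalDegree_C, MvPolynomial.totalDegree_X]
  refine ⟨MvPolynomial.aeval A q, ?_, fun z => ?_⟩
  · rw [MvPolynomial.aeval_def, MvPolynomial.eval₂_eq']
    refine (MvPolynomial.totalDegree_finsetSum _ _).trans (Finset.sup_le fun m hm => ?_)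
    refine (MvPolynomial.totalDegree_mul _ _).trans ?_
    rw [MvPolynomial.algebraMap_eq, MvPolynomial.totalDegree_C, zero_add]
    refine (MvPolynomial.totalDegree_finsetProd _ _).trans ?_
    calc ∑ i, (A i ^ m i).totalDegree ≤ ∑ i, m i := by
          refine Finset.sum_le_sum fun i _ => (MvPolynomial.totalDegree_pow _ _).trans ?_
          calc m i * (A i).totalDegree ≤ m i * 1 := Nat.mul_le_mul_left _ (hA i)
            _ = m i := mul_one _
      _ = m.sum fun _ e => e := (Finsupp.sum_fintype m (fun _ e => e) fun _ => rfl).symm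
      _ ≤ q.totalDegree := MvPolynomial.le_totalDegree hm
      _ ≤ p := hq
  · simp only [pol]
    rw [MvPolynomial.aeval_def, MvPolynomial.eval_eval₂]
    simp only [MvPolynomial.algebraMap_eq, A, map_add, map_mul, MvPolynomial.eval_C,
      MvPolynomial.eval_X]
    have : (MvPolynomial.eval fun i => z i).comp (MvPolynomial.C (R := ℝ) (σ := Fin d))
        = RingHom.id ℝ := by ext; simp
    rw [this]
    rfl

/-- On the polynomials of bounded degree, the sup norm over the unit ball is bounded by the `L²` norm
over a smaller ball. -/
theorem exists_sup_le_integral (d p : ℕ) {r : ℝ} (hr : 0 < r) :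
    ∃ C : ℝ, 0 < C ∧ ∀ q : MvPolynomial (Fin d) ℝ, q.totalDegree ≤ p →
      ∀ z ∈ closedBall (0 : Space d) 1, pol q z ^ 2 ≤ C * ∫ x in ball (0 : Space d) r, pol q x ^ 2 := by
  let μ : Measure (Space d) := volume.restrict (ball 0 r)
  have hμ : IsFiniteMeasure μ := ⟨by
    rw [Measure.restrict_apply_univ]; exact measure_ball_lt_top⟩
  let V := MvPolynomial.restrictTotalDegree (Fin d) ℝ p
  have hmem : ∀ q : MvPolynomial (Fin d) ℝ, MemLp (pol q) 2 μ := by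
    intro q
    obtain ⟨M, hM⟩ := exists_bound_of_continuous (isBounded_ball (x := (0 : Space d)) (r := r))
      (continuous_pol q)
    exact MemLp.of_bound (continuous_pol q).aestronglyMeasurable M
      (ae_restrict_of_forall_mem isOpen_ball.measurableSet hM)
  let Λ : V →ₗ[ℝ] Lp ℝ 2 μ :=
    { toFun := fun q => (hmem q.1).toLp _
      map_add' := by
        intro q q'
        rw [← MemLp.toLp_add]
        congr 1
        funext x; simp [pol]
      map_smul' := by
        intro c q
        rw [RingHom.id_apply, ← MemLp.toLp_const_smul]
        congr 1
        funext x; simp [pol] }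
  let E : V →ₗ[ℝ] C(closedBall (0 : Space d) 1, ℝ) :=
    { toFun := fun q => ⟨fun z => pol q.1 z, (continuous_pol q.1).comp continuous_subtype_val⟩
      map_add' := by intro q q'; ext z; simp [pol]
      map_smul' := by intro c q; ext z; simp [pol] }
  -- A polynomial that is zero almost everywhere on the ball is zero on a small box, a product of
  -- infinite sets, hence is the zero polynomial.
  have hinj : Function.Injective Λ := by
    rw [← LinearMap.ker_eq_bot, LinearMap.ker_eq_bot']
    intro q hq
    have h0 : pol q.1 =ᵐ[μ] 0 := by
      have h1 : (hmem q.1).toLp _ = (MemLp.zero : MemLp (0 : Space d → ℝ) 2 μ).toLp _ := by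
        rw [MemLp.toLp_zero]; exact hq
      exact (MemLp.toLp_eq_toLp_iff _ _).1 h1
    have h2 : ∀ x ∈ ball (0 : Space d) r, pol q.1 x = 0 :=
      Measure.eqOn_open_of_ae_eq h0 isOpen_ball (continuous_pol q.1).continuousOn
        continuousOn_const
    apply Subtype.ext
    obtain ⟨s, hs, hsub⟩ : ∃ s > 0, ∀ x : Fin d → ℝ, (∀ i, x i ∈ Ioo (-s) s) →
        WithLp.toLp 2 x ∈ ball (0 : Space d) r := by
      have ho : IsOpen ((fun x : Fin d → ℝ => (WithLp.toLp 2 x : Space d)) ⁻¹' ball 0 r) :=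
        isOpen_ball.preimage (PiLp.continuous_toLp 2 _)
      obtain ⟨s, hs, hb⟩ := Metric.isOpen_iff.1 ho 0 (by simpa using hr)
      refine ⟨s, hs, fun x hx => hb ?_⟩
      rw [mem_ball_zero_iff, pi_norm_lt_iff hs]
      exact fun i => abs_lt.2 (hx i)
    refine MvPolynomial.funext_set (fun _ : Fin d => Ioo (-s) s)
      (fun _ => Ioo_infinite (by linarith)) fun x hx => ?_
    have := h2 _ (hsub x fun i => hx i (mem_univ i))
    simpa [pol] using this
  let e := LinearEquiv.ofInjective Λ hinj
  have hfd : FiniteDimensional ℝ (LinearMap.range Λ) := inferInstance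
  -- Evaluation, read as a linear map on the finite-dimensional space of `L²` classes, is
  -- automatically continuous. Its squared norm is the constant, increased by `1` below to be
  -- positive.
  let B : LinearMap.range Λ →L[ℝ] C(closedBall (0 : Space d) 1, ℝ) :=
    LinearMap.toContinuousLinearMap (E ∘ₗ e.symm.toLinearMap)
  refine ⟨‖B‖ ^ 2 + 1, by positivity, fun q hq z hz => ?_⟩
  let qV : V := ⟨q, (MvPolynomial.mem_restrictTotalDegree _ _ _).2 hq⟩
  have h1 : B (e qV) = E qV := by simp [B]
  have h2 : |pol q z| ≤ ‖B‖ * ‖Λ qV‖ := by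
    have h3 : ‖(E qV) ⟨z, hz⟩‖ ≤ ‖E qV‖ := (E qV).norm_coe_le_norm _
    have h4 : ‖B (e qV)‖ ≤ ‖B‖ * ‖e qV‖ := B.le_opNorm _
    rw [h1] at h4
    exact h3.trans h4
  have h5 : ‖Λ qV‖ ^ 2 = ∫ x in ball (0 : Space d) r, pol q x ^ 2 := by
    rw [← real_inner_self_eq_norm_sq, L2.inner_def]
    refine integral_congr_ae ?_
    filter_upwards [(hmem q).coeFn_toLp] with x hx
    change ⟪((hmem q).toLp _ : Space d → ℝ) x, ((hmem q).toLp _ : Space d → ℝ) x⟫ = _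
    rw [hx, real_inner_self_eq_norm_sq, Real.norm_eq_abs, sq_abs]
  rw [← h5, ← sq_abs]
  calc |pol q z| ^ 2 ≤ (‖B‖ * ‖Λ qV‖) ^ 2 := pow_le_pow_left₀ (abs_nonneg _) h2 2
    _ = ‖B‖ ^ 2 * ‖Λ qV‖ ^ 2 := mul_pow _ _ _
    _ ≤ (‖B‖ ^ 2 + 1) * ‖Λ qV‖ ^ 2 := by
        refine mul_le_mul_of_nonneg_right ?_ (by positivity)
        linarith

/-! ### The discrete trace inequality -/

/-- With `f = 1`, `PolyDomain.gauss_green` becomes the divergence theorem for smooth functions. -/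
theorem hasWeakPartial_one {d : ℕ} {T : Set (Space d)} (i : Fin d) :
    HasWeakPartial T (fun _ => 1) i (fun _ => 0) := by
  intro φ h1 h2 h3
  have hd : Differentiable ℝ φ := h1.differentiable (by simp)
  have hc : Continuous fun x => fderiv ℝ φ x (EuclideanSpace.single i 1) :=
    (h1.continuous_fderiv (by simp)).clm_apply continuous_const
  have hcs : HasCompactSupport fun x => fderiv ℝ φ x (EuclideanSpace.single i 1) :=
    h2.fderiv_apply ℝ _
  have hInt := hc.integrable_of_hasCompactSupport (μ := volume) hcs
  have h0 := integral_mul_fderiv_eq_neg_fderiv_mul_of_integrable (μ := (volume : Measure (Space d)))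
    (f := fun _ : Space d => (1 : ℝ)) (g := φ) (v := EuclideanSpace.single i 1)
    (by simp) (by simpa using hInt)
    (by simpa using h1.continuous.integrable_of_hasCompactSupport h2)
    (fun x _ => differentiableAt_const _) (fun x _ => hd x)
  have h4 : ∫ x in T, 1 * fderiv ℝ φ x (EuclideanSpace.single i 1)
      = ∫ x, 1 * fderiv ℝ φ x (EuclideanSpace.single i 1) := by
    refine setIntegral_eq_integral_of_forall_compl_eq_zero fun x hx => ?_
    rw [fderiv_of_notMem_tsupport ℝ fun hxs => hx (h3 hxs)]
    simp
  rw [h4, h0]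
  simp

/-- If `y` lay strictly beyond the tangent plane at `x`, the segment to `y` from a point `x - s • n`
of `T` would cross that plane near `x`. Star-convexity would put the crossing point in `T`, and the
normal would exclude it. -/
theorem IsOutwardNormal.inner_nonneg_of_starConvex {d : ℕ} {T : Set (Space d)} {x n y : Space d}
    (h : IsOutwardNormal T x n) (hy : StarConvex ℝ y T) : 0 ≤ ⟪x - y, n⟫ := by
  by_contra hcon
  have hc : 0 < ⟪y - x, n⟫ := by
    rw [← neg_sub, inner_neg_left]; linarith
  set c := ⟪y - x, n⟫
  have hnn : ⟪n, n⟫ = 1 := by rw [real_inner_self_eq_norm_sq, h.1]; norm_num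
  -- The weight `s / (c + s)` places `w s` exactly on the tangent plane, and `w s → x` as `s → 0`.
  let w : ℝ → Space d := fun s => (s / (c + s)) • y + (1 - s / (c + s)) • (x - s • n)
  have hw : Tendsto w (𝓝[>] 0) (𝓝 x) := by
    have hwc : ContinuousAt w 0 := by
      have hd : ContinuousAt (fun s : ℝ => s / (c + s)) 0 :=
        continuousAt_id.div (by fun_prop) (by simpa using hc.ne')
      exact (hd.smul continuousAt_const).add ((continuousAt_const.sub hd).smul (by fun_prop))
    have := hwc.tendsto
    simp only [w, zero_div, zero_smul, sub_zero, one_smul, zero_add] at this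
    exact this.mono_left nhdsWithin_le_nhds
  obtain ⟨s, ⟨h1, h2⟩, h3⟩ := (((hw.eventually h.2).and
    (eventually_ray h.2 (-n))).and self_mem_nhdsWithin).exists
  have hs : (0 : ℝ) < s := h3
  have hcs : 0 < c + s := by linarith
  have hz : x - s • n ∈ T := by
    rw [sub_eq_add_neg, ← smul_neg]
    refine h2.2 ?_
    rw [add_sub_cancel_left, inner_smul_left, inner_neg_left, hnn]
    simp only [conj_trivial]; linarith
  have hmem : w s ∈ T := hy hz (by positivity)
    (by rw [sub_nonneg, div_le_one hcs]; linarith) (by ring)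
  have hlt := h1.1 hmem
  have hval : w s - x = (s / (c + s)) • (y - x) - ((1 - s / (c + s)) * s) • n := by
    simp only [w]
    module
  rw [hval, inner_sub_left, inner_smul_left, inner_smul_left, hnn] at hlt
  simp only [conj_trivial, mul_one] at hlt
  have : s / (c + s) * c - (1 - s / (c + s)) * s = 0 := by field_simp; ring
  exact absurd hlt (by rw [show ⟪y - x, n⟫ = c from rfl, this]; exact lt_irrefl 0)

/-- Apply the sign condition to the points of the ball farthest in the normal direction, `x₀ + t •
n` with `t < ρ`. -/
theorem IsOutwardNormal.le_inner_of_ball {d : ℕ} {T : Set (Space d)} {x n x₀ : Space d} {ρ : ℝ}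
    (h : IsOutwardNormal T x n) (hstar : ∀ y ∈ ball x₀ ρ, StarConvex ℝ y T) (hρ : 0 < ρ) :
    ρ ≤ ⟪x - x₀, n⟫ := by
  have hnn : ⟪n, n⟫ = 1 := by rw [real_inner_self_eq_norm_sq, h.1]; norm_num
  refine le_of_forall_lt fun s hs => ?_
  rcases le_or_gt 0 s with hs0 | hs0
  · let t := (s + ρ) / 2
    have ht : s < t ∧ t < ρ := ⟨by simp only [t]; linarith, by simp only [t]; linarith⟩
    have hmem : x₀ + t • n ∈ ball x₀ ρ := by
      rw [mem_ball, dist_eq_norm, add_sub_cancel_left, norm_smul, h.1, mul_one, Real.norm_eq_abs,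
        abs_of_nonneg (by linarith [ht.1])]
      exact ht.2
    have := h.inner_nonneg_of_starConvex (hstar _ hmem)
    rw [← sub_sub, inner_sub_left, inner_smul_left, hnn] at this
    simp only [conj_trivial, mul_one] at this
    linarith [ht.1]
  · have := h.inner_nonneg_of_starConvex (hstar x₀ (mem_ball_self hρ))
    linarith

/-- The field `x - x₀` has divergence `d`, and by star-shapedness its outward flux density is at
least `ρ`. -/
theorem PolyDomain.measure_frontier_le {d : ℕ} {T : Set (Space d)} {H : HyperplaneFamily d}
    (hT : PolyDomain T H) {x₀ : Space d} {ρ : ℝ} (hρ : 0 < ρ)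
    (hstar : ∀ y ∈ ball x₀ ρ, StarConvex ℝ y T) :
    ρ * (μHE[d - 1] : Measure (Space d)).real (frontier T) ≤ d * volume.real T := by
  have hgg : ∀ i : Fin d, IntegrableOn (fun x => (x - x₀) i * outwardNormal T x i) (frontier T)
      μHE[d - 1] ∧ volume.real T
        = ∫ x in frontier T, (x - x₀) i * outwardNormal T x i ∂μHE[d - 1] := by
    intro i
    have hφ : ContDiff ℝ ∞ fun x : Space d => (x - x₀) i :=
      (EuclideanSpace.proj (𝕜 := ℝ) i).contDiff.comp (contDiff_id.sub contDiff_const)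
    have hfd : ∀ x : Space d, fderiv ℝ (fun x : Space d => (x - x₀) i) x
        (EuclideanSpace.single i 1) = 1 := by
      intro x
      have h1 : HasFDerivAt (fun x : Space d => (x - x₀) i)
          ((EuclideanSpace.proj (𝕜 := ℝ) i).comp (ContinuousLinearMap.id ℝ (Space d))) x :=
        (EuclideanSpace.proj (𝕜 := ℝ) i).hasFDerivAt.comp x ((hasFDerivAt_id x).sub_const x₀)
      rw [h1.fderiv]
      simp
    have := hT.gauss_green (f := fun _ => 1) (g := fun _ => 0) (b := fun _ => 1) (C := 1) (i := i)
      continuousOn_const (by simp) (Eventually.of_forall fun _ _ => tendsto_const_nhds)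
      (by simp) (hasWeakPartial_one i) hφ
    simp only [one_mul, hfd, zero_mul, add_zero] at this
    refine ⟨this.1, ?_⟩
    rw [← this.2]
    simp
  have hinner : ∀ x, ⟪x - x₀, outwardNormal T x⟫
      = ∑ i, (x - x₀) i * outwardNormal T x i := by
    intro x
    rw [PiLp.inner_apply]
    exact Finset.sum_congr rfl fun i _ => by simp [mul_comm]
  have hInt : IntegrableOn (fun x => ⟪x - x₀, outwardNormal T x⟫) (frontier T) μHE[d - 1] := by
    simp_rw [hinner]
    exact integrable_finsetSum _ fun i _ => (hgg i).1
  have hsum : d * volume.real T = ∫ x in frontier T, ⟪x - x₀, outwardNormal T x⟫ ∂μHE[d - 1] := by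
    simp_rw [hinner]
    rw [integral_finsetSum _ fun i _ => (hgg i).1, ← Finset.sum_congr rfl fun i _ => (hgg i).2]
    simp
  rw [hsum]
  have hconst : ∫ x in frontier T, ρ ∂(μHE[d - 1] : Measure (Space d))
      = ρ * (μHE[d - 1] : Measure (Space d)).real (frontier T) := by
    rw [setIntegral_const, smul_eq_mul, mul_comm]
  rw [← hconst]
  refine integral_mono_ae (integrableOn_const hT.measure_frontier_lt_top.ne) hInt ?_
  change ∀ᵐ x ∂_, _
  rw [ae_restrict_iff' isClosed_frontier.measurableSet]
  filter_upwards [hT.ae_normal] with x hx hxf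
  obtain ⟨n, hn⟩ := hx hxf
  rw [hn.eq_outwardNormal]
  exact hn.le_inner_of_ball hstar hρ

theorem integral_ball_comp_affine {d : ℕ} (F : Space d → ℝ) (x₀ : Space d) {h r : ℝ} (hh : 0 < h) :
    ∫ z in ball (0 : Space d) r, F (x₀ + h • z) = (h ^ d)⁻¹ * ∫ x in ball x₀ (r * h), F x := by
  rw [← integral_indicator isOpen_ball.measurableSet, ← integral_indicator isOpen_ball.measurableSet]
  have h1 : ∀ z : Space d, (ball (0 : Space d) r).indicator (fun z => F (x₀ + h • z)) z
      = (fun y => (ball x₀ (r * h)).indicator F (x₀ + y)) (h • z) := by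
    intro z
    have hiff : z ∈ ball (0 : Space d) r ↔ x₀ + h • z ∈ ball x₀ (r * h) := by
      rw [mem_ball_zero_iff, mem_ball, dist_eq_norm, add_sub_cancel_left, norm_smul,
        Real.norm_eq_abs, abs_of_pos hh, mul_comm r, mul_lt_mul_iff_right₀ hh]
    by_cases hz : z ∈ ball (0 : Space d) r
    · simp only [indicator_of_mem hz, indicator_of_mem (hiff.1 hz)]
    · simp only [indicator_of_notMem hz, indicator_of_notMem fun h => hz (hiff.2 h)]
  simp_rw [h1]
  rw [Measure.integral_comp_smul volume (fun y => (ball x₀ (r * h)).indicator F (x₀ + y)) h,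
    integral_add_left_eq_self, finrank_euclideanSpace_fin, smul_eq_mul,
    abs_of_nonneg (by positivity)]

theorem diam_pos_of_isOpen {d : ℕ} (hd : 1 ≤ d) {T : Set (Space d)} (ho : IsOpen T)
    (hb : Bornology.IsBounded T) (hne : T.Nonempty) : 0 < diam T := by
  obtain ⟨x, hx⟩ := hne
  obtain ⟨r, hr, hball⟩ := Metric.isOpen_iff.1 ho x hx
  have hy : x + EuclideanSpace.single ⟨0, hd⟩ (r / 2) ∈ T := by
    apply hball
    rw [mem_ball, dist_eq_norm, add_sub_cancel_left, PiLp.norm_single, Real.norm_eq_abs,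
      abs_of_pos (half_pos hr)]
    exact half_lt_self hr
  have h1 := dist_le_diam_of_mem hb hy hx
  rw [dist_eq_norm, add_sub_cancel_left, PiLp.norm_single, Real.norm_eq_abs,
    abs_of_pos (half_pos hr)] at h1
  linarith

/-- Scaled by `h = diam T`, the element lies between a ball of radius `r` and the unit ball. Hence
the square of a polynomial is bounded pointwise by `C / h ^ d` times its integral. Integration over
the boundary costs its surface measure, at most `d / (r * h)` times the volume, which is at most `h
^ d` times that of the unit ball. -/
theorem exists_discreteTraceInequality {d : ℕ} (hd : 2 ≤ d) {Ω : Set (Space d)} {ι : Type*}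
    (M : ι → Mesh Ω) (hstar : StarShaped M) (p : ℕ) :
    ∃ C : ℝ, 0 < C ∧ DiscreteTraceInequality M p C := by
  obtain ⟨r, hr, -, hstar⟩ := hstar
  obtain ⟨C, hC, hsup⟩ := exists_sup_le_integral d p hr
  have hB : 0 < volume.real (closedBall (0 : Space d) 1) :=
    ENNReal.toReal_pos (measure_closedBall_pos _ _ one_pos).ne' measure_closedBall_lt_top.ne
  refine ⟨d * volume.real (closedBall (0 : Space d) 1) / r * C, by positivity, ?_⟩
  intro i T hT q hq
  obtain ⟨x₀, hx₀, hst⟩ := hstar i T hT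
  obtain ⟨H, hPD⟩ := ((M i).elem_polytope T hT).exists_polyDomain hd
  have hh : 0 < diam T := diam_pos_of_isOpen (by omega) hPD.isOpen hPD.bounded hPD.nonempty
  set h := diam T
  have hTball : closure T ⊆ closedBall x₀ h := by
    refine closure_minimal (fun y hy => ?_) isClosed_closedBall
    exact dist_le_diam_of_mem hPD.bounded hy hx₀
  have hballT : ball x₀ (r * h) ⊆ T := fun y hy => (hst y hy).mem ⟨x₀, hx₀⟩
  have hqi : IntegrableOn (fun x => pol q x ^ 2) T :=
    integrableOn_of_continuous hPD.bounded ((continuous_pol q).pow 2)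
  set I := ∫ x in T, pol q x ^ 2
  have hI : 0 ≤ I := integral_nonneg fun x => sq_nonneg _
  have hbound : ∀ x ∈ closure T, pol q x ^ 2 ≤ C * ((h ^ d)⁻¹ * I) := by
    intro x hx
    obtain ⟨q', hq', hqq⟩ := exists_pol_comp_affine q hq x₀ h
    have hz : h⁻¹ • (x - x₀) ∈ closedBall (0 : Space d) 1 := by
      rw [mem_closedBall_zero_iff, norm_smul, norm_inv, Real.norm_eq_abs, abs_of_pos hh,
        inv_mul_le_iff₀ hh, mul_one, ← dist_eq_norm]
      exact hTball hx
    have h1 := hsup q' hq' _ hz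
    rw [hqq, smul_smul, mul_inv_cancel₀ hh.ne', one_smul, add_sub_cancel] at h1
    refine h1.trans (mul_le_mul_of_nonneg_left ?_ hC.le)
    simp_rw [hqq]
    rw [integral_ball_comp_affine (fun x => pol q x ^ 2) x₀ hh]
    refine mul_le_mul_of_nonneg_left ?_ (by positivity)
    exact setIntegral_mono_set hqi (Eventually.of_forall fun x => sq_nonneg _)
      hballT.eventuallyLE
  have hfr := hPD.measure_frontier_le (mul_pos hr hh) hst
  have hvol : volume.real T ≤ h ^ d * volume.real (closedBall (0 : Space d) 1) := by
    calc volume.real T ≤ volume.real (closedBall x₀ h) :=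
          measureReal_mono (subset_closure.trans hTball) measure_closedBall_lt_top.ne
      _ = _ := by
          rw [Measure.real, Measure.addHaar_closedBall' _ _ hh.le, finrank_euclideanSpace_fin,
            ENNReal.toReal_mul, ENNReal.toReal_ofReal (by positivity)]
          rfl
  calc ∫ x in frontier T, (MvPolynomial.eval (fun j => x j) q) ^ 2 ∂μHE[d - 1]
      ≤ ∫ x in frontier T, C * ((h ^ d)⁻¹ * I) ∂(μHE[d - 1] : Measure (Space d)) := by
        refine integral_mono_of_nonneg (Eventually.of_forall fun x => sq_nonneg _)
          (integrableOn_const hPD.measure_frontier_lt_top.ne) ?_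
        exact ae_restrict_of_forall_mem isClosed_frontier.measurableSet fun x hx =>
          hbound x (frontier_subset_closure hx)
    _ = (μHE[d - 1] : Measure (Space d)).real (frontier T) * (C * ((h ^ d)⁻¹ * I)) := by
        rw [setIntegral_const, smul_eq_mul]
    _ ≤ (d * (h ^ d * volume.real (closedBall (0 : Space d) 1)) / (r * h)) *
          (C * ((h ^ d)⁻¹ * I)) := by
        refine mul_le_mul_of_nonneg_right ?_ (by positivity)
        rw [le_div_iff₀ (mul_pos hr hh), mul_comm]
        exact hfr.trans (mul_le_mul_of_nonneg_left hvol (Nat.cast_nonneg d))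
    _ = _ := by
        have : ∫ x in T, (MvPolynomial.eval (fun j => x j) q) ^ 2 = I := rfl
        rw [this]
        field_simp

/-! ### Geometry of meshes -/

/-- Boundary points are limits of exterior points, so the polytope is the interior of its closure.
The inclusion of the elements in `Ω` follows, since a mesh is only assumed to cover `closure Ω` by
closures. -/
theorem PolyDomain.mem_of_closure_mem_nhds {d : ℕ} {T : Set (Space d)} {H : HyperplaneFamily d}
    (hT : PolyDomain T H) {x : Space d} (hx : closure T ∈ 𝓝 x) : x ∈ T := by
  by_contra hcon
  have hfr : x ∈ frontier T := by
    rw [hT.isOpen.frontier_eq]; exact ⟨mem_of_mem_nhds hx, hcon⟩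
  exact (mem_closure_iff_frequently.1 (hT.outside x hfr)) (by
    filter_upwards [hx] with y hy hy'
    exact hy' hy)

/-- Facets have positive surface measure, so almost-everywhere statements about normals can be read
at one point to exclude impossible configurations. -/
theorem exists_mem_of_ae {d : ℕ} {e : Set (Space d)} (he : 0 < μHE[d - 1] e)
    {P : Space d → Prop} (h : ∀ᵐ x ∂(μHE[d - 1] : Measure (Space d)), x ∈ e → P x) :
    ∃ x ∈ e, P x := by
  by_contra hcon
  push Not at hcon
  refine he.ne' (measure_mono_null (fun x hx => ?_) (ae_iff.1 h))
  simp only [mem_ofPred_eq, Classical.not_imp]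
  exact ⟨hx, hcon x hx⟩

theorem eq_zero_of_eq_neg {d : ℕ} {v : Space d} (h : v = -v) : v = 0 := by
  have h2 : (2 : ℝ) • v = 0 := by
    rw [two_smul]
    exact eq_neg_iff_add_eq_zero.1 h
  exact (smul_eq_zero.1 h2).resolve_left two_ne_zero

namespace Mesh

variable {d : ℕ} {Ω : Set (Space d)} {HΩ : HyperplaneFamily d}

theorem exists_polyDomain (M : Mesh Ω) (hd : 2 ≤ d) {T : Set (Space d)} (hT : T ∈ M.elems) :
    ∃ H, PolyDomain T H := (M.elem_polytope T hT).exists_polyDomain hd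

theorem elem_isOpen (M : Mesh Ω) (hd : 2 ≤ d) {T : Set (Space d)} (hT : T ∈ M.elems) :
    IsOpen T := ((M.elem_polytope T hT).full (by omega)).1

theorem elem_bounded (M : Mesh Ω) (hd : 2 ≤ d) {T : Set (Space d)} (hT : T ∈ M.elems) :
    Bornology.IsBounded T := ((M.elem_polytope T hT).full (by omega)).2.1

theorem elem_subset (M : Mesh Ω) (hd : 2 ≤ d) (hΩ : PolyDomain Ω HΩ) {T : Set (Space d)}
    (hT : T ∈ M.elems) : T ⊆ Ω := by
  intro x hx
  refine hΩ.mem_of_closure_mem_nhds ?_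
  filter_upwards [(M.elem_isOpen hd hT).mem_nhds hx] with y hy
  rw [M.cover]
  exact mem_iUnion₂.2 ⟨T, hT, subset_closure hy⟩

theorem facet_isClosed (M : Mesh Ω) {e : Set (Space d)} (he : e ∈ M.facets) : IsClosed e := by
  obtain ⟨F, -, rfl⟩ := M.facet_polytope e he
  exact isClosed_closure

theorem facet_measure_pos (M : Mesh Ω) (hd : 2 ≤ d) {e : Set (Space d)} (he : e ∈ M.facets) :
    0 < μHE[d - 1] e := by
  obtain ⟨F, hF, rfl⟩ := M.facet_polytope e he
  obtain ⟨_, _, _, _, _, _, _, _, hpos⟩ := hF.exists_relOpen hd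
  exact hpos.trans_le (measure_mono subset_closure)

theorem mem_adjacent (M : Mesh Ω) {e T : Set (Space d)} :
    T ∈ M.adjacent e ↔ T ∈ M.elems ∧ e ⊆ frontier T := by
  simp [adjacent]

theorem mem_facetsOf (M : Mesh Ω) {e T : Set (Space d)} :
    e ∈ M.facetsOf T ↔ e ∈ M.facets ∧ e ⊆ frontier T := by
  simp [facetsOf]

theorem facet_ae_normal (M : Mesh Ω) (hd : 2 ≤ d) {e T : Set (Space d)} (he : e ∈ M.facets)
    (hT : T ∈ M.adjacent e) :
    ∀ᵐ x ∂(μHE[d - 1] : Measure (Space d)), x ∈ e →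
      IsOutwardNormal T x (outwardNormal T x) ∧
        (outwardNormal T x = M.normal e ∨ outwardNormal T x = -M.normal e) := by
  rw [mem_adjacent] at hT
  obtain ⟨H, hPD⟩ := M.exists_polyDomain hd hT.1
  obtain ⟨F, hF, heF⟩ := M.facet_polytope e he
  have h1 := M.normal_orthogonal e he
  have h2 := hT.2
  have h3 := M.normal_unit e he
  generalize M.normal e = m at *
  subst heF
  exact hPD.ae_normal_eq hd hF h2 h3 h1

/-- Two distinct elements have opposite normals on a common facet. -/
theorem facet_ae_normal_neg (M : Mesh Ω) (hd : 2 ≤ d) {e T T' : Set (Space d)}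
    (he : e ∈ M.facets) (hT : T ∈ M.adjacent e) (hT' : T' ∈ M.adjacent e) (hne : T ≠ T') :
    ∀ᵐ x ∂(μHE[d - 1] : Measure (Space d)), x ∈ e → outwardNormal T x = -outwardNormal T' x := by
  filter_upwards [M.facet_ae_normal hd he hT, M.facet_ae_normal hd he hT'] with x h1 h2 hx
  rw [mem_adjacent] at hT hT'
  exact (h1 hx).1.eq_neg_of_disjoint (h2 hx).1 (M.elem_disjoint T hT.1 T' hT'.1 hne)

/-- Distinct elements have opposite normals on a common facet. Three elements would have pairwise
opposite unit normals, which is impossible. -/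
theorem interior_adjacent (M : Mesh Ω) (hd : 2 ≤ d) {e : Set (Space d)}
    (he : e ∈ M.interiorFacets) :
    ∃ T₁ T₂, T₁ ≠ T₂ ∧ M.adjacent e = {T₁, T₂} := by
  classical
  simp only [interiorFacets, Finset.mem_filter] at he
  obtain ⟨hef, T₁, hT₁, T₂, hT₂, hne, heq⟩ := he
  have h1 : T₁ ∈ M.adjacent e := M.mem_adjacent.2 ⟨hT₁, heq ▸ inter_subset_left⟩
  have h2 : T₂ ∈ M.adjacent e := M.mem_adjacent.2 ⟨hT₂, heq ▸ inter_subset_right⟩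
  refine ⟨T₁, T₂, hne, ?_⟩
  ext T
  rw [Finset.mem_insert, Finset.mem_singleton]
  refine ⟨fun hT => ?_, ?_⟩
  · by_contra hcon
    push Not at hcon
    obtain ⟨x, hx, hx1, hx2, hx3, hx4⟩ := exists_mem_of_ae (M.facet_measure_pos hd hef) (by
      filter_upwards [M.facet_ae_normal_neg hd hef h1 h2 hne,
        M.facet_ae_normal_neg hd hef hT h1 hcon.1, M.facet_ae_normal_neg hd hef hT h2 hcon.2,
        M.facet_ae_normal hd hef h1] with x hx1 hx2 hx3 hx4 hx
      exact And.intro (hx1 hx) (And.intro (hx2 hx) (And.intro (hx3 hx) (hx4 hx).1)))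
    have h0 : outwardNormal T₁ x = outwardNormal T₂ x := neg_injective (hx2.symm.trans hx3)
    rw [h0] at hx1
    have h5 : outwardNormal T₂ x = 0 := eq_zero_of_eq_neg hx1
    have h6 := hx4.1
    rw [h0, h5] at h6
    simp at h6
  · rintro (rfl | rfl) <;> assumption

theorem interior_mem_facets (M : Mesh Ω) {e : Set (Space d)} (he : e ∈ M.interiorFacets) :
    e ∈ M.facets := by
  classical
  simp only [interiorFacets, Finset.mem_filter] at he
  exact he.1

theorem boundary_mem_facets (M : Mesh Ω) {e : Set (Space d)} (he : e ∈ M.boundaryFacets) :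
    e ∈ M.facets := by
  classical
  simp only [boundaryFacets, Finset.mem_filter] at he
  exact he.1

/-- On a boundary facet, the normals of the element and of `Ω` agree. -/
theorem boundary_ae_normal (M : Mesh Ω) (hd : 2 ≤ d) (hΩ : PolyDomain Ω HΩ) {e T : Set (Space d)}
    (he : e ∈ M.facets) (heΩ : e ⊆ frontier Ω) (hT : T ∈ M.adjacent e) :
    ∀ᵐ x ∂(μHE[d - 1] : Measure (Space d)), x ∈ e →
      IsOutwardNormal Ω x (outwardNormal Ω x) ∧ outwardNormal Ω x = outwardNormal T x := by
  filter_upwards [M.facet_ae_normal hd he hT, hΩ.ae_normal] with x h1 h2 hx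
  obtain ⟨n, hn⟩ := h2 (heΩ hx)
  rw [hn.eq_outwardNormal]
  refine ⟨hn, ?_⟩
  exact ((h1 hx).1.eq_of_subset hn (M.elem_subset hd hΩ (M.mem_adjacent.1 hT).1)).symm

/-- Both elements would share the normal of `Ω`, whereas distinct elements have opposite normals. -/
theorem not_adjacent_two_of_boundary (M : Mesh Ω) (hd : 2 ≤ d) (hΩ : PolyDomain Ω HΩ)
    {e T T' : Set (Space d)} (he : e ∈ M.facets) (heΩ : e ⊆ frontier Ω) (hT : T ∈ M.adjacent e)
    (hT' : T' ∈ M.adjacent e) : T = T' := by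
  by_contra hne
  obtain ⟨x, -, hx1, hx2, hx3⟩ := exists_mem_of_ae (M.facet_measure_pos hd he) (by
    filter_upwards [M.facet_ae_normal_neg hd he hT hT' hne, M.boundary_ae_normal hd hΩ he heΩ hT,
      M.boundary_ae_normal hd hΩ he heΩ hT'] with x h1 h2 h3 hx
    exact And.intro (h1 hx) (And.intro (h2 hx) (h3 hx)))
  rw [← hx2.2, ← hx3.2] at hx1
  have h5 : outwardNormal Ω x = 0 := eq_zero_of_eq_neg hx1
  have h6 := hx2.1.1
  rw [h5] at h6
  simp at h6

theorem boundary_subset (M : Mesh Ω) {e : Set (Space d)} (he : e ∈ M.boundaryFacets) :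
    e ⊆ frontier Ω := by
  classical
  simp only [boundaryFacets, Finset.mem_filter] at he
  obtain ⟨-, T, -, h⟩ := he
  exact h.trans inter_subset_right

theorem boundary_adjacent (M : Mesh Ω) (hd : 2 ≤ d) (hΩ : PolyDomain Ω HΩ) {e : Set (Space d)}
    (he : e ∈ M.boundaryFacets) : ∃ T, M.adjacent e = {T} := by
  classical
  have heΩ := M.boundary_subset he
  have hef := M.boundary_mem_facets he
  simp only [boundaryFacets, Finset.mem_filter] at he
  obtain ⟨-, T, hT, h⟩ := he
  have hTa : T ∈ M.adjacent e := M.mem_adjacent.2 ⟨hT, h.trans inter_subset_left⟩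
  refine ⟨T, Finset.eq_singleton_iff_unique_mem.2 ⟨hTa, fun T' hT' => ?_⟩⟩
  exact M.not_adjacent_two_of_boundary hd hΩ hef heΩ hT' hTa

theorem interior_boundary_disjoint (M : Mesh Ω) (hd : 2 ≤ d) (hΩ : PolyDomain Ω HΩ) :
    Disjoint M.interiorFacets M.boundaryFacets := by
  classical
  rw [Finset.disjoint_left]
  intro e hI hB
  obtain ⟨T₁, T₂, hne, hadj⟩ := M.interior_adjacent hd hI
  exact hne (M.not_adjacent_two_of_boundary hd hΩ (M.boundary_mem_facets hB) (M.boundary_subset hB)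
    (by rw [hadj]; simp) (by rw [hadj]; simp))

open scoped Classical in
theorem facets_eq_union (M : Mesh Ω) : M.facets = M.interiorFacets ∪ M.boundaryFacets := by
  ext e
  simp only [interiorFacets, boundaryFacets, Finset.mem_union, Finset.mem_filter]
  exact ⟨fun he => (M.conforming e he).imp (fun h => ⟨he, h⟩) fun h => ⟨he, h⟩,
    fun h => h.elim (fun h => h.1) fun h => h.1⟩

theorem sum_facets (M : Mesh Ω) (hd : 2 ≤ d) (hΩ : PolyDomain Ω HΩ) (f : Set (Space d) → ℝ) :
    ∑ e ∈ M.facets, f e = ∑ e ∈ M.interiorFacets, f e + ∑ e ∈ M.boundaryFacets, f e := by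
  classical
  rw [facets_eq_union, Finset.sum_union (M.interior_boundary_disjoint hd hΩ)]

theorem mem_boundaryFacetsOn (M : Mesh Ω) {Γ e : Set (Space d)} :
    e ∈ M.boundaryFacetsOn Γ ↔ e ∈ M.boundaryFacets ∧ μHE[d - 1] (e \ Γ) = 0 := by
  classical
  simp [boundaryFacetsOn]

theorem boundaryOn_ae_mem (M : Mesh Ω) {Γ e : Set (Space d)} (he : e ∈ M.boundaryFacetsOn Γ) :
    ∀ᵐ x ∂(μHE[d - 1] : Measure (Space d)), x ∈ e → x ∈ Γ := by
  filter_upwards [measure_eq_zero_iff_ae_notMem.1 (M.mem_boundaryFacetsOn.1 he).2] with x hx hxe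
  by_contra hcon
  exact hx ⟨hxe, hcon⟩

theorem sum_boundaryFacets (M : Mesh Ω) (hd : 2 ≤ d) {ΓD ΓN : Set (Space d)}
    (hdisj : Disjoint ΓD ΓN) (hDN : ∀ e ∈ M.boundaryFacets,
      e ∈ M.boundaryFacetsOn ΓD ∨ e ∈ M.boundaryFacetsOn ΓN) (f : Set (Space d) → ℝ) :
    ∑ e ∈ M.boundaryFacets, f e
      = ∑ e ∈ M.boundaryFacetsOn ΓD, f e + ∑ e ∈ M.boundaryFacetsOn ΓN, f e := by
  classical
  have h1 : M.boundaryFacets = M.boundaryFacetsOn ΓD ∪ M.boundaryFacetsOn ΓN := by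
    ext e
    rw [Finset.mem_union]
    exact ⟨hDN e, fun h => h.elim (fun h => (M.mem_boundaryFacetsOn.1 h).1)
      fun h => (M.mem_boundaryFacetsOn.1 h).1⟩
  rw [h1, Finset.sum_union]
  rw [Finset.disjoint_left]
  intro e hD hN
  obtain ⟨x, -, hx1, hx2⟩ := exists_mem_of_ae (M.facet_measure_pos hd
    (M.boundary_mem_facets (M.mem_boundaryFacetsOn.1 hD).1)) (by
    filter_upwards [M.boundaryOn_ae_mem hD, M.boundaryOn_ae_mem hN] with x h1 h2 hx
    exact And.intro (h1 hx) (h2 hx))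
  exact disjoint_left.1 hdisj hx1 hx2

/-- Near almost every boundary point of an element, `Ω` is convex. -/
theorem ae_exists_convex (M : Mesh Ω) (hd : 2 ≤ d) (hΩ : PolyDomain Ω HΩ) {T : Set (Space d)}
    (hT : T ∈ M.elems) : ∀ᵐ x ∂(μHE[d - 1] : Measure (Space d)),
      x ∈ frontier T → ∃ r > 0, Convex ℝ (ball x r ∩ Ω) := by
  filter_upwards [hΩ.ae_normal] with x hx hxT
  by_cases hxΩ : x ∈ Ω
  · exact exists_convex_of_mem hΩ.isOpen hxΩ
  · have hxc : x ∈ closure Ω :=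
      closure_mono (M.elem_subset hd hΩ hT) (frontier_subset_closure hxT)
    obtain ⟨n, hn⟩ := hx (by rw [hΩ.isOpen.frontier_eq]; exact ⟨hxc, hxΩ⟩)
    exact hn.exists_convex

theorem setIntegral_domain (M : Mesh Ω) (hd : 2 ≤ d) (hΩ : PolyDomain Ω HΩ) {f : Space d → ℝ}
    (hf : ∀ T ∈ M.elems, IntegrableOn f T) :
    ∫ x in Ω, f x = ∑ T ∈ M.elems, ∫ x in T, f x := by
  rw [← integral_biUnion_finset M.elems (fun T hT => (M.elem_isOpen hd hT).measurableSet)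
    (fun T hT T' hT' hne => M.elem_disjoint T hT T' hT' hne) hf]
  refine setIntegral_congr_set ?_
  refine Filter.EventuallyLE.antisymm ?_ ?_
  · have hnull : ∀ᵐ x : Space d, ∀ T ∈ M.elems, x ∉ frontier T := by
      rw [Finset.eventually_all]
      intro T hT
      obtain ⟨H, hPD⟩ := M.exists_polyDomain hd hT
      exact measure_eq_zero_iff_ae_notMem.1 hPD.volume_frontier
    filter_upwards [hnull] with x hx hxΩ
    have hxc : x ∈ closure Ω := subset_closure hxΩ
    rw [M.cover] at hxc
    obtain ⟨T, hT, hxT⟩ := mem_iUnion₂.1 hxc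
    refine mem_iUnion₂.2 ⟨T, hT, ?_⟩
    by_contra hcon
    exact hx T hT (by rw [(M.elem_isOpen hd hT).frontier_eq]; exact ⟨hxT, hcon⟩)
  · exact LE.le.eventuallyLE (iUnion₂_subset fun T hT => M.elem_subset hd hΩ hT)

theorem setIntegral_frontier (M : Mesh Ω) {T : Set (Space d)} (hT : T ∈ M.elems)
    {f : Space d → ℝ} (hf : IntegrableOn f (frontier T) μHE[d - 1]) :
    ∫ x in frontier T, f x ∂μHE[d - 1] = ∑ e ∈ M.facetsOf T, ∫ x in e, f x ∂μHE[d - 1] := by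
  have h1 : frontier T = ⋃ e ∈ M.facetsOf T, e := by
    conv_lhs => rw [M.frontier_eq T hT]
    ext x
    simp only [mem_iUnion, mem_facetsOf]
    constructor
    · rintro ⟨e, he, h, hx⟩; exact ⟨e, ⟨he, h⟩, hx⟩
    · rintro ⟨e, ⟨he, h⟩, hx⟩; exact ⟨e, he, h, hx⟩
  conv_lhs => rw [h1]
  refine setIntegral_biUnion_finset_ae (s := fun e : Set (Space d) => e) _ ?_ ?_ ?_
  · exact fun e he => (M.facet_isClosed (M.mem_facetsOf.1 he).1).measurableSet
  · exact fun e he e' he' hne => M.facet_nonoverlap e (M.mem_facetsOf.1 he).1 e'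
      (M.mem_facetsOf.1 he').1 hne
  · exact fun e he => hf.mono_set (M.mem_facetsOf.1 he).2

theorem sum_elems_facetsOf (M : Mesh Ω) (f : Set (Space d) → Set (Space d) → ℝ) :
    ∑ T ∈ M.elems, ∑ e ∈ M.facetsOf T, f T e = ∑ e ∈ M.facets, ∑ T ∈ M.adjacent e, f T e := by
  refine Finset.sum_comm' fun T e => ?_
  rw [mem_facetsOf, mem_adjacent]
  tauto

end Mesh

/-! ### Gauss–Green formula for vector fields and the advection-reaction form -/

theorem weakPartial_spec {d : ℕ} {Ω : Set (Space d)} {f : Space d → ℝ} (hf : MemW1Infty Ω f)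
    (i : Fin d) : MemLp (weakPartial Ω f i) ∞ (volume.restrict Ω) ∧
      HasWeakPartial Ω f i (weakPartial Ω f i) := by
  unfold weakPartial
  rw [dif_pos (hf.2 i)]
  exact (hf.2 i).choose_spec

theorem integrableOn_of_memLp_top {d : ℕ} {Ω T : Set (Space d)} (hTΩ : T ⊆ Ω)
    (hT : Bornology.IsBounded T) {g : Space d → ℝ} (hg : MemLp g ∞ (volume.restrict Ω)) :
    IntegrableOn g T := by
  have : IsFiniteMeasure (volume.restrict T) := ⟨by
    rw [Measure.restrict_apply_univ]; exact hT.measure_lt_top⟩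
  exact (hg.mono_measure (Measure.restrict_mono hTΩ le_rfl)).integrable le_top

theorem integrableOn_mul_of_memLp_top {d : ℕ} {Ω T : Set (Space d)} (hTΩ : T ⊆ Ω)
    (hTm : MeasurableSet T) (hT : Bornology.IsBounded T) {g φ : Space d → ℝ}
    (hg : MemLp g ∞ (volume.restrict Ω)) (hφ : Continuous φ) :
    IntegrableOn (fun x => g x * φ x) T := by
  obtain ⟨C, hC⟩ := exists_bound_of_continuous hT hφ
  refine (integrableOn_of_memLp_top hTΩ hT hg).mul_bdd (c := C) hφ.aestronglyMeasurable ?_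
  exact ae_restrict_of_forall_mem hTm fun x hx => hC x hx

/-- The scalar formula is applied to the components of `trace Ω β`, which are continuous and bounded
in `Ω` and have boundary limits almost everywhere. The volume integrals do not see the replacement
of `β`. -/
theorem PolyDomain.gauss_green_field {d : ℕ} {Ω T : Set (Space d)} {H : HyperplaneFamily d}
    (hT : PolyDomain T H) (hΩ : IsOpen Ω) (hTΩ : T ⊆ Ω) {β : Space d → Space d}
    (hβ : ∀ j, MemW1Infty Ω (fun x => β x j))
    (hconv : ∀ᵐ x ∂(μHE[d - 1] : Measure (Space d)),
      x ∈ frontier T → ∃ r > 0, Convex ℝ (ball x r ∩ Ω))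
    {φ : Space d → ℝ} (hφ : ContDiff ℝ ∞ φ) :
    IntegrableOn (fun x => ⟪trace Ω β x, outwardNormal T x⟫ * φ x) (frontier T) μHE[d - 1] ∧
    ∫ x in T, (⟪β x, gradient φ x⟫ + weakDiv Ω β x * φ x)
      = ∫ x in frontier T, ⟪trace Ω β x, outwardNormal T x⟫ * φ x ∂μHE[d - 1] := by
  have hTm := hT.isOpen.measurableSet
  obtain ⟨C, hC⟩ := exists_trace_bound hΩ hβ
  have haeT : ∀ᵐ x ∂volume.restrict T, trace Ω β x = β x :=
    ae_mono (Measure.restrict_mono hTΩ le_rfl) (ae_trace_eq hΩ hβ)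
  have hdφ : ∀ i : Fin d, Continuous fun x => fderiv ℝ φ x (EuclideanSpace.single i 1) := fun i =>
    (hφ.continuous_fderiv (by simp)).clm_apply continuous_const
  have key : ∀ i : Fin d,
      IntegrableOn (fun x => trace Ω β x i * φ x * outwardNormal T x i) (frontier T) μHE[d - 1] ∧
      ∫ x in T, (trace Ω β x i * fderiv ℝ φ x (EuclideanSpace.single i 1)
          + weakPartial Ω (fun y => β y i) i x * φ x)
        = ∫ x in frontier T, trace Ω β x i * φ x * outwardNormal T x i ∂μHE[d - 1] := by
    intro i
    refine hT.gauss_green (f := fun x => trace Ω β x i) (b := fun x => trace Ω β x i) (C := C)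
      ?_ (fun x hx => hC x (hTΩ hx) i) ?_ ?_ ?_ hφ
    · exact (EuclideanSpace.proj (𝕜 := ℝ) i).continuous.comp_continuousOn
        ((continuousOn_trace hΩ hβ).mono hTΩ)
    · filter_upwards [hconv] with x hx hxT
      have h1 := tendsto_trace hΩ hβ (closure_mono hTΩ (frontier_subset_closure hxT)) (hx hxT)
      exact (((EuclideanSpace.proj (𝕜 := ℝ) i).continuous.tendsto _).comp h1).mono_left
        (nhdsWithin_mono _ hTΩ)
    · exact integrableOn_of_memLp_top hTΩ hT.bounded (weakPartial_spec (hβ i) i).1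
    · intro ψ hψ hψc hψT
      rw [← (weakPartial_spec (hβ i) i).2.mono hΩ.measurableSet hTΩ ψ hψ hψc hψT]
      refine integral_congr_ae ?_
      filter_upwards [haeT] with x hx
      rw [hx]
  have hInt : ∀ i : Fin d, IntegrableOn (fun x => trace Ω β x i
      * fderiv ℝ φ x (EuclideanSpace.single i 1)
      + weakPartial Ω (fun y => β y i) i x * φ x) T := by
    intro i
    refine Integrable.add ?_ (integrableOn_mul_of_memLp_top hTΩ hTm hT.bounded
      (weakPartial_spec (hβ i) i).1 hφ.continuous)
    refine (integrableOn_mul_of_memLp_top hTΩ hTm hT.bounded (hβ i).1 (hdφ i)).congr ?_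
    filter_upwards [haeT] with x hx
    rw [hx]
  have hinner : ∀ x, ⟪trace Ω β x, outwardNormal T x⟫ * φ x
      = ∑ i, trace Ω β x i * φ x * outwardNormal T x i := by
    intro x
    rw [PiLp.inner_apply, Finset.sum_mul]
    refine Finset.sum_congr rfl fun i _ => ?_
    simp only [RCLike.inner_apply, conj_trivial]
    ring
  simp_rw [hinner]
  refine ⟨integrable_finsetSum _ fun i _ => (key i).1, ?_⟩
  rw [integral_finsetSum _ fun i _ => (key i).1, ← Finset.sum_congr rfl fun i _ => (key i).2,
    ← integral_finsetSum _ fun i _ => hInt i]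
  refine integral_congr_ae ?_
  filter_upwards [haeT] with x hx
  rw [Finset.sum_add_distrib, hx, weakDiv, Finset.sum_mul, PiLp.inner_apply]
  congr 1
  refine Finset.sum_congr rfl fun i _ => ?_
  rw [fderiv_single_eq_gradient]
  simp only [RCLike.inner_apply, conj_trivial]
  ring

theorem gradient_sq {d : ℕ} (q : MvPolynomial (Fin d) ℝ) (x : Space d) :
    gradient (fun y => pol q y ^ 2) x = (2 * pol q x) • gradient (pol q) x := by
  have h := ((contDiff_pol q).differentiable (by simp) x).hasGradientAt
  refine HasGradientAt.gradient ?_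
  rw [hasGradientAt_iff_hasFDerivAt] at h ⊢
  refine (h.pow 2).congr_fderiv ?_
  rw [map_smul]
  simp

theorem gradient_congr_of_isOpen {d : ℕ} {T : Set (Space d)} (hT : IsOpen T) {v w : Space d → ℝ}
    (h : ∀ y ∈ T, v y = w y) {x : Space d} (hx : x ∈ T) : gradient v x = gradient w x := by
  unfold gradient
  rw [Filter.EventuallyEq.fderiv_eq (eventually_of_mem (hT.mem_nhds hx) h)]

/-! ### Piecewise polynomials on a mesh: jumps, averages and advective fluxes -/

namespace Mesh

variable {d : ℕ} {Ω : Set (Space d)} {HΩ : HyperplaneFamily d}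

/-- `v` agrees on every element `T` with the polynomial `q T`. -/
def IsPiecewise (M : Mesh Ω) (v : Space d → ℝ) (q : Set (Space d) → MvPolynomial (Fin d) ℝ) :
    Prop := ∀ T ∈ M.elems, ∀ x ∈ T, v x = pol (q T) x

variable {v : Space d → ℝ} {q : Set (Space d) → MvPolynomial (Fin d) ℝ}

theorem mem_closure_of_adjacent (M : Mesh Ω) {e T : Set (Space d)} (hT : T ∈ M.adjacent e)
    {x : Space d} (hx : x ∈ e) : x ∈ closure T :=
  frontier_subset_closure ((M.mem_adjacent.1 hT).2 hx)

theorem trace_eq_pol (M : Mesh Ω) (hd : 2 ≤ d) (hv : M.IsPiecewise v q) {e T : Set (Space d)}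
    (hT : T ∈ M.adjacent e) {x : Space d} (hx : x ∈ e) : trace T v x = pol (q T) x :=
  trace_eq_of_eqOn (M.elem_isOpen hd (M.mem_adjacent.1 hT).1) (M.mem_closure_of_adjacent hT hx)
    (continuous_pol _) (hv T (M.mem_adjacent.1 hT).1)

theorem jump_interior (M : Mesh Ω) (hd : 2 ≤ d) (hv : M.IsPiecewise v q) {e T₁ T₂ : Set (Space d)}
    (he : e ∈ M.facets) (hne : T₁ ≠ T₂) (hadj : M.adjacent e = {T₁, T₂}) :
    ∀ᵐ x ∂(μHE[d - 1] : Measure (Space d)), x ∈ e →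
      M.jump e v x = (pol (q T₁) x - pol (q T₂) x) • outwardNormal T₁ x := by
  have h1 : T₁ ∈ M.adjacent e := by rw [hadj]; simp
  have h2 : T₂ ∈ M.adjacent e := by rw [hadj]; simp
  filter_upwards [M.facet_ae_normal_neg hd he h2 h1 hne.symm] with x hn hx
  rw [jump, hadj, Finset.sum_pair hne, M.trace_eq_pol hd hv h1 hx, M.trace_eq_pol hd hv h2 hx,
    hn hx, smul_neg, sub_smul, sub_eq_add_neg]

theorem jump_boundary (M : Mesh Ω) (hd : 2 ≤ d) (hv : M.IsPiecewise v q) {e T : Set (Space d)}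
    (hadj : M.adjacent e = {T}) {x : Space d} (hx : x ∈ e) :
    M.jump e v x = pol (q T) x • outwardNormal T x := by
  rw [jump, hadj, Finset.sum_singleton, M.trace_eq_pol hd hv (by rw [hadj]; simp) hx]

theorem avg_boundary {F : Type*} [NormedAddCommGroup F] [NormedSpace ℝ F] (M : Mesh Ω)
    {e T : Set (Space d)} (hadj : M.adjacent e = {T}) (f : Space d → F) (x : Space d) :
    M.avg e f x = trace T f x := by
  simp [avg, hadj]

theorem avg_interior {F : Type*} [NormedAddCommGroup F] [NormedSpace ℝ F] (M : Mesh Ω)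
    {e T₁ T₂ : Set (Space d)} (hne : T₁ ≠ T₂) (hadj : M.adjacent e = {T₁, T₂}) (f : Space d → F)
    (x : Space d) : M.avg e f x = (2 : ℝ)⁻¹ • (trace T₁ f x + trace T₂ f x) := by
  rw [avg, hadj, Finset.sum_pair hne, Finset.card_pair hne]
  norm_num

theorem avg_boundary_pol (M : Mesh Ω) (hd : 2 ≤ d) (hv : M.IsPiecewise v q) {e T : Set (Space d)}
    (hadj : M.adjacent e = {T}) {x : Space d} (hx : x ∈ e) : M.avg e v x = pol (q T) x := by
  rw [M.avg_boundary hadj, M.trace_eq_pol hd hv (by rw [hadj]; simp) hx]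

theorem trace_smul_field (M : Mesh Ω) (hd : 2 ≤ d) (hΩ : PolyDomain Ω HΩ) {β : Space d → Space d}
    (hβ : ∀ j, MemW1Infty Ω (fun x => β x j)) (hv : M.IsPiecewise v q) {e T : Set (Space d)}
    (hT : T ∈ M.adjacent e) :
    ∀ᵐ x ∂(μHE[d - 1] : Measure (Space d)), x ∈ e →
      trace T (fun y => v y • β y) x = pol (q T) x • trace Ω β x := by
  have hT' := M.mem_adjacent.1 hT
  filter_upwards [M.ae_exists_convex hd hΩ hT'.1] with x hc hx
  exact trace_smul_eq hΩ.isOpen hβ (M.elem_isOpen hd hT'.1) (M.elem_subset hd hΩ hT'.1)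
    (M.mem_closure_of_adjacent hT hx) (hc (hT'.2 hx)) (continuous_pol _) (hv T hT'.1)

/-- Gauss-Green with the test function `q²`, whose gradient is `2 q ∇q`: this trades the advection
integral for a divergence and a boundary flux. -/
theorem gauss_green_sq (M : Mesh Ω) (hd : 2 ≤ d) (hΩ : PolyDomain Ω HΩ) {β : Space d → Space d}
    (hβ : ∀ j, MemW1Infty Ω (fun x => β x j)) {T : Set (Space d)} (hT : T ∈ M.elems)
    (q : MvPolynomial (Fin d) ℝ) :
    IntegrableOn (fun x => ⟪trace Ω β x, outwardNormal T x⟫ * pol q x ^ 2) (frontier T)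
      μHE[d - 1] ∧
    ∫ x in T, (2 * ⟪pol q x • β x, gradient (pol q) x⟫ + weakDiv Ω β x * pol q x ^ 2)
      = ∑ e ∈ M.facetsOf T,
        ∫ x in e, ⟪trace Ω β x, outwardNormal T x⟫ * pol q x ^ 2 ∂μHE[d - 1] := by
  obtain ⟨H, hPD⟩ := M.exists_polyDomain hd hT
  obtain ⟨h1, h2⟩ := hPD.gauss_green_field hΩ.isOpen (M.elem_subset hd hΩ hT) hβ
    (M.ae_exists_convex hd hΩ hT) (φ := fun x => pol q x ^ 2) ((contDiff_pol q).pow 2)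
  refine ⟨h1, ?_⟩
  rw [← M.setIntegral_frontier hT h1, ← h2]
  refine integral_congr_ae (Eventually.of_forall fun x => ?_)
  simp only [gradient_sq, real_inner_smul_left, real_inner_smul_right]
  ring

/-- On an interior facet the central flux cancels the boundary terms of the adjacent elements. -/
theorem interior_flux (M : Mesh Ω) (hd : 2 ≤ d) (hΩ : PolyDomain Ω HΩ) {β : Space d → Space d}
    (hβ : ∀ j, MemW1Infty Ω (fun x => β x j)) (hv : M.IsPiecewise v q) {e : Set (Space d)}
    (he : e ∈ M.interiorFacets) :
    ∫ x in e, ⟪M.avg e (fun y => v y • β y) x, M.jump e v x⟫ ∂μHE[d - 1]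
      = 1 / 2 * ∑ T ∈ M.adjacent e,
        ∫ x in e, ⟪trace Ω β x, outwardNormal T x⟫ * pol (q T) x ^ 2 ∂μHE[d - 1] := by
  have hef := M.interior_mem_facets he
  have hem := (M.facet_isClosed hef).measurableSet
  obtain ⟨T₁, T₂, hne, hadj⟩ := M.interior_adjacent hd he
  have h1 : T₁ ∈ M.adjacent e := by rw [hadj]; simp
  have h2 : T₂ ∈ M.adjacent e := by rw [hadj]; simp
  rw [← integral_finsetSum _ fun T hT => ((M.gauss_green_sq hd hΩ hβ (M.mem_adjacent.1 hT).1
    (q T)).1.mono_set (M.mem_adjacent.1 hT).2), ← integral_const_mul]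
  refine setIntegral_congr_ae hem ?_
  filter_upwards [M.jump_interior hd hv hef hne hadj, M.trace_smul_field hd hΩ hβ hv h1,
    M.trace_smul_field hd hΩ hβ hv h2, M.facet_ae_normal_neg hd hef h2 h1 hne.symm]
    with x hj ht1 ht2 hn hx
  -- The normals being opposite, the cancellation is `(a + b) * (a - b) = a ^ 2 - b ^ 2`, and the
  -- average supplies the factor `1 / 2`.
  rw [hj hx, M.avg_interior hne hadj, ht1 hx, ht2 hx, hadj, Finset.sum_pair hne, hn hx,
    ← add_smul, smul_smul, real_inner_smul_left, real_inner_smul_right, inner_neg_right]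
  ring

theorem norm_jump_sq_boundary (M : Mesh Ω) (hd : 2 ≤ d) (hv : M.IsPiecewise v q)
    {e T : Set (Space d)} (he : e ∈ M.facets) (hadj : M.adjacent e = {T}) :
    ∀ᵐ x ∂(μHE[d - 1] : Measure (Space d)), x ∈ e → ‖M.jump e v x‖ ^ 2 = pol (q T) x ^ 2 := by
  filter_upwards [M.facet_ae_normal hd he (T := T) (by rw [hadj]; simp)] with x h1 hx
  rw [M.jump_boundary hd hv hadj hx, norm_smul, (h1 hx).1.1, mul_one, Real.norm_eq_abs, sq_abs]

theorem abs_inner_normal (M : Mesh Ω) (hd : 2 ≤ d) {e T : Set (Space d)} (he : e ∈ M.facets)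
    (hT : T ∈ M.adjacent e) (b : Space d → Space d) :
    ∀ᵐ x ∂(μHE[d - 1] : Measure (Space d)), x ∈ e →
      |⟪b x, M.normal e⟫| = |⟪b x, outwardNormal T x⟫| := by
  filter_upwards [M.facet_ae_normal hd he hT] with x h1 hx
  rcases (h1 hx).2 with h | h <;> rw [h]
  rw [inner_neg_right, abs_neg]

/-- With a single adjacent element nothing is averaged, so the factor is `1` where interior facets
have `1 / 2`. -/
theorem boundary_flux (M : Mesh Ω) (hd : 2 ≤ d) (hΩ : PolyDomain Ω HΩ) {β : Space d → Space d}
    (hβ : ∀ j, MemW1Infty Ω (fun x => β x j)) (hv : M.IsPiecewise v q) {e : Set (Space d)}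
    (he : e ∈ M.boundaryFacets) :
    ∫ x in e, ⟪M.avg e (fun y => v y • β y) x, outwardNormal Ω x⟫ * M.avg e v x ∂μHE[d - 1]
      = ∑ T ∈ M.adjacent e,
        ∫ x in e, ⟪trace Ω β x, outwardNormal T x⟫ * pol (q T) x ^ 2 ∂μHE[d - 1] := by
  have hef := M.boundary_mem_facets he
  have hem := (M.facet_isClosed hef).measurableSet
  obtain ⟨T, hadj⟩ := M.boundary_adjacent hd hΩ he
  have h1 : T ∈ M.adjacent e := by rw [hadj]; simp
  rw [hadj, Finset.sum_singleton]
  refine setIntegral_congr_ae hem ?_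
  filter_upwards [M.trace_smul_field hd hΩ hβ hv h1,
    M.boundary_ae_normal hd hΩ hef (M.boundary_subset he) h1] with x ht hn hx
  rw [M.avg_boundary hadj, M.avg_boundary_pol hd hv hadj hx, ht hx, (hn hx).2,
    real_inner_smul_left]
  ring

/-- Here `s` is the sign of `β · n`: `-1` on the Dirichlet part and `1` on the Neumann part. The
arbitrary orientation of the facet normal is lost in the absolute value. -/
theorem boundary_upwind (M : Mesh Ω) (hd : 2 ≤ d) (hΩ : PolyDomain Ω HΩ) {β : Space d → Space d}
    (hv : M.IsPiecewise v q) {e : Set (Space d)}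
    (he : e ∈ M.boundaryFacets) {s : ℝ} (hs : ∀ᵐ x ∂(μHE[d - 1] : Measure (Space d)), x ∈ e →
      |⟪trace Ω β x, outwardNormal Ω x⟫| = s * ⟪trace Ω β x, outwardNormal Ω x⟫) :
    ∫ x in e, |⟪trace Ω β x, M.normal e⟫| * ‖M.jump e v x‖ ^ 2 ∂μHE[d - 1]
      = s * ∑ T ∈ M.adjacent e,
        ∫ x in e, ⟪trace Ω β x, outwardNormal T x⟫ * pol (q T) x ^ 2 ∂μHE[d - 1] := by
  have hef := M.boundary_mem_facets he
  have hem := (M.facet_isClosed hef).measurableSet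
  obtain ⟨T, hadj⟩ := M.boundary_adjacent hd hΩ he
  have h1 : T ∈ M.adjacent e := by rw [hadj]; simp
  rw [hadj, Finset.sum_singleton, ← integral_const_mul]
  refine setIntegral_congr_ae hem ?_
  filter_upwards [hs, M.norm_jump_sq_boundary hd hv hef hadj,
    M.abs_inner_normal hd hef h1 (trace Ω β),
    M.boundary_ae_normal hd hΩ hef (M.boundary_subset he) h1] with x hs hj ha hn hx
  rw [ha hx, hj hx, ← (hn hx).2, hs hx, mul_assoc]

theorem trace_eq_zero_of_ae {d : ℕ} {Ω : Set (Space d)} (hΩ : IsOpen Ω) {β : Space d → Space d}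
    (h : β =ᵐ[volume.restrict Ω] 0) {x : Space d} (hx : x ∈ closure Ω) : trace Ω β x = 0 :=
  trace_eq_of_ae_eq hΩ hx (F := fun _ => 0) continuous_const one_pos
    (ae_mono (Measure.restrict_mono inter_subset_right le_rfl) h)

theorem ae_abs_flow (hΩ : IsOpen Ω) {β : Space d → Space d} {ΓD ΓN : Set (Space d)}
    (hflow : ¬ β =ᵐ[volume.restrict Ω] 0 →
      ∀ᵐ x ∂((μHE[d - 1] : Measure (Space d)).restrict (frontier Ω)),
        (x ∈ ΓD → ⟪trace Ω β x, outwardNormal Ω x⟫ < 0) ∧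
        (x ∈ ΓN → 0 ≤ ⟪trace Ω β x, outwardNormal Ω x⟫)) :
    ∀ᵐ x ∂(μHE[d - 1] : Measure (Space d)), x ∈ frontier Ω →
      (x ∈ ΓD → |⟪trace Ω β x, outwardNormal Ω x⟫| = -1 * ⟪trace Ω β x, outwardNormal Ω x⟫) ∧
      (x ∈ ΓN → |⟪trace Ω β x, outwardNormal Ω x⟫| = 1 * ⟪trace Ω β x, outwardNormal Ω x⟫) := by
  by_cases h0 : β =ᵐ[volume.restrict Ω] 0
  · refine Eventually.of_forall fun x hx => ?_
    rw [trace_eq_zero_of_ae hΩ h0 (frontier_subset_closure hx)]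
    simp
  · filter_upwards [(ae_restrict_iff' isClosed_frontier.measurableSet).1 (hflow h0)] with x h hx
    refine ⟨fun hD => ?_, fun hN => ?_⟩
    · rw [abs_of_neg ((h hx).1 hD)]; ring
    · rw [abs_of_nonneg ((h hx).2 hN)]; ring

/-- Coercivity of the advection-reaction form. -/
theorem aAdvReac_coercive (M : Mesh Ω) (hd : 2 ≤ d) (hΩ : PolyDomain Ω HΩ)
    {ΓD ΓN : Set (Space d)} (hdisj : Disjoint ΓD ΓN) {β : Space d → Space d} {σ : Space d → ℝ}
    (hβ : ∀ j, MemW1Infty Ω (fun x => β x j)) (hσ : MemLp σ ∞ (volume.restrict Ω)) {σ₀ : ℝ}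
    (hdiv : ∀ᵐ x ∂(volume.restrict Ω), σ₀ ≤ σ x + 1 / 2 * weakDiv Ω β x)
    (hflow : ¬ β =ᵐ[volume.restrict Ω] 0 →
      ∀ᵐ x ∂((μHE[d - 1] : Measure (Space d)).restrict (frontier Ω)),
        (x ∈ ΓD → ⟪trace Ω β x, outwardNormal Ω x⟫ < 0) ∧
        (x ∈ ΓN → 0 ≤ ⟪trace Ω β x, outwardNormal Ω x⟫))
    (hDN : ∀ e ∈ M.boundaryFacets, e ∈ M.boundaryFacetsOn ΓD ∨ e ∈ M.boundaryFacetsOn ΓN)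
    (hv : M.IsPiecewise v q) :
    σ₀ * (∫ x in Ω, v x ^ 2) + 1 / 2 * ∑ e ∈ M.facets,
      (∫ x in e, |⟪trace Ω β x, M.normal e⟫| * ‖M.jump e v x‖ ^ 2 ∂μHE[d - 1])
      ≤ M.aAdvReac β σ ΓN v v := by
  have hTm : ∀ T ∈ M.elems, MeasurableSet T := fun T hT => (M.elem_isOpen hd hT).measurableSet
  set B : Set (Space d) → ℝ := fun e => ∑ T ∈ M.adjacent e,
        ∫ x in e, ⟪trace Ω β x, outwardNormal T x⟫ * pol (q T) x ^ 2 ∂μHE[d - 1] with hB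
  -- Half of `gauss_green_sq` turns the advection integral into half a divergence, and `hdiv` bounds
  -- the resulting zero-order coefficient below by `σ₀`.
  have hvol : ∀ T ∈ M.elems, σ₀ * (∫ x in T, v x ^ 2) ≤
      - (∫ x in T, ⟪v x • β x, gradient v x⟫) + (∫ x in T, σ x * v x * v x)
        + 1 / 2 * ∑ e ∈ M.facetsOf T,
          ∫ x in e, ⟪trace Ω β x, outwardNormal T x⟫ * pol (q T) x ^ 2 ∂μHE[d - 1] := by
    intro T hT
    have hsub := M.elem_subset hd hΩ hT
    have hbd := M.elem_bounded hd hT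
    have hq2 : Continuous fun x => pol (q T) x ^ 2 := (continuous_pol _).pow 2
    have i1 : IntegrableOn (fun x => pol (q T) x ^ 2) T := integrableOn_of_continuous hbd hq2
    have i2 : IntegrableOn (fun x => σ x * pol (q T) x ^ 2) T :=
      integrableOn_mul_of_memLp_top hsub (hTm T hT) hbd hσ hq2
    have i3 : IntegrableOn (fun x => weakDiv Ω β x * pol (q T) x ^ 2) T := by
      simp only [weakDiv, Finset.sum_mul]
      exact integrable_finsetSum _ fun i _ => integrableOn_mul_of_memLp_top hsub (hTm T hT) hbd
        (weakPartial_spec (hβ i) i).1 hq2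
    have i4 : IntegrableOn (fun x => ⟪pol (q T) x • β x, gradient (pol (q T)) x⟫) T := by
      have : ∀ x, ⟪pol (q T) x • β x, gradient (pol (q T)) x⟫
          = ∑ i, β x i * (pol (q T) x * gradient (pol (q T)) x i) := by
        intro x
        rw [real_inner_smul_left, PiLp.inner_apply, Finset.mul_sum]
        refine Finset.sum_congr rfl fun i _ => ?_
        simp only [RCLike.inner_apply, conj_trivial]
        ring
      simp_rw [this]
      exact integrable_finsetSum _ fun i _ => integrableOn_mul_of_memLp_top hsub (hTm T hT) hbd
        (hβ i).1 ((continuous_pol _).mul ((EuclideanSpace.proj (𝕜 := ℝ) i).continuous.comp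
          (continuous_gradient_pol _)))
    have e1 : ∫ x in T, v x ^ 2 = ∫ x in T, pol (q T) x ^ 2 :=
      setIntegral_congr_fun (hTm T hT) fun x hx => by simp only [hv T hT x hx]
    have e2 : ∫ x in T, ⟪v x • β x, gradient v x⟫
        = ∫ x in T, ⟪pol (q T) x • β x, gradient (pol (q T)) x⟫ :=
      setIntegral_congr_fun (hTm T hT) fun x hx => by
        simp only [hv T hT x hx,
          gradient_congr_of_isOpen (M.elem_isOpen hd hT) (hv T hT) hx]
    have e3 : ∫ x in T, σ x * v x * v x = ∫ x in T, σ x * pol (q T) x ^ 2 :=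
      setIntegral_congr_fun (hTm T hT) fun x hx => by simp only [hv T hT x hx]; ring
    rw [e1, e2, e3, ← (M.gauss_green_sq hd hΩ hβ hT (q T)).2, integral_add (i4.const_mul 2) i3,
      integral_const_mul]
    have hle : ∫ x in T, σ₀ * pol (q T) x ^ 2
        ≤ ∫ x in T, (σ x * pol (q T) x ^ 2 + 1 / 2 * (weakDiv Ω β x * pol (q T) x ^ 2)) := by
      refine integral_mono_ae (i1.const_mul _) (i2.add (i3.const_mul _)) ?_
      filter_upwards [ae_mono (Measure.restrict_mono hsub le_rfl) hdiv] with x hx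
      have := mul_le_mul_of_nonneg_right hx (sq_nonneg (pol (q T) x))
      linarith
    rw [integral_const_mul, integral_add i2 (i3.const_mul _), integral_const_mul] at hle
    linarith
  have hΩint : ∫ x in Ω, v x ^ 2 = ∑ T ∈ M.elems, ∫ x in T, v x ^ 2 := by
    refine M.setIntegral_domain hd hΩ fun T hT => ?_
    refine IntegrableOn.congr_fun (integrableOn_of_continuous (M.elem_bounded hd hT)
      ((continuous_pol (q T)).pow 2)) (fun x hx => ?_) (hTm T hT)
    simp only [hv T hT x hx, Pi.pow_apply]
  have hvsum := Finset.sum_le_sum hvol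
  rw [Finset.sum_add_distrib, Finset.sum_add_distrib, Finset.sum_neg_distrib, ← Finset.mul_sum,
    ← Finset.mul_sum, ← hΩint, M.sum_elems_facetsOf, M.sum_facets hd hΩ,
    M.sum_boundaryFacets hd hdisj hDN] at hvsum
  have hflow' := ae_abs_flow hΩ.isOpen hflow
  have hD : ∀ e ∈ M.boundaryFacetsOn ΓD,
      ∫ x in e, |⟪trace Ω β x, M.normal e⟫| * ‖M.jump e v x‖ ^ 2 ∂μHE[d - 1] = -1 * B e := by
    intro e he
    have heb := (M.mem_boundaryFacetsOn.1 he).1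
    refine M.boundary_upwind hd hΩ hv heb ?_
    filter_upwards [hflow', M.boundaryOn_ae_mem he] with x h1 h2 hx
    exact (h1 (M.boundary_subset heb hx)).1 (h2 hx)
  have hN : ∀ e ∈ M.boundaryFacetsOn ΓN,
      ∫ x in e, |⟪trace Ω β x, M.normal e⟫| * ‖M.jump e v x‖ ^ 2 ∂μHE[d - 1] = 1 * B e := by
    intro e he
    have heb := (M.mem_boundaryFacetsOn.1 he).1
    refine M.boundary_upwind hd hΩ hv heb ?_
    filter_upwards [hflow', M.boundaryOn_ae_mem he] with x h1 h2 hx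
    exact (h1 (M.boundary_subset heb hx)).2 (h2 hx)
  have hNf : ∀ e ∈ M.boundaryFacetsOn ΓN,
      ∫ x in e, ⟪M.avg e (fun y => v y • β y) x, outwardNormal Ω x⟫ * M.avg e v x ∂μHE[d - 1]
        = B e := fun e he => M.boundary_flux hd hΩ hβ hv (M.mem_boundaryFacetsOn.1 he).1
  have hI : ∀ e ∈ M.interiorFacets,
      ∫ x in e, ⟪M.avg e (fun y => v y • β y) x, M.jump e v x⟫ ∂μHE[d - 1] = 1 / 2 * B e :=
    fun e he => M.interior_flux hd hΩ hβ hv he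
  -- The element estimates contribute `-B e / 2` on every facet. The form adds `B e / 2` on interior
  -- facets, `B e` on Neumann facets and nothing on Dirichlet facets. This leaves `0`, `B e / 2` and
  -- `-B e / 2`; by `hN` and `hD` the last two are half the upwind integrals.
  rw [aAdvReac, M.sum_facets hd hΩ, M.sum_boundaryFacets hd hdisj hDN, Finset.sum_congr rfl hD,
    Finset.sum_congr rfl hN, Finset.sum_congr rfl hNf, Finset.sum_congr rfl hI,
    ← Finset.mul_sum, ← Finset.mul_sum, ← Finset.mul_sum]
  simp only [real_inner_self_eq_norm_sq]
  linarith

end Mesh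

/-! ### Coercivity of the diffusion form -/

theorem integrableOn_hausdorff_of_continuous {d : ℕ} {e : Set (Space d)} (hem : MeasurableSet e)
    (hb : Bornology.IsBounded e) (he : μHE[d - 1] e < ⊤) {f : Space d → ℝ} (hf : Continuous f) :
    IntegrableOn f e μHE[d - 1] := by
  obtain ⟨C, hC⟩ := exists_bound_of_continuous hb hf
  exact Measure.integrableOn_of_bounded he.ne hf.aestronglyMeasurable
    (ae_restrict_of_forall_mem hem fun x hx => hC x hx)

/-- The right weight is `s = c⁻¹`. For `c = 0` it is infinite; there the value `(J + 1) / (2 * X)`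
already contradicts `X > 0`. -/
theorem two_mul_le_of_young {A J c X : ℝ} (hc : 0 ≤ c)
    (h : ∀ s : ℝ, 0 < s → 2 * X ≤ s * c ^ 2 * A + s⁻¹ * J) (hJ : 0 ≤ J) :
    2 * X ≤ c * (A + J) := by
  rcases hc.eq_or_lt with rfl | hc
  · by_contra hX
    simp only [zero_mul, not_le] at hX
    have h1 := h ((J + 1) / (2 * X)) (by positivity)
    rw [inv_div] at h1
    have h2 : 2 * X ≤ 2 * X * (J / (J + 1)) := by
      calc 2 * X ≤ _ := h1
        _ = _ := by ring
    have h3 : J / (J + 1) < 1 := by rw [div_lt_one (by positivity)]; linarith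
    nlinarith
  · have h1 := h c⁻¹ (by positivity)
    have h2 : c⁻¹ * c ^ 2 = c := by field_simp
    rw [h2, inv_inv] at h1
    linarith

theorem integrableOn_inner_clm {d : ℕ} {Ω T : Set (Space d)} (hTΩ : T ⊆ Ω)
    (hT : Bornology.IsBounded T) {K : Space d → Space d →L[ℝ] Space d}
    (hK : MemLp K ∞ (volume.restrict Ω)) {G : Space d → Space d} (hG : Continuous G) :
    IntegrableOn (fun x => ⟪K x (G x), G x⟫) T := by
  have hKT := hK.mono_measure (Measure.restrict_mono hTΩ le_rfl)
  have hmeas : AEStronglyMeasurable (fun x => K x (G x)) (volume.restrict T) :=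
    (isBoundedBilinearMap_apply (𝕜 := ℝ) (E := Space d) (F := Space d)).continuous
      |>.comp_aestronglyMeasurable (hKT.1.prodMk hG.aestronglyMeasurable)
  refine Integrable.mono' (g := fun x => (eLpNorm K ∞ (volume.restrict T)).toReal * ‖G x‖ ^ 2)
    ((integrableOn_of_continuous hT (hG.norm.pow 2)).const_mul _)
    (hmeas.inner hG.aestronglyMeasurable) ?_
  filter_upwards [ae_norm_le_of_memLp_top hKT] with x hx
  calc ‖⟪K x (G x), G x⟫‖ ≤ ‖K x (G x)‖ * ‖G x‖ := norm_inner_le_norm _ _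
    _ ≤ ‖K x‖ * ‖G x‖ * ‖G x‖ := by gcongr; exact (K x).le_opNorm _
    _ ≤ _ := by rw [mul_assoc, ← sq]; gcongr

namespace Mesh

variable {d : ℕ} {Ω : Set (Space d)} {HΩ : HyperplaneFamily d}
variable {v : Space d → ℝ} {q : Set (Space d) → MvPolynomial (Fin d) ℝ}

theorem integrableOn_frontier (M : Mesh Ω) (hd : 2 ≤ d) {T : Set (Space d)} (hT : T ∈ M.elems)
    {f : Space d → ℝ} (hf : Continuous f) : IntegrableOn f (frontier T) μHE[d - 1] := by
  obtain ⟨H, hPD⟩ := M.exists_polyDomain hd hT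
  exact integrableOn_hausdorff_of_continuous isClosed_frontier.measurableSet
    (hPD.bounded.closure.subset frontier_subset_closure) hPD.measure_frontier_lt_top hf

theorem integrableOn_facet (M : Mesh Ω) (hd : 2 ≤ d) {e T : Set (Space d)}
    (hT : T ∈ M.adjacent e) {f : Space d → ℝ} (hf : Continuous f) :
    IntegrableOn f e μHE[d - 1] :=
  (M.integrableOn_frontier hd (M.mem_adjacent.1 hT).1 hf).mono_set (M.mem_adjacent.1 hT).2

theorem diam_facet_le (M : Mesh Ω) (hd : 2 ≤ d) {e T : Set (Space d)} (hT : T ∈ M.adjacent e) :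
    diam e ≤ diam T := by
  have h := M.mem_adjacent.1 hT
  rw [← diam_closure T]
  exact diam_mono (h.2.trans frontier_subset_closure) (M.elem_bounded hd h.1).closure

/-- The discrete trace inequality for the gradient, summed over the facets of an element. -/
theorem sum_facetsOf_gradient_le (M : Mesh Ω) (hd : 2 ≤ d) {T : Set (Space d)} (hT : T ∈ M.elems)
    {N p : ℕ} (hN : M.maxFacets ≤ N) {Ctr : ℝ}
    (htr : ∀ q : MvPolynomial (Fin d) ℝ, q.totalDegree ≤ p →
      ∫ x in frontier T, pol q x ^ 2 ∂μHE[d - 1] ≤ Ctr * (diam T)⁻¹ * ∫ x in T, pol q x ^ 2)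
    {q : MvPolynomial (Fin d) ℝ} (hq : q.totalDegree ≤ p) :
    ∑ e ∈ M.facetsOf T, diam e * ∫ x in e, ‖gradient (pol q) x‖ ^ 2 ∂μHE[d - 1]
      ≤ N * Ctr * ∫ x in T, ‖gradient (pol q) x‖ ^ 2 := by
  have hpos : 0 < diam T :=
    diam_pos_of_isOpen (by omega) (M.elem_isOpen hd hT) (M.elem_bounded hd hT)
      (M.exists_polyDomain hd hT).choose_spec.nonempty
  have hc2 : ∀ i, Continuous fun x => pol (MvPolynomial.pderiv i q) x ^ 2 := fun i =>
    (continuous_pol _).pow 2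
  -- Each partial derivative has degree at most `p`, so the trace inequality applies to every
  -- component of the gradient.
  have hbd : ∫ x in frontier T, ‖gradient (pol q) x‖ ^ 2 ∂μHE[d - 1]
      ≤ Ctr * (diam T)⁻¹ * ∫ x in T, ‖gradient (pol q) x‖ ^ 2 := by
    simp_rw [norm_sq_gradient_pol]
    rw [integral_finsetSum _ fun i _ => M.integrableOn_frontier hd hT (hc2 i),
      integral_finsetSum _ fun i _ => integrableOn_of_continuous (M.elem_bounded hd hT) (hc2 i),
      Finset.mul_sum]
    exact Finset.sum_le_sum fun i _ => htr _ ((totalDegree_pderiv_le q i).trans hq)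
  have hcg : Continuous fun x => ‖gradient (pol q) x‖ ^ 2 := (continuous_gradient_pol q).norm.pow 2
  have hI0 : 0 ≤ ∫ x in frontier T, ‖gradient (pol q) x‖ ^ 2 ∂μHE[d - 1] :=
    integral_nonneg fun x => sq_nonneg _
  -- Each facet integral is bounded by the integral over the whole boundary; summing costs the
  -- number of facets, which is where the factor `N` comes from.
  have hterm : ∀ e ∈ M.facetsOf T, diam e * ∫ x in e, ‖gradient (pol q) x‖ ^ 2 ∂μHE[d - 1]
      ≤ diam T * ∫ x in frontier T, ‖gradient (pol q) x‖ ^ 2 ∂μHE[d - 1] := by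
    intro e he
    rw [mem_facetsOf] at he
    refine mul_le_mul (M.diam_facet_le hd (M.mem_adjacent.2 ⟨hT, he.2⟩)) ?_
      (integral_nonneg fun x => sq_nonneg _) diam_nonneg
    exact setIntegral_mono_set (M.integrableOn_frontier hd hT hcg)
      (Eventually.of_forall fun x => sq_nonneg _) (LE.le.eventuallyLE he.2)
  refine (Finset.sum_le_card_nsmul _ _ _ hterm).trans ?_
  have hcard : ((M.facetsOf T).card : ℝ) ≤ N := by
    exact_mod_cast (Finset.le_sup (f := fun T => (M.facetsOf T).card) hT).trans hN
  rw [nsmul_eq_mul, mul_assoc]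
  refine mul_le_mul hcard ?_ (by positivity) (by positivity)
  calc diam T * ∫ x in frontier T, ‖gradient (pol q) x‖ ^ 2 ∂μHE[d - 1]
      ≤ diam T * (Ctr * (diam T)⁻¹ * ∫ x in T, ‖gradient (pol q) x‖ ^ 2) := by gcongr
    _ = _ := by field_simp

theorem norm_trace_flux_le (M : Mesh Ω) (hd : 2 ≤ d) (hΩ : PolyDomain Ω HΩ)
    {K : Space d → Space d →L[ℝ] Space d} (hK : MemLp K ∞ (volume.restrict Ω))
    (hKtrace : ∀ T ∈ M.elems, ∀ᵐ x ∂((μHE[d - 1] : Measure (Space d)).restrict (frontier T)),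
      ∃ a, HasTraceAt T K x a)
    (hv : M.IsPiecewise v q) {e T : Set (Space d)} (hT : T ∈ M.adjacent e) :
    ∀ᵐ x ∂(μHE[d - 1] : Measure (Space d)), x ∈ e →
      ‖trace T (fun y => K y (gradient v y)) x‖
        ≤ linftyNorm Ω K * ‖gradient (pol (q T)) x‖ := by
  have h := M.mem_adjacent.1 hT
  have hsub := Measure.restrict_mono (μ := (volume : Measure (Space d)))
    (M.elem_subset hd hΩ h.1) le_rfl
  filter_upwards [(ae_restrict_iff' isClosed_frontier.measurableSet).1 (hKtrace T h.1)]
    with x hx hxe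
  exact norm_trace_clm_le (M.elem_isOpen hd h.1) (M.mem_closure_of_adjacent hT hxe)
    (hK.mono_measure hsub) ENNReal.toReal_nonneg (ae_mono hsub (ae_norm_le_of_memLp_top hK))
    (hx (h.2 hxe)) (continuous_gradient_pol _)
    fun y hy => gradient_congr_of_isOpen (M.elem_isOpen hd h.1) (hv T h.1) hy

/-- Cauchy-Schwarz gains a factor `1 / n` for `n` adjacent elements; dropping it lets interior and
boundary facets share one bound. -/
theorem norm_avg_flux_sq_le (M : Mesh Ω) (hd : 2 ≤ d) (hΩ : PolyDomain Ω HΩ)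
    {K : Space d → Space d →L[ℝ] Space d} (hK : MemLp K ∞ (volume.restrict Ω))
    (hKtrace : ∀ T ∈ M.elems, ∀ᵐ x ∂((μHE[d - 1] : Measure (Space d)).restrict (frontier T)),
      ∃ a, HasTraceAt T K x a)
    (hv : M.IsPiecewise v q) (e : Set (Space d)) :
    ∀ᵐ x ∂(μHE[d - 1] : Measure (Space d)), x ∈ e →
      ‖M.avg e (fun y => K y (gradient v y)) x‖ ^ 2
        ≤ linftyNorm Ω K ^ 2 * ∑ T ∈ M.adjacent e, ‖gradient (pol (q T)) x‖ ^ 2 := by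
  have hall : ∀ᵐ x ∂(μHE[d - 1] : Measure (Space d)), ∀ T ∈ M.adjacent e, x ∈ e →
      ‖trace T (fun y => K y (gradient v y)) x‖
        ≤ linftyNorm Ω K * ‖gradient (pol (q T)) x‖ := by
    rw [Finset.eventually_all]
    exact fun T hT => M.norm_trace_flux_le hd hΩ hK hKtrace hv hT
  filter_upwards [hall] with x hx hxe
  set n : ℝ := ((M.adjacent e).card : ℝ) with hn
  set S := ∑ T ∈ M.adjacent e, ‖trace T (fun y => K y (gradient v y)) x‖ ^ 2 with hS
  have hS0 : 0 ≤ S := Finset.sum_nonneg fun T _ => sq_nonneg _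
  have h1 : S ≤ linftyNorm Ω K ^ 2 * ∑ T ∈ M.adjacent e, ‖gradient (pol (q T)) x‖ ^ 2 := by
    rw [Finset.mul_sum]
    refine Finset.sum_le_sum fun T hT => ?_
    rw [← mul_pow]
    exact pow_le_pow_left₀ (norm_nonneg _) (hx T hT hxe) 2
  refine le_trans ?_ h1
  have h2 : ‖∑ T ∈ M.adjacent e, trace T (fun y => K y (gradient v y)) x‖ ^ 2 ≤ n * S :=
    (pow_le_pow_left₀ (norm_nonneg _) (norm_sum_le _ _) 2).trans sq_sum_le_card_mul_sum_sq
  rw [avg, norm_smul, mul_pow, ← hn]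
  rcases (M.adjacent e).eq_empty_or_nonempty with h0 | h0
  · simp [hn, h0, hS0]
  · have hn1 : 1 ≤ n := Nat.one_le_cast.2 (Finset.card_pos.2 h0)
    have hnn : ‖n⁻¹‖ ^ 2 = (n * n)⁻¹ := by
      rw [Real.norm_eq_abs, sq_abs, inv_pow, sq]
    rw [hnn, inv_mul_le_iff₀ (by positivity)]
    refine h2.trans ?_
    nlinarith [mul_nonneg (mul_nonneg (by linarith : (0:ℝ) ≤ n) hS0) (sub_nonneg.2 hn1)]

/-- A single estimate serves both kinds of facet, `w` being the norm of the jump or the boundary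
value. No measurability of `f` is required, as a non-integrable `f` has integral zero. -/
theorem facet_young (M : Mesh Ω) (hd : 2 ≤ d) (hΩ : PolyDomain Ω HΩ)
    {K : Space d → Space d →L[ℝ] Space d} (hK : MemLp K ∞ (volume.restrict Ω))
    (hKtrace : ∀ T ∈ M.elems, ∀ᵐ x ∂((μHE[d - 1] : Measure (Space d)).restrict (frontier T)),
      ∃ a, HasTraceAt T K x a)
    (hv : M.IsPiecewise v q) {e : Set (Space d)} (he : e ∈ M.facets) {f w : Space d → ℝ}
    (hf : ∀ᵐ x ∂(μHE[d - 1] : Measure (Space d)), x ∈ e →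
      |f x| ≤ ‖M.avg e (fun y => K y (gradient v y)) x‖ * |w x|)
    (hw : IntegrableOn (fun x => w x ^ 2) e μHE[d - 1]) {δ : ℝ} (hδ : 0 < δ) :
    2 * |∫ x in e, f x ∂μHE[d - 1]| ≤
      δ * linftyNorm Ω K ^ 2
        * (∑ T ∈ M.adjacent e, ∫ x in e, ‖gradient (pol (q T)) x‖ ^ 2 ∂μHE[d - 1])
      + δ⁻¹ * ∫ x in e, w x ^ 2 ∂μHE[d - 1] := by
  have hem := (M.facet_isClosed he).measurableSet
  have hi : ∀ T ∈ M.adjacent e,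
      IntegrableOn (fun x => ‖gradient (pol (q T)) x‖ ^ 2) e μHE[d - 1] := fun T hT =>
    M.integrableOn_facet hd hT ((continuous_gradient_pol _).norm.pow 2)
  have hi' := integrable_finsetSum _ hi
  have hbd : ‖∫ x in e, f x ∂μHE[d - 1]‖ ≤ ∫ x in e, (1 / 2 * δ * linftyNorm Ω K ^ 2
      * (∑ T ∈ M.adjacent e, ‖gradient (pol (q T)) x‖ ^ 2) + 1 / 2 * δ⁻¹ * w x ^ 2)
      ∂μHE[d - 1] := by
    refine norm_integral_le_of_norm_le ((hi'.const_mul _).add (hw.const_mul _)) ?_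
    rw [ae_restrict_iff' hem]
    filter_upwards [hf, M.norm_avg_flux_sq_le hd hΩ hK hKtrace hv e] with x h1 h2 hx
    rw [Real.norm_eq_abs]
    refine (h1 hx).trans ?_
    have h3 := h2 hx
    set a := ‖M.avg e (fun y => K y (gradient v y)) x‖
    have h4 : a * |w x| ≤ 1 / 2 * δ * a ^ 2 + 1 / 2 * δ⁻¹ * w x ^ 2 := by
      have h5 : 0 ≤ δ⁻¹ * (δ * a - |w x|) ^ 2 := by positivity
      have h6 : δ⁻¹ * (δ * a - |w x|) ^ 2 = δ * a ^ 2 - 2 * (a * |w x|) + δ⁻¹ * |w x| ^ 2 := by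
        field_simp
        ring
      rw [h6, sq_abs] at h5
      linarith
    have h7 := mul_le_mul_of_nonneg_left h3 (by positivity : 0 ≤ 1 / 2 * δ)
    linarith
  rw [integral_add (hi'.const_mul _) (hw.const_mul _), integral_const_mul, integral_const_mul,
    integral_finsetSum _ hi, Real.norm_eq_abs] at hbd
  linarith

theorem integrableOn_norm_jump_sq (M : Mesh Ω) (hd : 2 ≤ d) (hv : M.IsPiecewise v q)
    {e : Set (Space d)} (he : e ∈ M.interiorFacets) :
    IntegrableOn (fun x => ‖M.jump e v x‖ ^ 2) e μHE[d - 1] := by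
  have hef := M.interior_mem_facets he
  have hem := (M.facet_isClosed hef).measurableSet
  obtain ⟨T₁, T₂, hne, hadj⟩ := M.interior_adjacent hd he
  have h1 : T₁ ∈ M.adjacent e := by rw [hadj]; simp
  refine (M.integrableOn_facet hd h1 (f := fun x => (pol (q T₁) x - pol (q T₂) x) ^ 2)
    (((continuous_pol _).sub (continuous_pol _)).pow 2)).congr ?_
  rw [EventuallyEq, ae_restrict_iff' hem]
  filter_upwards [M.jump_interior hd hv hef hne hadj, M.facet_ae_normal hd hef h1] with x hj hn hx
  rw [hj hx, norm_smul, (hn hx).1.1, mul_one, Real.norm_eq_abs, sq_abs]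

theorem integrableOn_avg_sq (M : Mesh Ω) (hd : 2 ≤ d) (hΩ : PolyDomain Ω HΩ)
    (hv : M.IsPiecewise v q) {e : Set (Space d)} (he : e ∈ M.boundaryFacets) :
    IntegrableOn (fun x => M.avg e v x ^ 2) e μHE[d - 1] := by
  obtain ⟨T, hadj⟩ := M.boundary_adjacent hd hΩ he
  have h1 : T ∈ M.adjacent e := by rw [hadj]; simp
  refine IntegrableOn.congr_fun (M.integrableOn_facet hd h1 ((continuous_pol (q T)).pow 2))
    (fun x hx => ?_) (M.facet_isClosed (M.boundary_mem_facets he)).measurableSet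
  simp only [M.avg_boundary_pol hd hv hadj hx, Pi.pow_apply]

/-- The consistency terms of the diffusion form. -/
def consistency (M : Mesh Ω) (K : Space d → Space d →L[ℝ] Space d) (ΓD : Set (Space d))
    (v : Space d → ℝ) : ℝ :=
  ∑ e ∈ M.interiorFacets,
      (∫ x in e, ⟪M.avg e (fun y => K y (gradient v y)) x, M.jump e v x⟫ ∂μHE[d - 1])
  + ∑ e ∈ M.boundaryFacetsOn ΓD,
      (∫ x in e, ⟪M.avg e (fun y => K y (gradient v y)) x, outwardNormal Ω x⟫
        * M.avg e v x ∂μHE[d - 1])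

/-- On the diagonal the nonsymmetric and the adjoint consistency terms are the same number, with
factors `-1` and `ε`; for `ε = 1` they cancel. -/
theorem aDiff_self (M : Mesh Ω) (K : Space d → Space d →L[ℝ] Space d) (ΓD : Set (Space d))
    (ε γ : ℝ) (v : Space d → ℝ) :
    M.aDiff K ΓD ε γ v v = M.normDiffSq K ΓD γ v + (ε - 1) * M.consistency K ΓD v := by
  have h1 : ∀ e x, ⟪M.jump e v x, M.avg e (fun y => K y (gradient v y)) x⟫
      = ⟪M.avg e (fun y => K y (gradient v y)) x, M.jump e v x⟫ := fun e x => real_inner_comm _ _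
  have h2 : ∀ e x, M.avg e v x * ⟪M.avg e (fun y => K y (gradient v y)) x, outwardNormal Ω x⟫
      = ⟪M.avg e (fun y => K y (gradient v y)) x, outwardNormal Ω x⟫ * M.avg e v x :=
    fun e x => mul_comm _ _
  simp only [aDiff, normDiffSq, jumpSq, consistency, real_inner_self_eq_norm_sq, ← sq]
  simp only [h1, h2]
  ring

theorem jumpSq_nonneg (M : Mesh Ω) (ΓD : Set (Space d)) {γ : ℝ} (hγ : 0 ≤ γ) (v : Space d → ℝ) :
    0 ≤ M.jumpSq ΓD γ v :=
  add_nonneg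
    (Finset.sum_nonneg fun _ _ => mul_nonneg (div_nonneg hγ diam_nonneg)
      (integral_nonneg fun _ => sq_nonneg _))
    (Finset.sum_nonneg fun _ _ => mul_nonneg (div_nonneg hγ diam_nonneg)
      (integral_nonneg fun _ => sq_nonneg _))

theorem gradient_elem_le (M : Mesh Ω) (hd : 2 ≤ d) (hΩ : PolyDomain Ω HΩ)
    {K : Space d → Space d →L[ℝ] Space d} (hK : MemLp K ∞ (volume.restrict Ω)) {kmin : ℝ}
    (hell : ∀ᵐ x ∂(volume.restrict Ω), ∀ ξ : Space d, kmin * ‖ξ‖ ^ 2 ≤ ⟪ξ, K x ξ⟫)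
    (hv : M.IsPiecewise v q) {T : Set (Space d)} (hT : T ∈ M.elems) :
    kmin * ∫ x in T, ‖gradient (pol (q T)) x‖ ^ 2
      ≤ ∫ x in T, ⟪K x (gradient v x), gradient v x⟫ := by
  have hsub := M.elem_subset hd hΩ hT
  have hbd := M.elem_bounded hd hT
  have e1 : ∫ x in T, ⟪K x (gradient v x), gradient v x⟫
      = ∫ x in T, ⟪K x (gradient (pol (q T)) x), gradient (pol (q T)) x⟫ :=
    setIntegral_congr_fun (M.elem_isOpen hd hT).measurableSet fun x hx => by
      simp only [gradient_congr_of_isOpen (M.elem_isOpen hd hT) (hv T hT) hx]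
  rw [e1, ← integral_const_mul]
  refine integral_mono_ae ((integrableOn_of_continuous hbd
    ((continuous_gradient_pol (q T)).norm.pow 2)).const_mul _)
    (integrableOn_inner_clm hsub hbd hK (continuous_gradient_pol _)) ?_
  filter_upwards [ae_mono (Measure.restrict_mono hsub le_rfl) hell] with x hx
  rw [real_inner_comm]
  exact hx _

theorem abs_consistency_le (M : Mesh Ω) (hd : 2 ≤ d) (hΩ : PolyDomain Ω HΩ)
    {K : Space d → Space d →L[ℝ] Space d} (hK : MemLp K ∞ (volume.restrict Ω)) {kmin : ℝ}
    (hkmin : 0 < kmin)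
    (hell : ∀ᵐ x ∂(volume.restrict Ω), ∀ ξ : Space d, kmin * ‖ξ‖ ^ 2 ≤ ⟪ξ, K x ξ⟫)
    (hKtrace : ∀ T ∈ M.elems, ∀ᵐ x ∂((μHE[d - 1] : Measure (Space d)).restrict (frontier T)),
      ∃ a, HasTraceAt T K x a) (ΓD : Set (Space d))
    (hdiam : ∀ e ∈ M.facets, 0 < diam e)
    {N p : ℕ} (hN : M.maxFacets ≤ N) {Ctr : ℝ} (hCtr : 0 < Ctr)
    (htr : ∀ T ∈ M.elems, ∀ q : MvPolynomial (Fin d) ℝ, q.totalDegree ≤ p →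
      ∫ x in frontier T, pol q x ^ 2 ∂μHE[d - 1] ≤ Ctr * (diam T)⁻¹ * ∫ x in T, pol q x ^ 2)
    (hv : M.IsPiecewise v q) (hq : ∀ T ∈ M.elems, (q T).totalDegree ≤ p) {γ : ℝ} (hγ : 0 < γ) :
    2 * |M.consistency K ΓD v|
      ≤ linftyNorm Ω K * Real.sqrt (N * Ctr / (γ * kmin)) * M.normDiffSq K ΓD γ v := by
  classical
  have hk : 0 ≤ linftyNorm Ω K := ENNReal.toReal_nonneg
  -- Here `A` is the broken energy and `J` the jump seminorm, whose sum is `normDiffSq`.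
  refine two_mul_le_of_young (by positivity) (fun s hs => ?_) (M.jumpSq_nonneg ΓD hγ.le v)
  rw [mul_pow, Real.sq_sqrt (by positivity)]
  set k := linftyNorm Ω K
  set D : Set (Space d) → ℝ := fun e => ∑ T ∈ M.adjacent e,
    ∫ x in e, ‖gradient (pol (q T)) x‖ ^ 2 ∂μHE[d - 1] with hD
  have hD0 : ∀ e, 0 ≤ D e := fun e => Finset.sum_nonneg fun T _ =>
    integral_nonneg fun x => sq_nonneg _
  have hI : ∀ e ∈ M.interiorFacets,
      2 * |∫ x in e, ⟪M.avg e (fun y => K y (gradient v y)) x, M.jump e v x⟫ ∂μHE[d - 1]|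
        ≤ s / γ * k ^ 2 * (diam e * D e)
          + s⁻¹ * (γ / diam e * ∫ x in e, ‖M.jump e v x‖ ^ 2 ∂μHE[d - 1]) := by
    intro e he
    have hef := M.interior_mem_facets he
    have he0 := hdiam e hef
    -- The weight `s / γ * diam e` makes `δ⁻¹` equal to `s⁻¹` times the penalty coefficient `γ /
    -- diam e`.
    refine (M.facet_young hd hΩ hK hKtrace hv hef (w := fun x => ‖M.jump e v x‖)
      (Eventually.of_forall fun x _ => ?_) (M.integrableOn_norm_jump_sq hd hv he)
      (δ := s / γ * diam e) (by positivity)).trans_eq ?_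
    · rw [abs_norm]; exact abs_real_inner_le_norm _ _
    · simp only [hD, k]; field_simp
  have hB : ∀ e ∈ M.boundaryFacetsOn ΓD,
      2 * |∫ x in e, ⟪M.avg e (fun y => K y (gradient v y)) x, outwardNormal Ω x⟫
        * M.avg e v x ∂μHE[d - 1]|
        ≤ s / γ * k ^ 2 * (diam e * D e)
          + s⁻¹ * (γ / diam e * ∫ x in e, M.avg e v x ^ 2 ∂μHE[d - 1]) := by
    intro e he
    have heb := (M.mem_boundaryFacetsOn.1 he).1
    have hef := M.boundary_mem_facets heb
    have he0 := hdiam e hef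
    refine (M.facet_young hd hΩ hK hKtrace hv hef (w := fun x => M.avg e v x)
      (Eventually.of_forall fun x _ => ?_) (M.integrableOn_avg_sq hd hΩ hv heb)
      (δ := s / γ * diam e) (by positivity)).trans_eq ?_
    · rw [abs_mul]
      gcongr
      refine (abs_real_inner_le_norm _ _).trans ?_
      -- The bound on `outwardNormal` holds at every point, its default value being `0`.
      exact mul_le_of_le_one_right (norm_nonneg _) (norm_outwardNormal_le _ _)
    · simp only [hD, k]; field_simp
  have hsumI := Finset.sum_le_sum hI
  have hsumB := Finset.sum_le_sum hB
  rw [← Finset.mul_sum, Finset.sum_add_distrib, ← Finset.mul_sum, ← Finset.mul_sum]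
    at hsumI hsumB
  have habs : |M.consistency K ΓD v| ≤
      ∑ e ∈ M.interiorFacets,
        |∫ x in e, ⟪M.avg e (fun y => K y (gradient v y)) x, M.jump e v x⟫ ∂μHE[d - 1]|
      + ∑ e ∈ M.boundaryFacetsOn ΓD,
        |∫ x in e, ⟪M.avg e (fun y => K y (gradient v y)) x, outwardNormal Ω x⟫
          * M.avg e v x ∂μHE[d - 1]| :=
    (abs_add_le _ _).trans (add_le_add (Finset.abs_sum_le_sum_abs _ _)
      (Finset.abs_sum_le_sum_abs _ _))
  have hDsum : ∑ e ∈ M.interiorFacets, diam e * D e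
      + ∑ e ∈ M.boundaryFacetsOn ΓD, diam e * D e
      ≤ N * Ctr / kmin * ∑ T ∈ M.elems, (∫ x in T, ⟪K x (gradient v x), gradient v x⟫) := by
    -- Adding the nonnegative terms of the other boundary facets completes the sum over all facets,
    -- which can then be rearranged by elements.
    calc _ ≤ ∑ e ∈ M.interiorFacets, diam e * D e + ∑ e ∈ M.boundaryFacets, diam e * D e := by
          refine add_le_add le_rfl (Finset.sum_le_sum_of_subset_of_nonneg
            (fun e he => (M.mem_boundaryFacetsOn.1 he).1) fun e _ _ =>
              mul_nonneg diam_nonneg (hD0 e))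
      _ = ∑ T ∈ M.elems, ∑ e ∈ M.facetsOf T,
            diam e * ∫ x in e, ‖gradient (pol (q T)) x‖ ^ 2 ∂μHE[d - 1] := by
          rw [← M.sum_facets hd hΩ, M.sum_elems_facetsOf]
          simp only [hD, Finset.mul_sum]
      _ ≤ _ := by
          rw [Finset.mul_sum]
          refine Finset.sum_le_sum fun T hT => ?_
          refine (M.sum_facetsOf_gradient_le hd hT hN (htr T hT) (hq T hT)).trans ?_
          have h1 := M.gradient_elem_le hd hΩ hK hell hv hT
          rw [div_mul_eq_mul_div, le_div_iff₀ hkmin, mul_assoc]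
          refine mul_le_mul_of_nonneg_left ?_ (by positivity)
          linarith
  have hfin := mul_le_mul_of_nonneg_left hDsum (by positivity : 0 ≤ s / γ * k ^ 2)
  rw [jumpSq]
  have hrew : s / γ * k ^ 2 * (N * Ctr / kmin
        * ∑ T ∈ M.elems, (∫ x in T, ⟪K x (gradient v x), gradient v x⟫))
      = s * (k ^ 2 * (N * Ctr / (γ * kmin)))
        * ∑ T ∈ M.elems, (∫ x in T, ⟪K x (gradient v x), gradient v x⟫) := by
    field_simp
  rw [hrew] at hfin
  linarith

/-- Coercivity of the diffusion form. -/
theorem aDiff_coercive (M : Mesh Ω) {K : Space d → Space d →L[ℝ] Space d} {ΓD : Set (Space d)}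
    {c N Ctr kmin γ : ℝ}
    (h : 2 * |M.consistency K ΓD v|
      ≤ c * Real.sqrt (N * Ctr / (γ * kmin)) * M.normDiffSq K ΓD γ v)
    {ε : ℤ} (hε : ε = -1 ∨ ε = 0 ∨ ε = 1) :
    alphaDiff ε c N Ctr kmin γ * M.normDiffSq K ΓD γ v ≤ M.aDiff K ΓD ε γ v v := by
  have h1 := le_abs_self (M.consistency K ΓD v)
  rw [aDiff_self, alphaDiff]
  rcases hε with rfl | rfl | rfl
  · norm_num
    linarith
  · norm_num
    linarith
  · norm_num

end Mesh

/-! ### Coercivity of the full form -/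

theorem gammaThreshold_nonneg (ε : ℤ) {k N Ctr kmin : ℝ} (hN : 0 ≤ N) (hCtr : 0 < Ctr)
    (hkmin : 0 < kmin) : 0 ≤ gammaThreshold ε k N Ctr kmin := by
  unfold gammaThreshold
  split_ifs <;> positivity

theorem alphaDiff_pos {ε : ℤ} (hε : ε = -1 ∨ ε = 0 ∨ ε = 1) {k N Ctr kmin γ : ℝ}
    (hN : 0 ≤ N) (hCtr : 0 < Ctr) (hkmin : 0 < kmin)
    (hγ : gammaThreshold ε k N Ctr kmin < γ) : 0 < alphaDiff ε k N Ctr kmin γ := by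
  have hγ0 : 0 < γ := (gammaThreshold_nonneg ε hN hCtr hkmin).trans_lt hγ
  -- Positivity of `alphaDiff` means that `k * √(N * Ctr / (γ * kmin))` is below `1` for `ε = -1`
  -- and below `2` for `ε = 0`. These are the two uses of `m`, and `2 ^ 2` is the `4` in the second
  -- threshold.
  have hsqrt : ∀ m : ℝ, 0 < m → k ^ 2 * (N * Ctr / (m ^ 2 * kmin)) < γ →
      k * Real.sqrt (N * Ctr / (γ * kmin)) < m := by
    intro m hm h
    refine lt_of_pow_lt_pow_left₀ 2 hm.le ?_
    rw [mul_pow, Real.sq_sqrt (by positivity)]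
    calc k ^ 2 * (N * Ctr / (γ * kmin)) = k ^ 2 * (N * Ctr / (m ^ 2 * kmin)) * (m ^ 2 / γ) := by
          field_simp
      _ < γ * (m ^ 2 / γ) := by gcongr
      _ = m ^ 2 := by field_simp
  rcases hε with rfl | rfl | rfl
  · have h := hsqrt 1 one_pos (by simpa [gammaThreshold] using hγ)
    norm_num [alphaDiff]
    linarith
  · have h := hsqrt 2 two_pos (by norm_num [gammaThreshold] at hγ ⊢; exact hγ)
    norm_num [alphaDiff]
    linarith
  · norm_num [alphaDiff]

namespace Mesh

variable {d : ℕ} {Ω : Set (Space d)}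

theorem exists_elem_of_facet (M : Mesh Ω) {e : Set (Space d)} (he : e ∈ M.facets) :
    ∃ T ∈ M.elems, e ∈ M.facetsOf T := by
  rcases M.conforming e he with ⟨T, hT, _, _, _, h⟩ | ⟨T, hT, h⟩
  · exact ⟨T, hT, M.mem_facetsOf.2 ⟨he, h ▸ inter_subset_left⟩⟩
  · exact ⟨T, hT, M.mem_facetsOf.2 ⟨he, h.trans inter_subset_left⟩⟩

/-- A bounded nonempty element is not the whole space, hence has a boundary point, and this lies on
a facet. -/
theorem exists_facet (M : Mesh Ω) (hd : 1 ≤ d) (hΩ : Ω.Nonempty) : ∃ e, e ∈ M.facets := by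
  obtain ⟨x, hx⟩ := hΩ
  have hxc : x ∈ closure Ω := subset_closure hx
  rw [M.cover] at hxc
  obtain ⟨T, hT, hxT⟩ := mem_iUnion₂.1 hxc
  obtain ⟨-, hTb, hTc, -⟩ := (M.elem_polytope T hT).full hd
  have : Nonempty (Fin d) := ⟨⟨0, hd⟩⟩
  have hne : T ≠ univ := by
    rintro rfl
    exact NormedSpace.unbounded_univ ℝ (Space d) hTb
  obtain ⟨y, hy⟩ := nonempty_frontier_iff.2 ⟨hTc.nonempty, hne⟩
  rw [M.frontier_eq T hT] at hy
  obtain ⟨e, he, -⟩ := mem_iUnion₂.1 hy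
  exact ⟨e, he⟩

end Mesh

/-- From `0 < diam T ≤ C * diam e`. The positivity matters because `γ / diam e` would otherwise take
the value `0` and the penalty would vanish. -/
theorem Graded.diam_facet_pos {d : ℕ} {Ω : Set (Space d)} {ι : Type*} {M : ι → Mesh Ω}
    (h : Graded M) (hd : 1 ≤ d) (i : ι) {e : Set (Space d)} (he : e ∈ (M i).facets) :
    0 < diam e := by
  obtain ⟨C, hC, h⟩ := h
  obtain ⟨T, hT, heT⟩ := (M i).exists_elem_of_facet he
  obtain ⟨hTo, hTb, hTc, -⟩ := ((M i).elem_polytope T hT).full hd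
  exact pos_of_mul_pos_right
    ((diam_pos_of_isOpen hd hTo hTb hTc.nonempty).trans_le (h i T hT e heT)) hC.le

/-- Facets of one-dimensional meshes are points, which gradedness excludes. -/
theorem Graded.two_le {d : ℕ} {Ω : Set (Space d)} {ι : Type*} {M : ι → Mesh Ω}
    (h : Graded M) (hd : 1 ≤ d) (hΩ : Ω.Nonempty) (i : ι) : 2 ≤ d := by
  by_contra hcon
  obtain rfl : d = 1 := by omega
  obtain ⟨e, he⟩ := (M i).exists_facet hd hΩ
  have hpos := h.diam_facet_pos hd i he
  obtain ⟨F, ⟨x, rfl⟩, rfl⟩ := (M i).facet_polytope e he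
  simp at hpos

namespace Mesh

variable {d : ℕ} {Ω : Set (Space d)}

theorem exists_isPiecewise (M : Mesh Ω) {p : ℕ} {v : Space d → ℝ} (hv : v ∈ M.brokenPoly p) :
    ∃ q : Set (Space d) → MvPolynomial (Fin d) ℝ, M.IsPiecewise v q ∧
      ∀ T ∈ M.elems, (q T).totalDegree ≤ p := by
  choose! q hq using (show ∀ T ∈ M.elems, ∃ q : MvPolynomial (Fin d) ℝ, q.totalDegree ≤ p ∧
    ∀ x ∈ T, v x = MvPolynomial.eval (fun i => x i) q from hv)
  exact ⟨q, fun T hT => (hq T hT).2, fun T hT => (hq T hT).1⟩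

end Mesh

end DG

end

/-! ### The discrete coercivity theorem -/

theorem lemma4p3 {d : ℕ} (hd : 1 ≤ d)
    -- the domain and the two parts of its boundary
    (Ω : Set (DG.Space d)) (hΩ : DG.IsPolytope d Ω)
    (ΓD ΓN : Set (DG.Space d)) (hΓ : ΓD ∪ ΓN = frontier Ω) (hΓdisj : Disjoint ΓD ΓN)
    -- the coefficients
    (K : DG.Space d → DG.Space d →L[ℝ] DG.Space d)
    (β : DG.Space d → DG.Space d) (σ : DG.Space d → ℝ)
    (hK : MemLp K ∞ (volume.restrict Ω))
    (hβ : ∀ j, DG.MemW1Infty Ω (fun x => β x j))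
    (hσ : MemLp σ ∞ (volume.restrict Ω))
    (kmin : ℝ) (hkmin : 0 < kmin)
    (hell : ∀ᵐ x ∂(volume.restrict Ω), ∀ ξ : DG.Space d, kmin * ‖ξ‖ ^ 2 ≤ ⟪ξ, K x ξ⟫)
    (σ₀ : ℝ) (hσ₀ : 0 < σ₀)
    (hdiv : ∀ᵐ x ∂(volume.restrict Ω), σ₀ ≤ σ x + 1 / 2 * DG.weakDiv Ω β x)
    (hflow : ¬ β =ᵐ[volume.restrict Ω] 0 →
      ∀ᵐ x ∂((μHE[d - 1] : Measure (DG.Space d)).restrict (frontier Ω)),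
        (x ∈ ΓD → ⟪DG.trace Ω β x, DG.outwardNormal Ω x⟫ < 0) ∧
        (x ∈ ΓN → 0 ≤ ⟪DG.trace Ω β x, DG.outwardNormal Ω x⟫))
    -- the family of meshes
    {ι : Type*} (M : ι → DG.Mesh Ω) (hstar : DG.StarShaped M) (hgraded : DG.Graded M)
    (hDN : ∀ i, ∀ e ∈ (M i).boundaryFacets,
      e ∈ (M i).boundaryFacetsOn ΓD ∨ e ∈ (M i).boundaryFacetsOn ΓN)
    (N : ℕ) (hN : ∀ i, (M i).maxFacets ≤ N)
    -- the traces of the diffusion matrix on the element boundaries exist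
    (hKtrace : ∀ i, ∀ T ∈ (M i).elems,
      ∀ᵐ x ∂((μHE[d - 1] : Measure (DG.Space d)).restrict (frontier T)),
        ∃ a, DG.HasTraceAt T K x a)
    -- the discrete spaces
    (p : ℕ) (Vh : ι → Submodule ℝ (DG.Space d → ℝ)) (hVh : ∀ i, Vh i ≤ (M i).brokenPoly p) :
    (∃ Ctr : ℝ, 0 < Ctr ∧ DG.DiscreteTraceInequality M p Ctr) ∧
    ∀ Ctr : ℝ, 0 < Ctr → DG.DiscreteTraceInequality M p Ctr →
    ∀ ε : ℤ, (ε = -1 ∨ ε = 0 ∨ ε = 1) →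
    ∀ γ : ℝ, DG.gammaThreshold ε (DG.linftyNorm Ω K) N Ctr kmin < γ →
      0 < min 1 (min σ₀ (DG.alphaDiff ε (DG.linftyNorm Ω K) N Ctr kmin γ)) ∧
      ∀ i, ∀ v ∈ Vh i,
        min 1 (min σ₀ (DG.alphaDiff ε (DG.linftyNorm Ω K) N Ctr kmin γ))
            * (M i).normDarSq K β ΓD γ v
          ≤ (M i).aDar K β σ ΓD ΓN ε γ v v := by
  have hdom := hΩ.full hd
  -- Only an actual mesh forces `2 ≤ d`; for an empty family the trace inequality is vacuous.
  have htwo : ∀ _ : ι, 2 ≤ d := fun i => hgraded.two_le hd hdom.2.2.1.nonempty i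
  refine ⟨?_, fun Ctr hCtr htr ε hε γ hγ => ⟨?_, fun i v hv => ?_⟩⟩
  · rcases isEmpty_or_nonempty ι with hι | ⟨⟨i⟩⟩
    · exact ⟨1, one_pos, fun i => hι.elim i⟩
    · exact DG.exists_discreteTraceInequality (htwo i) M hstar p
  · exact lt_min one_pos (lt_min hσ₀ (DG.alphaDiff_pos hε N.cast_nonneg hCtr hkmin hγ))
  · have hγ0 : 0 < γ := (DG.gammaThreshold_nonneg ε N.cast_nonneg hCtr hkmin).trans_lt hγ
    obtain ⟨H, hPD⟩ := hΩ.exists_polyDomain (htwo i)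
    obtain ⟨q, hq, hqdeg⟩ := (M i).exists_isPiecewise (hVh i hv)
    have hcons := (M i).abs_consistency_le (htwo i) hPD hK hkmin hell (hKtrace i) ΓD
      (fun e he => hgraded.diam_facet_pos hd i he) (hN i) hCtr (htr i) hq hqdeg hγ0
    have hdiff := (M i).aDiff_coercive hcons hε
    have hadv := (M i).aAdvReac_coercive (htwo i) hPD hΓdisj hβ hσ hdiv hflow (hDN i) hq
    -- The norm has three parts, with coercivity constants `alphaDiff`, `σ₀` and `1`. Each part is
    -- nonnegative, so every constant may be lowered to the minimum.
    have hA : 0 ≤ (M i).normDiffSq K ΓD γ v := by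
      refine add_nonneg (Finset.sum_nonneg fun T hT => ?_) ((M i).jumpSq_nonneg ΓD hγ0.le v)
      exact (mul_nonneg hkmin.le (integral_nonneg fun x => sq_nonneg _)).trans
        ((M i).gradient_elem_le (htwo i) hPD hK hell hq hT)
    have hL : 0 ≤ ∫ x in Ω, v x ^ 2 := integral_nonneg fun x => sq_nonneg _
    have hJ : 0 ≤ ∑ e ∈ (M i).facets, (∫ x in e, |⟪DG.trace Ω β x, (M i).normal e⟫|
        * ‖(M i).jump e v x‖ ^ 2 ∂μHE[d - 1]) :=
      Finset.sum_nonneg fun e _ => integral_nonneg fun x => by positivity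
    set α := min 1 (min σ₀ (DG.alphaDiff ε (DG.linftyNorm Ω K) N Ctr kmin γ)) with hα
    have hα1 : α ≤ 1 := min_le_left _ _
    have hα2 : α ≤ σ₀ := (min_le_right _ _).trans (min_le_left _ _)
    have hα3 : α ≤ DG.alphaDiff ε (DG.linftyNorm Ω K) N Ctr kmin γ :=
      (min_le_right _ _).trans (min_le_right _ _)
    rw [DG.Mesh.normDarSq, DG.Mesh.normAdvReacSq, DG.Mesh.aDar]
    have h1 := mul_le_mul_of_nonneg_right hα3 hA
    have h2 := mul_le_mul_of_nonneg_right hα2 hL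
    have h3 := mul_le_mul_of_nonneg_right hα1 hJ
    linarith
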